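/- Let $v$ be the valuation on $\bar{\mathbb Q}_2$ with $v(2)=1$, let $\bar{\mathbb Z}_2$ be its ring of integers and $\bar{\mathbb F}_2$ its residue field, and let $G=\mathrm{GL}_2(\mathbb Q_2)$, $K=\mathrm{GL}_2(\mathbb Z_2)$. For a $\mathbb Z_2$-algebra $R$ let $\mathrm{Sym}^rR^2$ be the space of homogeneous polynomials of degree $r$ in $X,Y$ over $R$, with $K$ acting by $\begin{pmatrix}a&b\\c&d\end{pmatrix}f(X,Y)=f(aX+cY,bX+dY)$ and the scalar matrix $2$ acting trivially, and let $\mathcal I(\mathrm{Sym}^rR^2)$ be its compact induction from $K\mathbb Q_2^\times$ to $G$, that is, the functions $f:G\to\mathrm{Sym}^rR^2$ with $f(hg)=h\cdot f(g)$ for $h\in K\mathbb Q_2^\times$ which are supported on finitely many cosets $K\mathbb Q_2^\times g$; $G$ acts by right translation. Let $[g,w]$ be the function supported on $K\mathbb Q_2^\times g^{-1}$ with $[g,w](g')=(g'g)\cdot w$ there, and let $T$ be the $G$- and $R$-linear Hecke operator with $$T[g,w(X,Y)]=\sum_{\mu\in\{0,1\}}\Big[g\begin{pmatrix}2&\mu\\0&1\end{pmatrix},w(X,2Y-\mu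 X)\Big]+\Big[g\begin{pmatrix}1&0\\0&2\end{pmatrix},w(2X,Y)\Big].$$ Put $V_r=\mathrm{Sym}^r\bar{\mathbb F}_2^2$. Let $k=r+2\ge4$ be an integer and let $a_2\in\bar{\mathbb Q}_2$ satisfy $0<v(a_2)<1$. Put $$\Theta_{k,a_2}=\frac{\mathcal I(\mathrm{Sym}^r\bar{\mathbb Z}_2^2)}{(T-a_2)\big(\mathcal I(\mathrm{Sym}^r\bar{\mathbb Q}_2^2)\big)\cap\mathcal I(\mathrm{Sym}^r\bar{\mathbb Z}_2^2)},\qquad \bar\Theta_{k,a_2}=\Theta_{k,a_2}\otimes_{\bar{\mathbb Z}_2}\bar{\mathbb F}_2,$$ $$\alpha'=\frac{a_2^2-2r^2}{2a_2},\qquad \tau'=v(\alpha')\in\mathbb R\cup\{\infty\},\qquad t=v(r-1).$$ There is a unique $\bar{\mathbb F}_2$-linear map $\mathcal I(V_r)\to\bar\Theta_{k,a_2}$ sending the reduction of each $f\in\mathcal I(\mathrm{Sym}^r\bar{\mathbb Z}_2^2)$ to the class of $f$. It factors, uniquely, as the map $\mathcal I(V_r)\to\mathcal I(V_0)$ induced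 by the $K$-linear map $V_r\to V_0$, $\sum_jc_jX^{r-j}Y^j\mapsto\sum_{1\le j\le r-1}c_j$, followed by a map $P:\mathcal I(V_0)\to\bar\Theta_{k,a_2}$, and $P$ is surjective and $G$-equivariant. Moreover: 1. if $\tau'<t$, then $P$ factors through $\mathcal I(V_0)/(T)$; 2. if $\tau'\ge t$, then $\alpha'/(r-1)\in\bar{\mathbb Z}_2$ and $P$ factors through $\mathcal I(V_0)/(T^2-cT+1)$, where $c\in\bar{\mathbb F}_2$ is the reduction of $\alpha'/(r-1)$. Here $(S)$ denotes the image $S(\mathcal I(V_0))$ of an operator $S$. -/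

import Mathlib

open scoped TensorProduct
open MvPolynomial (C X)

noncomputable section

namespace TreeInd

/-! ### Symmetric powers -/

/-- `Sym^r R^2`: homogeneous polynomials of degree `r` in `X = X 0`, `Y = X 1` over `R`. -/
def SymPow (R : Type*) [CommRing R] (r : ℕ) : Type _ :=
  ↥(MvPolynomial.homogeneousSubmodule (Fin 2) R r)

instance (R : Type*) [CommRing R] (r : ℕ) : AddCommGroup (SymPow R r) :=
  inferInstanceAs (AddCommGroup ↥(MvPolynomial.homogeneousSubmodule (Fin 2) R r))

instance (R S : Type*) [CommRing R] [CommRing S] [Algebra R S] (r : ℕ) :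
    Module R (SymPow S r) :=
  inferInstanceAs (Module R ↥(MvPolynomial.homogeneousSubmodule (Fin 2) S r))

instance (R S : Type*) [CommRing R] [CommRing S] [Algebra R S] (r : ℕ) :
    IsScalarTower R S (SymPow S r) :=
  inferInstanceAs (IsScalarTower R S ↥(MvPolynomial.homogeneousSubmodule (Fin 2) S r))

/-- The linear form substituted for the `j`-th variable: for `M = (a b; c d)` these are
`aX + cY` and `bX + dY`. -/
def linForm {R : Type*} [CommRing R] (M : Matrix (Fin 2) (Fin 2) R) (j : Fin 2) :
    MvPolynomial (Fin 2) R :=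
  ∑ i, C (M i j) * X i

theorem linForm_isHomogeneous {R : Type*} [CommRing R] (M : Matrix (Fin 2) (Fin 2) R)
    (j : Fin 2) : (linForm M j).IsHomogeneous 1 := by
  refine MvPolynomial.IsHomogeneous.sum _ _ _ fun i _ => ?_
  simpa using (MvPolynomial.isHomogeneous_C (Fin 2) (M i j)).mul (MvPolynomial.isHomogeneous_X R i)

theorem aeval_linForm {R : Type*} [CommRing R] (M N : Matrix (Fin 2) (Fin 2) R) (j : Fin 2) :
    MvPolynomial.aeval (linForm M) (linForm N j) = linForm (M * N) j := by
  simp only [linForm, Fin.sum_univ_two, map_add, map_mul, MvPolynomial.aeval_X, Matrix.mul_apply,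
    MvPolynomial.algHom_C, MvPolynomial.algebraMap_eq]
  ring

theorem aeval_linForm_mem {R : Type*} [CommRing R] {r : ℕ} (M : Matrix (Fin 2) (Fin 2) R)
    {f : MvPolynomial (Fin 2) R} (hf : f ∈ MvPolynomial.homogeneousSubmodule (Fin 2) R r) :
    MvPolynomial.aeval (linForm M) f ∈ MvPolynomial.homogeneousSubmodule (Fin 2) R r := by
  have hf' : f.IsHomogeneous r := hf
  have := hf'.aeval (linForm M) (linForm_isHomogeneous M)
  rw [one_mul] at this
  exact this

theorem aeval_linForm_one {R : Type*} [CommRing R] (f : MvPolynomial (Fin 2) R) :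
    MvPolynomial.aeval (linForm (1 : Matrix (Fin 2) (Fin 2) R)) f = f := by
  have : linForm (1 : Matrix (Fin 2) (Fin 2) R) = X := by
    funext j
    simp [linForm, Matrix.one_apply]
  rw [this, MvPolynomial.aeval_X_left_apply]

theorem aeval_linForm_mul {R : Type*} [CommRing R] (M N : Matrix (Fin 2) (Fin 2) R)
    (f : MvPolynomial (Fin 2) R) :
    MvPolynomial.aeval (linForm (M * N)) f =
      MvPolynomial.aeval (linForm M) (MvPolynomial.aeval (linForm N) f) := by
  have h : MvPolynomial.aeval (R := R) (linForm (M * N)) =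
      (MvPolynomial.aeval (R := R) (linForm M)).comp (MvPolynomial.aeval (linForm N)) := by
    apply MvPolynomial.algHom_ext
    intro j
    rw [AlgHom.comp_apply, MvPolynomial.aeval_X, MvPolynomial.aeval_X, aeval_linForm]
  exact DFunLike.congr_fun h f

/-- The action `((a b; c d) · f)(X, Y) = f (aX + cY, bX + dY)` of `2 × 2` matrices on
`Sym^r R^2`. -/
def symAct (R : Type*) [CommRing R] (r : ℕ) :
    Matrix (Fin 2) (Fin 2) R →* Module.End R (SymPow R r) where
  toFun M :=
    { toFun := fun f => ⟨MvPolynomial.aeval (linForm M) f.1, aeval_linForm_mem M f.2⟩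
      map_add' := fun _ _ => Subtype.ext (map_add _ _ _)
      map_smul' := fun _ _ => Subtype.ext (map_smul _ _ _) }
  map_one' := LinearMap.ext fun f => Subtype.ext (aeval_linForm_one f.1)
  map_mul' M N := LinearMap.ext fun f => Subtype.ext (aeval_linForm_mul M N f.1)

theorem coe_symAct {R : Type*} [CommRing R] {r : ℕ} (M : Matrix (Fin 2) (Fin 2) R)
    (f : SymPow R r) :
    (symAct R r M f).1 = MvPolynomial.aeval (linForm M) f.1 := rfl

/-! ### The groups `G ⊇ K Q_2^× ⊇ K` -/

/-- `G = GL_2(ℚ_2)`. -/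
abbrev G : Type := GL (Fin 2) ℚ_[2]

/-- `K = GL_2(ℤ_2)`. -/
abbrev K : Type := GL (Fin 2) ℤ_[2]

/-- The inclusion of `K` in `G`. -/
def KtoG : K →* G := Matrix.GeneralLinearGroup.map (algebraMap ℤ_[2] ℚ_[2])

/-- The scalar matrix `2` in `G`. -/
def two : G := Matrix.GeneralLinearGroup.scalar (Fin 2) (Units.mk0 (2 : ℚ_[2]) two_ne_zero)

/-- The subgroup `K Q_2^×` of `G`. -/
def KZ : Subgroup G := KtoG.range ⊔ (Matrix.GeneralLinearGroup.scalar (Fin 2)).range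

/-- Integral matrices acting on `Sym^r R^2`, for a `ℤ_2`-algebra `R`. -/
def symInt (R : Type*) [CommRing R] [Algebra ℤ_[2] R] (r : ℕ) :
    Matrix (Fin 2) (Fin 2) ℤ_[2] →* Module.End R (SymPow R r) :=
  (symAct R r).comp (algebraMap ℤ_[2] R).mapMatrix.toMonoidHom

/-- The action of `K` on `Sym^r R^2`, for a `ℤ_2`-algebra `R`. -/
def symRep (R : Type*) [CommRing R] [Algebra ℤ_[2] R] (r : ℕ) :
    Representation R K (SymPow R r) :=
  (symInt R r).comp (Units.coeHom (Matrix (Fin 2) (Fin 2) ℤ_[2]))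

theorem symRep_apply {R : Type*} [CommRing R] [Algebra ℤ_[2] R] {r : ℕ} (k : K) :
    symRep R r k = symInt R r k.1 := rfl

/-! ### Compact induction -/

/-- The compact induction `I(Sym^r R^2)` from `K Q_2^×` to `G`, where the scalar matrix `2` acts
trivially on `Sym^r R^2`: functions `f` on `G` with `f(hg) = h · f(g)` for `h ∈ K Q_2^×`
(this group is generated by `K` and the scalar `2`), whose support lies in
finitely many cosets `K Q_2^× x`, i.e. is compact modulo the centre. -/
def ind (R : Type*) [CommRing R] [Algebra ℤ_[2] R] (r : ℕ) :
    Submodule R (G → SymPow R r) where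
  carrier := {f | (∀ (k : K) (g : G), f (KtoG k * g) = symRep R r k (f g)) ∧
    (∀ g : G, f (two * g) = f g) ∧
    ∃ s : Finset G, ∀ g : G, f g ≠ 0 → ∃ h ∈ KZ, ∃ x ∈ s, g = h * x}
  add_mem' := by
    classical
    rintro f f' ⟨h1, h2, s, hs⟩ ⟨h1', h2', s', hs'⟩
    refine ⟨fun k g => by simp [h1, h1'], fun g => by simp [h2, h2'], s ∪ s', fun g hg => ?_⟩
    by_cases h : f g = 0
    · have : f' g ≠ 0 := fun h' => hg (by simp [h, h'])
      obtain ⟨a, ha, x, hx, e⟩ := hs' g this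
      exact ⟨a, ha, x, Finset.mem_union_right _ hx, e⟩
    · obtain ⟨a, ha, x, hx, e⟩ := hs g h
      exact ⟨a, ha, x, Finset.mem_union_left _ hx, e⟩
  zero_mem' := ⟨fun k g => by simp, fun g => rfl, ∅, fun g hg => absurd rfl hg⟩
  smul_mem' := by
    rintro c f ⟨h1, h2, s, hs⟩
    refine ⟨fun k g => by simp [h1], fun g => by simp [h2], s, fun g hg => hs g fun h => hg ?_⟩
    simp [h]

/-- `G` acts on `I(Sym^r R^2)` by right translation. -/
def indRep (R : Type*) [CommRing R] [Algebra ℤ_[2] R] (r : ℕ) :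
    Representation R G (ind R r) where
  toFun g := LinearMap.restrict (LinearMap.funLeft R (SymPow R r) (fun x : G => x * g)) (by
    rintro f ⟨h1, h2, s, hs⟩
    classical
    refine ⟨fun k x => ?_, fun x => ?_, s.image (fun x => x * g⁻¹), fun x hx => ?_⟩
    · simp [LinearMap.funLeft_apply, mul_assoc, h1]
    · simp [LinearMap.funLeft_apply, mul_assoc, h2]
    · obtain ⟨a, ha, y, hy, e⟩ := hs (x * g) hx
      exact ⟨a, ha, y * g⁻¹, Finset.mem_image_of_mem _ hy, by
        rw [← mul_assoc, ← e, mul_inv_cancel_right]⟩)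
  map_one' := by
    ext1 f
    apply Subtype.ext
    funext x
    simp [LinearMap.restrict_apply, LinearMap.funLeft_apply]
  map_mul' g g' := by
    ext1 f
    apply Subtype.ext
    funext x
    simp [LinearMap.restrict_apply, LinearMap.funLeft_apply, mul_assoc]

theorem indRep_apply {R : Type*} [CommRing R] [Algebra ℤ_[2] R] {r : ℕ} (g : G) (f : ind R r)
    (x : G) : (indRep R r g f).1 x = f.1 (x * g) := rfl

/-! ### The Hecke operator -/

/-- Representatives `(2 0; 0 1)`, `(2 1; 0 1)`, `(1 0; 0 2)` of the cosets `m K` in the double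
coset `K (2 0; 0 1) K`. -/
def heckeMat : Fin 3 → Matrix (Fin 2) (Fin 2) ℤ_[2] :=
  ![!![2, 0; 0, 1], !![2, 1; 0, 1], !![1, 0; 0, 2]]

theorem det_heckeMat (i : Fin 3) : (heckeMat i).det = 2 := by
  fin_cases i <;> simp [heckeMat, Matrix.det_fin_two]

/-- The matrices `heckeMat i` as elements of `G`. -/
def heckeG (i : Fin 3) : G :=
  Matrix.GeneralLinearGroup.mkOfDetNeZero ((algebraMap ℤ_[2] ℚ_[2]).mapMatrix (heckeMat i)) (by
    rw [← RingHom.map_det, det_heckeMat]; simp)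

theorem two_dvd_or (a : ℤ_[2]) : (2 ∣ a) ∨ (2 ∣ a - 1) := by
  have key : ∀ b : ℤ_[2], PadicInt.toZMod b = 0 → 2 ∣ b := by
    intro b hb
    have : b ∈ RingHom.ker (PadicInt.toZMod (p := 2)) := hb
    rw [PadicInt.ker_toZMod, PadicInt.maximalIdeal_eq_span_p, Ideal.mem_span_singleton] at this
    simpa using this
  have h : ∀ z : ZMod 2, z = 0 ∨ z - 1 = 0 := by decide
  rcases h (PadicInt.toZMod a) with h | h
  · exact Or.inl (key _ h)
  · exact Or.inr (key _ (by simpa using h))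

theorem not_two_isUnit : ¬ IsUnit (2 : ℤ_[2]) := by
  have := (PadicInt.prime_p (p := 2)).not_isUnit
  simpa using this

theorem exists_heckeMat_mul (N : Matrix (Fin 2) (Fin 2) ℤ_[2]) (u : ℤ_[2]) (hu : IsUnit u)
    (hN : N.det = 2 * u) : ∃ (j : Fin 3) (k : K), N = heckeMat j * k.1 := by
  suffices h : ∃ (j : Fin 3) (N' : Matrix (Fin 2) (Fin 2) ℤ_[2]), N = heckeMat j * N' by
    obtain ⟨j, N', e⟩ := h
    have : N'.det = u := by
      have h2 : (2 : ℤ_[2]) * N'.det = 2 * u := by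
        rw [← hN, e, Matrix.det_mul, det_heckeMat]
      exact mul_left_cancel₀ two_ne_zero h2
    exact ⟨j, Matrix.GeneralLinearGroup.mk'' N' (this ▸ hu), e⟩
  have hd : (2 : ℤ_[2]) ∣ N 0 0 * N 1 1 - N 0 1 * N 1 0 := by
    rw [← Matrix.det_fin_two, hN]; exact dvd_mul_right _ _
  have h1 : (2 ∣ N 0 0 ∧ 2 ∣ N 0 1) ∨ (2 ∣ N 1 0 ∧ 2 ∣ N 1 1) ∨
      (2 ∣ N 0 0 - N 1 0 ∧ 2 ∣ N 0 1 - N 1 1) := by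
    have hn1 : ¬ (2 : ℤ_[2]) ∣ 1 := fun h => not_two_isUnit (isUnit_of_dvd_one h)
    generalize N 0 0 = a at *
    generalize N 0 1 = b at *
    generalize N 1 0 = c at *
    generalize N 1 1 = d at *
    have hsub : ∀ x y : ℤ_[2], 2 ∣ x - 1 → 2 ∣ y - 1 → 2 ∣ x - y := fun x y hx hy => by
      have := dvd_sub hx hy
      rwa [sub_sub_sub_cancel_right] at this
    have hodd : ∀ x y : ℤ_[2], 2 ∣ x - 1 → 2 ∣ y - 1 → ¬ 2 ∣ x * y := fun x y hx hy h => by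
      rcases (PadicInt.prime_p (p := 2)).dvd_or_dvd (by simpa using h) with h | h
      · exact hn1 (by have h' := dvd_sub (a := (2 : ℤ_[2])) (by simpa using h) hx; rwa [sub_sub_cancel] at h')
      · exact hn1 (by have h' := dvd_sub (a := (2 : ℤ_[2])) (by simpa using h) hy; rwa [sub_sub_cancel] at h')
    have hev1 : ∀ x y : ℤ_[2], 2 ∣ x → 2 ∣ x * y := fun x y h => h.mul_right y
    have hev2 : ∀ x y : ℤ_[2], 2 ∣ y → 2 ∣ x * y := fun x y h => h.mul_left x
    have hiff : 2 ∣ a * d ↔ 2 ∣ b * c := (dvd_iff_dvd_of_dvd_sub hd)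
    rcases two_dvd_or a with ha | ha <;> rcases two_dvd_or b with hb | hb <;>
      rcases two_dvd_or c with hc | hc <;> rcases two_dvd_or d with hd | hd <;>
      first
        | exact Or.inl ⟨ha, hb⟩
        | exact Or.inr (Or.inl ⟨hc, hd⟩)
        | exact Or.inr (Or.inr ⟨dvd_sub ha hc, dvd_sub hb hd⟩)
        | exact Or.inr (Or.inr ⟨dvd_sub ha hc, hsub _ _ hb hd⟩)
        | exact Or.inr (Or.inr ⟨hsub _ _ ha hc, dvd_sub hb hd⟩)
        | exact Or.inr (Or.inr ⟨hsub _ _ ha hc, hsub _ _ hb hd⟩)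
        | exact absurd (hiff.1 (hev1 _ _ ha)) (hodd _ _ hb hc)
        | exact absurd (hiff.1 (hev2 _ _ hd)) (hodd _ _ hb hc)
        | exact absurd (hiff.2 (hev1 _ _ hb)) (hodd _ _ ha hd)
        | exact absurd (hiff.2 (hev2 _ _ hc)) (hodd _ _ ha hd)
  rcases h1 with ⟨⟨x, hx⟩, ⟨y, hy⟩⟩ | ⟨⟨x, hx⟩, ⟨y, hy⟩⟩ | ⟨⟨x, hx⟩, ⟨y, hy⟩⟩
  · refine ⟨0, !![x, y; N 1 0, N 1 1], ?_⟩
    ext i j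
    fin_cases i <;> fin_cases j <;> simp [heckeMat, hx, hy]
  · refine ⟨2, !![N 0 0, N 0 1; x, y], ?_⟩
    ext i j
    fin_cases i <;> fin_cases j <;> simp [heckeMat, hx, hy]
  · refine ⟨1, !![x, y; N 1 0, N 1 1], ?_⟩
    ext i j
    fin_cases i <;> fin_cases j <;> simp [heckeMat, ← hx, ← hy]

theorem heckeMat_inj {i j : Fin 3} {k : K} (h : heckeMat i = heckeMat j * k.1) : i = j := by
  have hn1 : ¬ (2 : ℤ_[2]) ∣ 1 := fun h => not_two_isUnit (isUnit_of_dvd_one h)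
  have h00 := congrFun (congrFun h 0) 0
  have h01 := congrFun (congrFun h 0) 1
  have h10 := congrFun (congrFun h 1) 0
  have h11 := congrFun (congrFun h 1) 1
  fin_cases i <;> fin_cases j <;> first | rfl | exfalso
  all_goals
    simp [heckeMat, Matrix.mul_apply] at h00 h01 h10 h11
  all_goals
    apply hn1
    first
      | exact ⟨_, h00⟩
      | exact ⟨_, h01⟩
      | exact ⟨_, h10⟩
      | exact ⟨_, h11⟩
      | exact ⟨_, by linear_combination h01⟩
      | exact ⟨-k.1 0 1, by linear_combination h11 - h01⟩
      | exact ⟨k.1 0 0, by linear_combination h00 - h10⟩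


theorem coe_KtoG (k : K) : (KtoG k).1 = (algebraMap ℤ_[2] ℚ_[2]).mapMatrix k.1 := rfl

theorem coe_heckeG (i : Fin 3) :
    (heckeG i).1 = (algebraMap ℤ_[2] ℚ_[2]).mapMatrix (heckeMat i) := rfl

theorem exists_coset (k : K) (i : Fin 3) :
    ∃ (j : Fin 3) (k' : K), k.1 * heckeMat i = heckeMat j * k'.1 := by
  have hk : IsUnit k.1.det := (Matrix.isUnit_iff_isUnit_det _).1 k.isUnit
  exact exists_heckeMat_mul _ _ hk (by rw [Matrix.det_mul, det_heckeMat, mul_comm])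

theorem heckeG_mul {k k' : K} {i j : Fin 3} (h : k.1 * heckeMat i = heckeMat j * k'.1) :
    KtoG k * heckeG i = heckeG j * KtoG k' := by
  apply Units.ext
  rw [Units.val_mul, Units.val_mul, coe_KtoG, coe_KtoG, coe_heckeG, coe_heckeG, ← map_mul, h,
    map_mul]

/-- Right-coset version: `heckeG i * k = k' * n` with `n` in a finite set. -/
theorem exists_heckeG_mul (i : Fin 3) : ∃ s : Finset G, ∀ k : K, ∃ k' : K, ∃ n ∈ s,
    heckeG i * KtoG k = KtoG k' * n := by
  classical
  have hdet : ∀ j, ((algebraMap ℤ_[2] ℚ_[2]).mapMatrix (heckeMat j).transpose).det ≠ 0 := by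
    intro j
    rw [← RingHom.map_det, Matrix.det_transpose, det_heckeMat]; simp
  refine ⟨Finset.univ.image fun j => Matrix.GeneralLinearGroup.mkOfDetNeZero _ (hdet j),
    fun k => ?_⟩
  have hk : IsUnit k.1.det := (Matrix.isUnit_iff_isUnit_det _).1 k.isUnit
  obtain ⟨j, k', e⟩ := exists_heckeMat_mul (heckeMat i * k.1).transpose _ hk
    (by rw [Matrix.det_transpose, Matrix.det_mul, det_heckeMat])
  have hk' : IsUnit k'.1.transpose.det := by
    rw [Matrix.det_transpose]; exact (Matrix.isUnit_iff_isUnit_det _).1 k'.isUnit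
  refine ⟨Matrix.GeneralLinearGroup.mk'' k'.1.transpose hk', _,
    Finset.mem_image_of_mem _ (Finset.mem_univ j), ?_⟩
  have e2 : heckeMat i * k.1 = k'.1.transpose * (heckeMat j).transpose := by
    rw [← Matrix.transpose_mul, ← e, Matrix.transpose_transpose]
  apply Units.ext
  rw [Units.val_mul, Units.val_mul, coe_KtoG, coe_KtoG, coe_heckeG, ← map_mul, e2, map_mul]
  rfl

theorem scalar_comm (u : ℚ_[2]ˣ) (g : G) :
    Matrix.GeneralLinearGroup.scalar (Fin 2) u * g =
      g * Matrix.GeneralLinearGroup.scalar (Fin 2) u :=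
  Matrix.GeneralLinearGroup.scalar_commute u g

theorem mem_KZ {h : G} : h ∈ KZ ↔
    ∃ (k : K) (u : ℚ_[2]ˣ), h = KtoG k * Matrix.GeneralLinearGroup.scalar (Fin 2) u := by
  have : (Matrix.GeneralLinearGroup.scalar (n := Fin 2) (R := ℚ_[2])).range.Normal :=
    ⟨by rintro _ ⟨u, rfl⟩ g; exact ⟨u, by rw [← scalar_comm, mul_inv_cancel_right]⟩⟩
  constructor
  · intro hh
    obtain ⟨_, ⟨k, rfl⟩, _, ⟨u, rfl⟩, e⟩ := Subgroup.mem_sup_of_normal_right.1 hh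
    exact ⟨k, u, e.symm⟩
  · rintro ⟨k, u, rfl⟩
    exact mul_mem (Subgroup.mem_sup_left ⟨k, rfl⟩) (Subgroup.mem_sup_right ⟨u, rfl⟩)

/-- The formula for the Hecke operator on functions on `G`:
`(T f)(x) = ∑ m, m · f (m⁻¹ x)`, over the representatives `m = heckeMat i`. -/
def heckeFun (R : Type*) [CommRing R] [Algebra ℤ_[2] R] (r : ℕ) :
    (G → SymPow R r) →ₗ[R] (G → SymPow R r) where
  toFun f x := ∑ i, symInt R r (heckeMat i) (f ((heckeG i)⁻¹ * x))
  map_add' f g := by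
    funext x
    simp [Finset.sum_add_distrib]
  map_smul' c f := by
    funext x
    simp [Finset.smul_sum]

theorem heckeFun_mem {R : Type*} [CommRing R] [Algebra ℤ_[2] R] {r : ℕ} {f : G → SymPow R r}
    (hf : f ∈ ind R r) : heckeFun R r f ∈ ind R r := by
  classical
  obtain ⟨h1, h2, s, hs⟩ := hf
  refine ⟨fun k x => ?_, fun x => ?_, ?_⟩
  · choose π κ hπ using exists_coset k
    have hinj : Function.Injective π := by
      intro i j hij
      have h1 := hπ i
      have h2 := hπ j
      rw [hij] at h1
      refine heckeMat_inj (k := (κ j)⁻¹ * κ i) ?_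
      have e : k.1 * heckeMat i = k.1 * (heckeMat j * ((κ j)⁻¹ * κ i : K).1) := by
        rw [← mul_assoc, h2, h1, mul_assoc, ← Units.val_mul, mul_inv_cancel_left]
      have e' := congrArg (fun M => (k⁻¹ : K).1 * M) e
      simpa [← mul_assoc] using e'
    have hbij : Function.Bijective π := Finite.injective_iff_bijective.1 hinj
    change ∑ i : Fin 3, symInt R r (heckeMat i) (f ((heckeG i)⁻¹ * (KtoG k * x))) =
      symRep R r k (∑ i : Fin 3, symInt R r (heckeMat i) (f ((heckeG i)⁻¹ * x)))
    rw [map_sum, ← hbij.sum_comp]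
    refine Finset.sum_congr rfl fun i _ => ?_
    have e1 : (heckeG (π i))⁻¹ * (KtoG k * x) = KtoG (κ i) * ((heckeG i)⁻¹ * x) := by
      rw [inv_mul_eq_iff_eq_mul, ← mul_assoc, ← mul_assoc, ← heckeG_mul (hπ i)]
      group
    rw [e1, h1, symRep_apply, symRep_apply, ← Module.End.mul_apply, ← Module.End.mul_apply,
      ← map_mul, ← map_mul, hπ i]
  · change ∑ i : Fin 3, symInt R r (heckeMat i) (f ((heckeG i)⁻¹ * (two * x))) =
      ∑ i : Fin 3, symInt R r (heckeMat i) (f ((heckeG i)⁻¹ * x))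
    refine Finset.sum_congr rfl fun i _ => ?_
    rw [two, ← mul_assoc, ← scalar_comm, mul_assoc, ← two, h2]
  · choose n hn using exists_heckeG_mul
    refine ⟨Finset.univ.biUnion fun i => (n i ×ˢ s).image fun p => p.1 * p.2, fun x hx => ?_⟩
    change ∑ i : Fin 3, symInt R r (heckeMat i) (f ((heckeG i)⁻¹ * x)) ≠ 0 at hx
    obtain ⟨i, _, hi⟩ := Finset.exists_ne_zero_of_sum_ne_zero hx
    have hi' : f ((heckeG i)⁻¹ * x) ≠ 0 := fun h => hi (by rw [h, map_zero])
    obtain ⟨h, hh, y, hy, e⟩ := hs _ hi'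
    obtain ⟨k, u, rfl⟩ := mem_KZ.1 hh
    obtain ⟨k', m, hm, e'⟩ := hn i k
    refine ⟨KtoG k' * Matrix.GeneralLinearGroup.scalar (Fin 2) u, mem_KZ.2 ⟨k', u, rfl⟩, m * y,
      Finset.mem_biUnion.2 ⟨i, Finset.mem_univ _, Finset.mem_image.2
        ⟨(m, y), Finset.mem_product.2 ⟨hm, hy⟩, rfl⟩⟩, ?_⟩
    rw [inv_mul_eq_iff_eq_mul] at e
    rw [e, ← mul_assoc, ← mul_assoc, ← mul_assoc, e', mul_assoc (KtoG k'), mul_assoc (KtoG k'),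
      ← scalar_comm, ← mul_assoc, ← mul_assoc]

/-- The Hecke operator `T` on `I(Sym^r R^2)`. Its value on elementary functions is given in
`hecke_single`. -/
def hecke (R : Type*) [CommRing R] [Algebra ℤ_[2] R] (r : ℕ) : Module.End R (ind R r) :=
  LinearMap.restrict (heckeFun R r) fun _ hf => heckeFun_mem hf

theorem hecke_apply {R : Type*} [CommRing R] [Algebra ℤ_[2] R] {r : ℕ} (f : ind R r) (x : G) :
    (hecke R r f).1 x = ∑ i, symInt R r (heckeMat i) (f.1 ((heckeG i)⁻¹ * x)) := rfl

theorem hecke_indRep {R : Type*} [CommRing R] [Algebra ℤ_[2] R] {r : ℕ} (g : G) (f : ind R r) :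
    hecke R r (indRep R r g f) = indRep R r g (hecke R r f) := by
  apply Subtype.ext
  funext x
  rw [indRep_apply, hecke_apply, hecke_apply]
  refine Finset.sum_congr rfl fun i _ => ?_
  rw [indRep_apply, mul_assoc]

/-! ### Elementary functions -/

/-- The elementary function `[g, v]`: supported on `K Q_2^× g⁻¹`, where it takes `x` to
`(x g) · v`. -/
def singleFun {R : Type*} [CommRing R] [Algebra ℤ_[2] R] {r : ℕ} (g : G) (v : SymPow R r) :
    G → SymPow R r := by
  classical
  exact fun x => if h : ∃ k : K, ∃ n : ℤ, x * g = KtoG k * two ^ n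
    then symRep R r h.choose v else 0

theorem two_comm (g : G) : two * g = g * two := scalar_comm _ g

theorem two_zpow_comm (n : ℤ) (g : G) : two ^ n * g = g * two ^ n :=
  ((show Commute two g from two_comm g).zpow_left n).eq

theorem four_ne : (4 : ℚ_[2]) ≠ 0 := by norm_num

theorem det_two_zpow (n : ℤ) : (two ^ n).1.det = (4 : ℚ_[2]) ^ n := by
  have h : Matrix.GeneralLinearGroup.det two = Units.mk0 (4 : ℚ_[2]) four_ne := by
    rw [two, Matrix.GeneralLinearGroup.det_scalar]
    ext
    simp; norm_num
  have : Matrix.GeneralLinearGroup.det (two ^ n) = (Units.mk0 (4 : ℚ_[2]) four_ne) ^ n := by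
    rw [map_zpow, h]
  have := congrArg Units.val this
  rw [Units.val_zpow_eq_zpow_val] at this
  exact this

theorem norm_det_KtoG (k : K) : ‖(KtoG k).1.det‖ = 1 := by
  have hk : IsUnit k.1.det := (Matrix.isUnit_iff_isUnit_det _).1 k.isUnit
  rw [coe_KtoG, ← RingHom.map_det]
  exact PadicInt.isUnit_iff.1 hk

theorem norm_two_padic : ‖(2 : ℚ_[2])‖ = 2⁻¹ := by
  simpa using Padic.norm_p (p := 2)

theorem norm_four_padic : ‖(4 : ℚ_[2])‖ = 4⁻¹ := by
  rw [show (4 : ℚ_[2]) = 2 * 2 by norm_num, norm_mul, norm_two_padic]; norm_num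

theorem norm_det_zpow (k : K) (n : ℤ) : ‖(KtoG k * two ^ n).1.det‖ = (4⁻¹ : ℝ) ^ n := by
  rw [Units.val_mul, Matrix.det_mul, norm_mul, norm_det_KtoG, det_two_zpow, norm_zpow,
    norm_four_padic, one_mul]

theorem KtoG_injective : Function.Injective KtoG := by
  intro k k' h
  apply Units.ext
  have h1 := congrArg Units.val h
  rw [coe_KtoG, coe_KtoG] at h1
  ext i j
  have h2 := congrFun (congrFun h1 i) j
  exact Subtype.ext h2

theorem KtoG_two_unique {k k' : K} {n n' : ℤ} (h : KtoG k * two ^ n = KtoG k' * two ^ n') :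
    n = n' ∧ k = k' := by
  have h1 := norm_det_zpow k n
  rw [h, norm_det_zpow] at h1
  have hn : n = n' := (zpow_right_injective₀ (by norm_num) (by norm_num) h1).symm
  subst hn
  exact ⟨rfl, KtoG_injective (mul_right_cancel h)⟩

theorem singleFun_of_eq {R : Type*} [CommRing R] [Algebra ℤ_[2] R] {r : ℕ} {g : G}
    {v : SymPow R r} {x : G} {k : K} {n : ℤ} (h : x * g = KtoG k * two ^ n) :
    singleFun g v x = symRep R r k v := by
  have hex : ∃ k : K, ∃ n : ℤ, x * g = KtoG k * two ^ n := ⟨k, n, h⟩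
  rw [singleFun, dif_pos hex]
  obtain ⟨n', hn'⟩ := hex.choose_spec
  rw [(KtoG_two_unique (hn'.symm.trans h)).2]

theorem singleFun_of_not {R : Type*} [CommRing R] [Algebra ℤ_[2] R] {r : ℕ} {g : G}
    {v : SymPow R r} {x : G} (h : ¬ ∃ k : K, ∃ n : ℤ, x * g = KtoG k * two ^ n) :
    singleFun g v x = 0 := by
  rw [singleFun, dif_neg h]

theorem two_zpow_mem (n : ℤ) : two ^ n ∈ KZ :=
  KZ.zpow_mem (Subgroup.mem_sup_right (MonoidHom.mem_range.2 ⟨_, rfl⟩)) n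

theorem singleFun_mem {R : Type*} [CommRing R] [Algebra ℤ_[2] R] {r : ℕ} (g : G)
    (v : SymPow R r) : singleFun g v ∈ ind R r := by
  refine ⟨fun k x => ?_, fun x => ?_, {g⁻¹}, fun x hx => ?_⟩
  · by_cases h : ∃ k : K, ∃ n : ℤ, x * g = KtoG k * two ^ n
    · obtain ⟨k', n, e⟩ := h
      rw [singleFun_of_eq e, singleFun_of_eq (k := k * k') (n := n)
        (by rw [mul_assoc, e, map_mul, mul_assoc]), map_mul, Module.End.mul_apply]
    · rw [singleFun_of_not h, map_zero, singleFun_of_not]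
      rintro ⟨k', n, e⟩
      exact h ⟨k⁻¹ * k', n, by rw [map_mul, mul_assoc, ← e, map_inv]; group⟩
  · by_cases h : ∃ k : K, ∃ n : ℤ, x * g = KtoG k * two ^ n
    · obtain ⟨k', n, e⟩ := h
      rw [singleFun_of_eq e, singleFun_of_eq (k := k') (n := n + 1)
        (by rw [mul_assoc, e, two_comm, zpow_add_one, mul_assoc])]
    · rw [singleFun_of_not h, singleFun_of_not]
      rintro ⟨k', n, e⟩
      refine h ⟨k', n - 1, ?_⟩
      rw [mul_assoc, two_comm, ← eq_mul_inv_iff_mul_eq] at e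
      rw [e, zpow_sub_one, mul_assoc]
  · by_cases h : ∃ k : K, ∃ n : ℤ, x * g = KtoG k * two ^ n
    · obtain ⟨k', n, e⟩ := h
      exact ⟨x * g, e ▸ mul_mem (Subgroup.mem_sup_left ⟨k', rfl⟩) (two_zpow_mem n), g⁻¹,
        Finset.mem_singleton_self _, (mul_inv_cancel_right x g).symm⟩
    · exact absurd (singleFun_of_not h) hx

/-- The elementary function `[g, v]` as an element of `I(Sym^r R^2)`. -/
def single {R : Type*} [CommRing R] [Algebra ℤ_[2] R] {r : ℕ} (g : G) (v : SymPow R r) :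
    ind R r :=
  ⟨singleFun g v, singleFun_mem g v⟩

theorem adj_eq (i : Fin 3) : heckeMat i * (heckeMat i).adjugate = (2 : ℤ_[2]) • 1 := by
  rw [Matrix.mul_adjugate, det_heckeMat]

theorem coe_two : two.1 = (2 : ℚ_[2]) • (1 : Matrix (Fin 2) (Fin 2) ℚ_[2]) := by
  simp [two, Matrix.smul_one_eq_diagonal, Matrix.GeneralLinearGroup.coe_scalar]

theorem heckeG_unique {i j : Fin 3} {k k' : K} {n m : ℤ}
    (h : heckeG i * (KtoG k * two ^ n) = heckeG j * (KtoG k' * two ^ m)) : i = j := by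
  have hd : ∀ l, ‖(heckeG l).1.det‖ = 2⁻¹ := by
    intro l
    rw [coe_heckeG, ← RingHom.map_det, det_heckeMat, map_ofNat, norm_two_padic]
  have hn : n = m := by
    have h1 := congrArg (fun g : G => ‖g.1.det‖) h
    simp only [Units.val_mul (heckeG _), Matrix.det_mul (heckeG _).1, norm_mul (heckeG _).1.det,
      hd, norm_det_zpow] at h1
    exact zpow_right_injective₀ (by norm_num) (by norm_num) (mul_left_cancel₀ (by norm_num) h1)
  subst hn
  rw [← mul_assoc, ← mul_assoc] at h
  have h2 := congrArg Units.val (mul_right_cancel h)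
  rw [Units.val_mul, Units.val_mul, coe_KtoG, coe_KtoG, coe_heckeG, coe_heckeG, ← map_mul,
    ← map_mul] at h2
  have h3 : heckeMat i * k.1 = heckeMat j * k'.1 := by
    ext a b
    exact Subtype.ext (congrFun (congrFun h2 a) b)
  refine heckeMat_inj (k := k' * k⁻¹) ?_
  have e' := congrArg (fun M => M * (k⁻¹ : K).1) h3
  simpa [mul_assoc] using e'

/-- `k · adj(m_i) = m_j · k'` gives `m_j k' m_i = 2 k` in `G`. -/
theorem heckeG_adj {i j : Fin 3} {k k' : K}
    (e : k.1 * (heckeMat i).adjugate = heckeMat j * k'.1) :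
    heckeG j * KtoG k' * heckeG i = KtoG k * two := by
  apply Units.ext
  rw [Units.val_mul, Units.val_mul, Units.val_mul, coe_KtoG, coe_KtoG, coe_heckeG, coe_heckeG,
    coe_two, ← map_mul, ← e, ← map_mul, mul_assoc, Matrix.adjugate_mul, det_heckeMat]
  ext a b
  simp
  left
  exact map_ofNat (algebraMap ℤ_[2] ℚ_[2]) 2

theorem exists_adj (k : K) (i : Fin 3) :
    ∃ (j : Fin 3) (k' : K), k.1 * (heckeMat i).adjugate = heckeMat j * k'.1 := by
  have hk : IsUnit k.1.det := (Matrix.isUnit_iff_isUnit_det _).1 k.isUnit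
  exact exists_heckeMat_mul _ _ hk
    (by rw [Matrix.det_mul, Matrix.det_adjugate, det_heckeMat]; simp [mul_comm])

/-- The action of `T` on elementary functions:
`T [g, v] = ∑ i, [g m_i, adj(m_i) · v]`. -/
theorem hecke_single_sum {R : Type*} [CommRing R] [Algebra ℤ_[2] R] {r : ℕ} (g : G)
    (v : SymPow R r) : hecke R r (single g v) =
      ∑ i, single (g * heckeG i) (symInt R r (heckeMat i).adjugate v) := by
  apply Subtype.ext
  funext x
  rw [hecke_apply]
  simp only [AddSubmonoidClass.coe_finsetSum, Finset.sum_apply]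
  change ∑ i : Fin 3, symInt R r (heckeMat i) (singleFun g v ((heckeG i)⁻¹ * x)) =
    ∑ i : Fin 3, singleFun (g * heckeG i) (symInt R r (heckeMat i).adjugate v) x
  by_cases h : ∃ (i : Fin 3) (k : K) (n : ℤ), x * (g * heckeG i) = KtoG k * two ^ n
  · obtain ⟨i, k, n, e⟩ := h
    obtain ⟨j, k', e1⟩ := exists_adj k i
    have e2 : (heckeG j)⁻¹ * x * g = KtoG k' * two ^ (n - 1) := by
      rw [mul_assoc, inv_mul_eq_iff_eq_mul]
      apply mul_right_cancel (b := heckeG i)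
      rw [mul_assoc, e, ← mul_assoc, mul_assoc _ _ (heckeG i), two_zpow_comm, ← mul_assoc,
        heckeG_adj e1, mul_assoc, ← zpow_one_add]
      congr 2
      ring
    rw [Finset.sum_eq_single j, Finset.sum_eq_single i]
    · rw [singleFun_of_eq e, singleFun_of_eq e2, symRep_apply, symRep_apply,
        ← Module.End.mul_apply, ← Module.End.mul_apply, ← map_mul, ← map_mul, e1]
    · intro i' _ hi'
      rw [singleFun_of_not]
      rintro ⟨k2, m, e3⟩
      apply hi'
      apply heckeG_unique (k := k2⁻¹) (k' := k⁻¹) (n := -m) (m := -n)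
      have f1 : ∀ {l : Fin 3} {κ : K} {q : ℤ}, x * (g * heckeG l) = KtoG κ * two ^ q →
          heckeG l * (KtoG κ⁻¹ * two ^ (-q)) = (x * g)⁻¹ := by
        intro l κ q hq
        rw [map_inv, zpow_neg, ← mul_inv_rev, two_zpow_comm, ← hq]
        group
      rw [f1 e3, f1 e]
    · simp
    · intro j' _ hj'
      rw [singleFun_of_not, map_zero]
      rintro ⟨k2, m, e3⟩
      apply hj'
      apply heckeG_unique (k := k2) (k' := k') (n := m) (m := n - 1)
      rw [← e3, ← e2]
      group
    · simp
  · rw [Finset.sum_eq_zero, Finset.sum_eq_zero]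
    · intro i _
      exact singleFun_of_not fun ⟨k, n, e⟩ => h ⟨i, k, n, e⟩
    · intro j _
      rw [singleFun_of_not, map_zero]
      rintro ⟨k', m, e⟩
      obtain ⟨i, k2, e1⟩ := exists_adj k'⁻¹ j
      refine h ⟨i, k2⁻¹, m + 1, ?_⟩
      have e2 := heckeG_adj e1
      rw [map_inv] at e2
      have e3 : x * g = heckeG j * (KtoG k' * two ^ m) := by
        rw [← e]; group
      have e4 : heckeG j * KtoG k' * heckeG i = KtoG k2⁻¹ * two := by
        have e5 : heckeG i = (KtoG k')⁻¹ * two * (heckeG j)⁻¹ * (KtoG k2)⁻¹ := by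
          rw [← e2]; group
        rw [e5, map_inv, mul_assoc _ two, two_comm (heckeG j)⁻¹]
        have : heckeG j * KtoG k' * ((KtoG k')⁻¹ * ((heckeG j)⁻¹ * two) * (KtoG k2)⁻¹) =
            two * (KtoG k2)⁻¹ := by group
        rw [this, two_comm]
      rw [← mul_assoc, e3, mul_assoc, mul_assoc, two_zpow_comm, ← mul_assoc, ← mul_assoc, e4,
        mul_assoc, ← zpow_one_add, add_comm]

theorem symInt_adjugate {R : Type*} [CommRing R] [Algebra ℤ_[2] R] {r : ℕ} (v : SymPow R r)
    (i : Fin 3) : (symInt R r (heckeMat i).adjugate v).1 =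
      ![MvPolynomial.aeval ![X 0, 2 * X 1] v.1, MvPolynomial.aeval ![X 0, 2 * X 1 - X 0] v.1,
        MvPolynomial.aeval ![2 * X 0, X 1] v.1] i := by
  change MvPolynomial.aeval (linForm ((algebraMap ℤ_[2] R).mapMatrix _)) v.1 = _
  have h2 : (C (algebraMap ℤ_[2] R 2) : MvPolynomial (Fin 2) R) = 2 := by
    rw [map_ofNat]; exact map_ofNat _ 2
  fin_cases i
  · change _ = MvPolynomial.aeval ![X 0, 2 * X 1] v.1
    congr 2
    funext j
    fin_cases j <;> simp [linForm, heckeMat, Matrix.adjugate_fin_two, h2]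
  · change _ = MvPolynomial.aeval ![X 0, 2 * X 1 - X 0] v.1
    congr 2
    funext j
    fin_cases j <;> simp [linForm, heckeMat, Matrix.adjugate_fin_two, h2]
    ring
  · change _ = MvPolynomial.aeval ![2 * X 0, X 1] v.1
    congr 2
    funext j
    fin_cases j <;> simp [linForm, heckeMat, Matrix.adjugate_fin_two, h2]

/-- The defining formula of the Hecke operator on elementary functions:
`T [g, v(X, Y)] = ∑ μ ∈ {0, 1}, [g (2 μ; 0 1), v(X, 2Y - μX)] + [g (1 0; 0 2), v(2X, Y)]`
(see `symInt_adjugate` for the three polynomials). -/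
theorem hecke_single {R : Type*} [CommRing R] [Algebra ℤ_[2] R] {r : ℕ} (g : G)
    (v : SymPow R r) : hecke R r (single g v) =
      single (g * heckeG 0) (symInt R r (heckeMat 0).adjugate v) +
      single (g * heckeG 1) (symInt R r (heckeMat 1).adjugate v) +
      single (g * heckeG 2) (symInt R r (heckeMat 2).adjugate v) := by
  rw [hecke_single_sum, Fin.sum_univ_three]

/-! ### Functoriality -/

/-- Extension of scalars on `Sym^r`. -/
def symBaseChange (R S : Type*) [CommRing R] [CommRing S] [Algebra R S] (r : ℕ) :
    SymPow R r →ₗ[R] SymPow S r where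
  toFun f := ⟨MvPolynomial.map (algebraMap R S) f.1, MvPolynomial.IsHomogeneous.map f.2 _⟩
  map_add' _ _ := Subtype.ext (map_add _ _ _)
  map_smul' c f := Subtype.ext (by
    change MvPolynomial.map (algebraMap R S) (c • f.1) = c • MvPolynomial.map (algebraMap R S) f.1
    rw [MvPolynomial.smul_eq_C_mul, map_mul, MvPolynomial.map_C, ← MvPolynomial.smul_eq_C_mul,
      algebraMap_smul])

theorem symBaseChange_symInt (R S : Type*) [CommRing R] [CommRing S] [Algebra R S]
    [Algebra ℤ_[2] R] [Algebra ℤ_[2] S] [IsScalarTower ℤ_[2] R S] (r : ℕ)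
    (M : Matrix (Fin 2) (Fin 2) ℤ_[2]) (f : SymPow R r) :
    symBaseChange R S r (symInt R r M f) = symInt S r M (symBaseChange R S r f) := by
  apply Subtype.ext
  change MvPolynomial.map (algebraMap R S)
      (MvPolynomial.aeval (linForm ((algebraMap ℤ_[2] R).mapMatrix M)) f.1) =
    MvPolynomial.aeval (linForm ((algebraMap ℤ_[2] S).mapMatrix M))
      (MvPolynomial.map (algebraMap R S) f.1)
  have : ∀ j, MvPolynomial.map (algebraMap R S) (linForm ((algebraMap ℤ_[2] R).mapMatrix M) j) =
      linForm ((algebraMap ℤ_[2] S).mapMatrix M) j := by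
    intro j
    simp [linForm, IsScalarTower.algebraMap_apply ℤ_[2] R S]
  induction f.1 using MvPolynomial.induction_on with
  | C a => simp
  | add p q hp hq => simp only [map_add, hp, hq]
  | mul_X p j hp => simp only [map_mul, hp, MvPolynomial.aeval_X, MvPolynomial.map_X, this]

/-- Extension of scalars `I(Sym^r R^2) → I(Sym^r S^2)`. -/
def indBaseChange (R S : Type*) [CommRing R] [CommRing S] [Algebra R S]
    [Algebra ℤ_[2] R] [Algebra ℤ_[2] S] [IsScalarTower ℤ_[2] R S] (r : ℕ) :
    ind R r →ₗ[R] ind S r where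
  toFun f := ⟨fun x => symBaseChange R S r (f.1 x), by
    obtain ⟨f, h1, h2, s, hs⟩ := f
    refine ⟨fun k g => ?_, fun g => ?_, s, fun g hg => hs g fun h => hg ?_⟩
    · change symBaseChange R S r (f (KtoG k * g)) = symRep S r k (symBaseChange R S r (f g))
      rw [h1, symRep_apply, symRep_apply, symBaseChange_symInt]
    · change symBaseChange R S r (f (two * g)) = symBaseChange R S r (f g)
      rw [h2]
    · change symBaseChange R S r (f g) = 0
      rw [h, map_zero]⟩
  map_add' f g := Subtype.ext (funext fun x => map_add (symBaseChange R S r) (f.1 x) (g.1 x))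
  map_smul' c f := Subtype.ext (funext fun x => map_smul (symBaseChange R S r) c (f.1 x))

theorem indBaseChange_apply {R S : Type*} [CommRing R] [CommRing S] [Algebra R S]
    [Algebra ℤ_[2] R] [Algebra ℤ_[2] S] [IsScalarTower ℤ_[2] R S] {r : ℕ} (f : ind R r) (x : G) :
    (indBaseChange R S r f).1 x = symBaseChange R S r (f.1 x) := rfl

theorem indBaseChange_indRep {R S : Type*} [CommRing R] [CommRing S] [Algebra R S]
    [Algebra ℤ_[2] R] [Algebra ℤ_[2] S] [IsScalarTower ℤ_[2] R S] {r : ℕ} (g : G) (f : ind R r) :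
    indBaseChange R S r (indRep R r g f) = indRep S r g (indBaseChange R S r f) := rfl

/-- The map `I(φ) : I(Sym^r R^2) → I(Sym^s R^2)` induced by a `K`-linear map `φ`. -/
def indMap {R : Type*} [CommRing R] [Algebra ℤ_[2] R] {r s : ℕ}
    (φ : SymPow R r →ₗ[R] SymPow R s)
    (hφ : ∀ (k : K) (v : SymPow R r), φ (symRep R r k v) = symRep R s k (φ v)) :
    ind R r →ₗ[R] ind R s where
  toFun f := ⟨fun x => φ (f.1 x), by
    obtain ⟨f, h1, h2, s, hs⟩ := f
    refine ⟨fun k g => ?_, fun g => ?_, s, fun g hg => hs g fun h => hg ?_⟩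
    · change φ (f (KtoG k * g)) = _
      rw [h1, hφ]
    · change φ (f (two * g)) = φ (f g)
      rw [h2]
    · change φ (f g) = 0
      rw [h, map_zero]⟩
  map_add' f g := Subtype.ext (funext fun x => map_add φ (f.1 x) (g.1 x))
  map_smul' c f := Subtype.ext (funext fun x => map_smul φ c (f.1 x))

/-! ### The map `V_r → V_0` -/

/-- The coefficient of `X^(r-j) Y^j`. -/
def coeffXY (R : Type*) [CommRing R] (r j : ℕ) : SymPow R r →ₗ[R] R where
  toFun f := MvPolynomial.coeff (Finsupp.single 0 (r - j) + Finsupp.single 1 j) f.1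
  map_add' _ _ := MvPolynomial.coeff_add _ _ _
  map_smul' _ _ := MvPolynomial.coeff_smul _ _ _

/-- The identification `R = Sym^0 R^2`. -/
def constSym (R : Type*) [CommRing R] : R →ₗ[R] SymPow R 0 where
  toFun c := ⟨C c, MvPolynomial.isHomogeneous_C _ _⟩
  map_add' _ _ := Subtype.ext (map_add _ _ _)
  map_smul' c d := Subtype.ext ((map_mul C c d).trans (MvPolynomial.smul_eq_C_mul _ _).symm)

/-- The map `Sym^r R^2 → Sym^0 R^2 = R`,
`∑ c_j X^(r-j) Y^j ↦ ∑_{1 ≤ j ≤ r - 1} c_j`. -/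
def midSum (R : Type*) [CommRing R] (r : ℕ) : SymPow R r →ₗ[R] SymPow R 0 :=
  constSym R ∘ₗ ∑ j ∈ Finset.Ioo 0 r, coeffXY R r j

theorem midSum_val {R : Type*} [CommRing R] {r : ℕ} (f : SymPow R r) :
    (midSum R r f).1 = C (∑ j ∈ Finset.Ioo 0 r, coeffXY R r j f) := by
  rw [midSum, LinearMap.comp_apply, LinearMap.sum_apply]
  rfl

theorem eval_eq_sum {R : Type*} [CommRing R] {r : ℕ} (f : SymPow R r) (p : Fin 2 → R) :
    MvPolynomial.eval p f.1 =
      ∑ j ∈ Finset.range (r + 1), coeffXY R r j f * (p 0 ^ (r - j) * p 1 ^ j) := by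
  classical
  have hf : f.1.IsHomogeneous r := f.2
  let e : ℕ → (Fin 2 →₀ ℕ) := fun j => Finsupp.single 0 (r - j) + Finsupp.single 1 j
  have he1 : ∀ j, e j 1 = j := fun j => by simp [e]
  have he0 : ∀ j, e j 0 = r - j := fun j => by simp [e]
  have hinj : Set.InjOn e (Finset.range (r + 1)) := fun i _ j _ h => by
    rw [← he1 i, h, he1]
  have hsub : f.1.support ⊆ (Finset.range (r + 1)).image e := by
    intro d hd
    have hdeg := hf (MvPolynomial.mem_support_iff.1 hd)
    have hdeg' : d 0 + d 1 = r := by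
      rw [← hdeg, Finsupp.weight_apply, Finsupp.sum_fintype _ _ (by simp)]
      simp
    refine Finset.mem_image.2 ⟨d 1, Finset.mem_range.2 (by omega), ?_⟩
    ext i
    fin_cases i
    · change e (d 1) 0 = d 0
      rw [he0]; omega
    · exact he1 _
  rw [MvPolynomial.eval_eq', Finset.sum_subset hsub, Finset.sum_image hinj]
  · refine Finset.sum_congr rfl fun j _ => ?_
    rw [Fin.prod_univ_two, he0, he1]
    rfl
  · intro d _ hd
    rw [MvPolynomial.notMem_support_iff.1 hd, zero_mul]

theorem eval_symInt {R : Type*} [CommRing R] [Algebra ℤ_[2] R] {r : ℕ}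
    (M : Matrix (Fin 2) (Fin 2) ℤ_[2]) (f : SymPow R r) (p : Fin 2 → R) :
    MvPolynomial.eval p (symInt R r M f).1 =
      MvPolynomial.eval (fun j => ∑ i, algebraMap ℤ_[2] R (M i j) * p i) f.1 := by
  change MvPolynomial.eval p
    (MvPolynomial.aeval (linForm ((algebraMap ℤ_[2] R).mapMatrix M)) f.1) = _
  induction f.1 using MvPolynomial.induction_on with
  | C a => simp
  | add p q hp hq => simp only [map_add, hp, hq]
  | mul_X p j hp =>
    simp only [map_mul, hp, MvPolynomial.aeval_X, MvPolynomial.eval_X]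
    congr 1
    simp [linForm]

theorem midSum_eq_eval {R : Type*} [CommRing R] [CharP R 2] {r : ℕ} (hr : 1 ≤ r)
    (f : SymPow R r) : (midSum R r f).1 = C (MvPolynomial.eval ![1, 0] f.1 +
      MvPolynomial.eval ![0, 1] f.1 + MvPolynomial.eval ![1, 1] f.1) := by
  obtain ⟨n, rfl⟩ : ∃ n, r = n + 1 := ⟨r - 1, by omega⟩
  rw [midSum_val]
  congr 1
  have h10 : MvPolynomial.eval ![1, 0] f.1 = coeffXY R (n + 1) 0 f := by
    rw [eval_eq_sum, Finset.sum_eq_single 0]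
    · simp
    · intro j _ hj; simp [hj]
    · simp
  have h01 : MvPolynomial.eval ![0, 1] f.1 = coeffXY R (n + 1) (n + 1) f := by
    rw [eval_eq_sum, Finset.sum_eq_single (n + 1)]
    · simp
    · intro j hj hj'
      have : n + 1 - j ≠ 0 := by have := Finset.mem_range.1 hj; omega
      simp [this]
    · simp
  have h11 : MvPolynomial.eval ![1, 1] f.1 = coeffXY R (n + 1) 0 f +
      (∑ j ∈ Finset.Ioo 0 (n + 1), coeffXY R (n + 1) j f) + coeffXY R (n + 1) (n + 1) f := by
    rw [eval_eq_sum, Finset.sum_range_succ, Finset.sum_range_eq_add_Ico _ (Nat.succ_pos n)]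
    have : Finset.Ico 1 (n + 1) = Finset.Ioo 0 (n + 1) := by ext; simp; omega
    simp [this]
  rw [h10, h01, h11]
  have e2 : ∀ x : R, x + x = 0 := CharTwo.add_self_eq_zero
  linear_combination -(e2 (coeffXY R (n + 1) 0 f)) - e2 (coeffXY R (n + 1) (n + 1) f)

theorem algebraMap_bit {R : Type*} [CommRing R] [Algebra ℤ_[2] R] [CharP R 2] (a : ℤ_[2]) :
    algebraMap ℤ_[2] R a = 0 ∨ algebraMap ℤ_[2] R a = 1 := by
  have h2 : (2 : R) = 0 := CharTwo.two_eq_zero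
  rcases two_dvd_or a with ⟨b, hb⟩ | ⟨b, hb⟩
  · left; rw [hb, map_mul, map_ofNat, h2, zero_mul]
  · right
    rw [sub_eq_iff_eq_add.1 hb, map_add, map_mul, map_ofNat, h2, zero_mul, zero_add, map_one]

/-- `midSum` is `K`-linear in characteristic two. -/
theorem midSum_equivariant {R : Type*} [CommRing R] [Algebra ℤ_[2] R] [CharP R 2] (r : ℕ)
    (k : K) (f : SymPow R r) :
    midSum R r (symRep R r k f) = symRep R 0 k (midSum R r f) := by
  have hR : (2 : R) = 0 := CharTwo.two_eq_zero
  have hnt : Nontrivial R := CharP.nontrivial_of_char_ne_one (v := 2) (by norm_num)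
  have hdet : algebraMap ℤ_[2] R (k.1 0 0) * algebraMap ℤ_[2] R (k.1 1 1) -
      algebraMap ℤ_[2] R (k.1 0 1) * algebraMap ℤ_[2] R (k.1 1 0) ≠ 0 := by
    have hk : IsUnit k.1.det := (Matrix.isUnit_iff_isUnit_det _).1 k.isUnit
    rw [← map_mul, ← map_mul, ← map_sub, ← Matrix.det_fin_two]
    exact (hk.map (algebraMap ℤ_[2] R)).ne_zero
  apply Subtype.ext
  have h0 : (symRep R 0 k (midSum R r f)).1 = (midSum R r f).1 := by
    change MvPolynomial.aeval _ (midSum R r f).1 = (midSum R r f).1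
    rw [midSum_val]
    simp
  rw [h0]
  rcases Nat.eq_zero_or_pos r with rfl | hr
  · rw [midSum_val, midSum_val]; simp
  rw [midSum_eq_eval hr, midSum_eq_eval hr, symRep_apply, eval_symInt, eval_symInt, eval_symInt]
  congr 1
  have hv : ∀ (u v : R) (q : Fin 2 → R), q 0 = u → q 1 = v → q = ![u, v] := by
    intro u v q h h'
    funext i
    fin_cases i
    · exact h
    · exact h'
  simp only [Fin.sum_univ_two]
  rw [hv _ _ (fun j => algebraMap ℤ_[2] R (k.1 0 j) * (![1, 0] : Fin 2 → R) 0 +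
      algebraMap ℤ_[2] R (k.1 1 j) * (![1, 0] : Fin 2 → R) 1) rfl rfl,
    hv _ _ (fun j => algebraMap ℤ_[2] R (k.1 0 j) * (![0, 1] : Fin 2 → R) 0 +
      algebraMap ℤ_[2] R (k.1 1 j) * (![0, 1] : Fin 2 → R) 1) rfl rfl,
    hv _ _ (fun j => algebraMap ℤ_[2] R (k.1 0 j) * (![1, 1] : Fin 2 → R) 0 +
      algebraMap ℤ_[2] R (k.1 1 j) * (![1, 1] : Fin 2 → R) 1) rfl rfl]
  have h11 : (1 : R) + 1 = 0 := by rw [one_add_one_eq_two, hR]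
  rcases algebraMap_bit (R := R) (k.1 0 0) with ha | ha <;>
    rcases algebraMap_bit (R := R) (k.1 0 1) with hb | hb <;>
    rcases algebraMap_bit (R := R) (k.1 1 0) with hc | hc <;>
    rcases algebraMap_bit (R := R) (k.1 1 1) with hd | hd <;>
    rw [ha, hb, hc, hd] at hdet ⊢ <;> simp [h11] at hdet ⊢ <;> ring

/-! ### The coefficient rings and `Θ` -/

/-- `\bar ℚ_2`. -/
abbrev QBar : Type := PadicAlgCl 2

/-- `\bar ℤ_2`, the ring of integers of `\bar ℚ_2`. -/
def ZBar : Type := ↥(Valued.v (R := QBar) (Γ₀ := NNReal)).valuationSubring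

instance : CommRing ZBar :=
  inferInstanceAs (CommRing ↥(Valued.v (R := QBar) (Γ₀ := NNReal)).valuationSubring)

instance : IsLocalRing ZBar :=
  inferInstanceAs (IsLocalRing ↥(Valued.v (R := QBar) (Γ₀ := NNReal)).valuationSubring)

instance : Algebra ZBar QBar :=
  RingHom.toAlgebra (Valued.v (R := QBar) (Γ₀ := NNReal)).valuationSubring.subtype

instance algebraZBar : Algebra ℤ_[2] ZBar :=
  RingHom.toAlgebra (RingHom.codRestrict (algebraMap ℤ_[2] QBar)
    (Valued.v (R := QBar) (Γ₀ := NNReal)).valuationSubring.toSubring (by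
      intro x
      change Valued.v (algebraMap ℤ_[2] QBar x) ≤ 1
      rw [IsScalarTower.algebraMap_apply ℤ_[2] ℚ_[2] QBar, PadicAlgCl.valuation_def,
        ← NNReal.coe_le_coe, coe_nnnorm, norm_algebraMap']
      exact x.2))

instance : IsScalarTower ℤ_[2] ZBar QBar := IsScalarTower.of_algebraMap_eq fun _ => rfl

/-- `\bar 𝔽_2`, the residue field of `\bar ℤ_2`. -/
abbrev FBar : Type := IsLocalRing.ResidueField ZBar

instance : CharP FBar 2 := by
  have h2 : (2 : FBar) = 0 := by
    rw [← map_ofNat (IsLocalRing.residue ZBar) 2, IsLocalRing.residue_eq_zero_iff,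
      IsLocalRing.mem_maximalIdeal, mem_nonunits_iff]
    intro hu
    obtain ⟨b, hb⟩ := hu.exists_right_inv
    have h1 := congrArg (algebraMap ZBar QBar) hb
    rw [map_mul, map_ofNat, map_one] at h1
    have h3 := congrArg (fun x : QBar => Valued.v (Γ₀ := NNReal) x) h1
    have hb1 : Valued.v (Γ₀ := NNReal) (algebraMap ZBar QBar b) ≤ 1 := b.2
    have h4 : Valued.v (Γ₀ := NNReal) (2 : QBar) = 1 / 2 := by
      simpa using PadicAlgCl.valuation_p 2
    simp only [map_mul, map_one, h4] at h3
    have h5 : (1 : NNReal) ≤ 1 / 2 := by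
      calc (1 : NNReal) = 1 / 2 * Valued.v (Γ₀ := NNReal) (algebraMap ZBar QBar b) := h3.symm
        _ ≤ 1 / 2 * 1 := by gcongr
        _ = 1 / 2 := mul_one _
    rw [← NNReal.coe_le_coe] at h5
    norm_num at h5
  exact CharTwo.of_one_ne_zero_of_two_eq_zero one_ne_zero h2

/-- The valuation on `\bar ℚ_2` with `v(2) = 1` and `v(0) = ∞`. -/
def val (x : QBar) : WithTop ℝ := by
  classical
  exact if x = 0 then ⊤ else ((-Real.logb 2 ‖x‖ : ℝ) : WithTop ℝ)

/-- `(T - a)(I(Sym^r \bar ℚ_2^2)) ∩ I(Sym^r \bar ℤ_2^2)`. -/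
def thetaKer (r : ℕ) (a : QBar) : Submodule ZBar (ind ZBar r) :=
  Submodule.comap (indBaseChange ZBar QBar r)
    ((LinearMap.range (hecke QBar r - a • LinearMap.id)).restrictScalars ZBar)

theorem thetaKer_le (r : ℕ) (a : QBar) (g : G) :
    thetaKer r a ≤ (thetaKer r a).comap (indRep ZBar r g) := by
  rintro f ⟨h, hh⟩
  refine ⟨indRep QBar r g h, ?_⟩
  rw [indBaseChange_indRep, ← hh]
  simp [hecke_indRep]

/-- `Θ_{k,a}` for `k = r + 2`. -/
abbrev Theta (r : ℕ) (a : QBar) : Type := ind ZBar r ⧸ thetaKer r a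

/-- The action of `G` on `Θ_{k,a}`. -/
def thetaRep (r : ℕ) (a : QBar) : Representation ZBar G (Theta r a) :=
  (indRep ZBar r).quotient (thetaKer r a) (thetaKer_le r a)

/-- `\bar Θ_{k,a} = Θ_{k,a} ⊗ \bar 𝔽_2` for `k = r + 2`. -/
abbrev ThetaBar (r : ℕ) (a : QBar) : Type := FBar ⊗[ZBar] Theta r a

/-- The action of `G` on `\bar Θ_{k,a}`. -/
def thetaBarRep (r : ℕ) (a : QBar) : Representation FBar G (ThetaBar r a) :=
  (Module.End.baseChangeHom ZBar FBar (Theta r a)).toMonoidHom.comp (thetaRep r a)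

/-- `P : I(V_r) → \bar Θ_{k,a}` is the natural map: it sends the reduction of
`f ∈ I(Sym^r \bar ℤ_2^2)` to the class of `f`. -/
def IsNaturalMap (r : ℕ) (a : QBar) (P : ind FBar r →ₗ[FBar] ThetaBar r a) : Prop :=
  ∀ f : ind ZBar r, P (indBaseChange ZBar FBar r f) = 1 ⊗ₜ[ZBar] (Submodule.Quotient.mk f)

/-- The map `I(V_r) → I(V_0)` induced by `V_r → V_0`. -/
def toIndV0 (r : ℕ) : ind FBar r →ₗ[FBar] ind FBar 0 :=
  indMap (midSum FBar r) (midSum_equivariant r)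

end TreeInd

end

/-! Write n = r - 1 and b = 2/a, let m_0, m_1, m_2 be the matrices `heckeMat`, and let U(g), E(g) be
the classes in Θ of [g, X^r] and [g, XY^n]. On Θ the operator T acts as the scalar a, and Θ is
torsion free, so every relation coming from T may be divided by a. Both a and b lie in the maximal
ideal.

Factorization. For 0 < j < r, a·[g, X^(r-j)Y^j] is ±U(g m_1) modulo 2 (`exists_hecke_mono`).
Dividing by a, all middle monomials have the same class modulo b (`exists_mono_sub`). Every X^r
class also occurs as such an m_1 term, so U takes values in aΘ (`exists_mono_zero`), and Y^r is a
K-translate of X^r. Hence the reduction of [g, v] depends only on the sum of the middle coefficients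
of v, and P₀ sends [g, 1] to the reduction of E(g).

Hecke relation. The forms X, Y, -X-Y are permuted by `rot`, of order three. Adding the formulas for
aU at g, g·rot and g·rot², the terms regroup into one contribution, Y^r + (-1)^r (2X+Y)^r + 2^r X^r,
at each of the three neighbours of g in the tree (`hecke_sum_rot`). For even r these contributions
are divisible by 2a = a²b, while U is -a times a value of E modulo 2; cancelling a² gives TE = 0
modulo b (`sum_mem_of_even`).

For odd r the expansions are made modulo 4n. The combination `recClass` satisfies recClass(g) = (2 -
a²)E(g) + a·recClass(g m_2) up to error terms (`exists_recursion`), and iterating it makes the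
remainder negligible. The outcome (`sum_mem_of_odd`) is that (2 - a²)·TE - 2nb·E₂ is an error term,
where E₂ is the sum of E over the six vertices at distance two, that is (T² - 3)E.

It remains to compare 2 - a² with 2nb. Since 2r² - 2 = 2n(n+2), replacing 2 - a² by 2r² - a² = -2aα'
is harmless. If τ' < t, then 2 - a² dominates and TE = 0 (`mem_smul_top_of_lt`). If τ' ≥ t, then
v(a) = 1/2 and b/a reduces to 1, so division by 2na gives c·TE + (T² - 3)E = 0, which in
characteristic two is (T² - cT + 1)E = 0 (`mem_smul_top_of_le`). For even r only the first case
occurs. -/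

noncomputable section

namespace TreeInd

/-! ### Elements of `K` -/

/-- An integral `2 × 2` matrix with determinant `u` invertible, as an element of `K`. -/
def mkK (a b c d : ℤ_[2]) (h : IsUnit (a * d - b * c)) : K :=
  Matrix.GeneralLinearGroup.mk'' !![a, b; c, d] (by rwa [Matrix.det_fin_two_of])

theorem coe_mkK (a b c d : ℤ_[2]) (h : IsUnit (a * d - b * c)) :
    (mkK a b c d h).1 = !![a, b; c, d] := rfl

/-- The matrix `(1 1; 0 1)`. -/
def shear : K := mkK 1 1 0 1 (by simp)

/-- The matrix `(0 -1; 1 -1)` of order three. -/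
def rot : K := mkK 0 (-1) 1 (-1) (by simp)

/-- The matrix `(0 -1; 1 0)`. -/
def quarter : K := mkK 0 (-1) 1 0 (by simp)

/-- The matrix `(-2 1; -1 0)`. -/
def twist : K := mkK (-2) 1 (-1) 0 (by simp)

/-- Left multiplication by K permutes the cosets m_i K. These identities record the factor of K that
appears on the right, because that factor acts on the polynomial. -/
theorem shear_mul_heckeG_one : KtoG shear * heckeG 1 = heckeG 0 * KtoG shear :=
  heckeG_mul (by
    ext i j
    fin_cases i <;> fin_cases j <;> simp [shear, coe_mkK, heckeMat, Matrix.mul_apply]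
    norm_num)

theorem rot_mul_heckeG_one : KtoG rot * heckeG 1 = heckeG 2 * KtoG quarter :=
  heckeG_mul (by
    ext i j
    fin_cases i <;> fin_cases j <;> simp [rot, quarter, coe_mkK, heckeMat, Matrix.mul_apply])

theorem rot_sq_mul_heckeG_zero : KtoG rot ^ 2 * heckeG 0 = heckeG 2 * KtoG twist := by
  rw [← map_pow]
  exact heckeG_mul (by
    ext i j
    fin_cases i <;> fin_cases j <;>
      simp [rot, twist, coe_mkK, heckeMat, Matrix.mul_apply, pow_two])

theorem rot_mul_heckeG_two : ∃ k : K, KtoG rot * heckeG 2 = heckeG 0 * KtoG k :=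
  ⟨mkK 0 (-1) 1 (-2) (by simp), heckeG_mul (by
    ext i j
    fin_cases i <;> fin_cases j <;> simp [rot, coe_mkK, heckeMat, Matrix.mul_apply])⟩

theorem rot_sq_mul_heckeG_two : ∃ k : K, KtoG rot ^ 2 * heckeG 2 = heckeG 1 * KtoG k := by
  refine ⟨mkK 0 1 (-1) 0 (by simp), ?_⟩
  rw [← map_pow]
  exact heckeG_mul (by
    ext i j
    fin_cases i <;> fin_cases j <;> simp [rot, coe_mkK, heckeMat, Matrix.mul_apply, pow_two])

theorem rot_pow_three : KtoG rot ^ 3 = 1 := by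
  rw [← map_pow, ← map_one KtoG]
  congr 1
  apply Units.ext
  ext i j
  fin_cases i <;> fin_cases j <;> simp [rot, coe_mkK, pow_succ, Matrix.mul_apply]

theorem heckeG_two_mul_zero : heckeG 2 * heckeG 0 = two := by
  apply Units.ext
  rw [Units.val_mul, coe_heckeG, coe_heckeG, ← map_mul, coe_two]
  have h2 : algebraMap ℤ_[2] ℚ_[2] 2 = 2 := map_ofNat _ 2
  ext i j
  fin_cases i <;> fin_cases j <;> simp [heckeMat, h2]

/-- The vertex of g is thus the m_1-neighbour of g m_2 shear, so [g, X^r] appears as the m_1 term of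
a Hecke relation based there. -/
theorem heckeG_two_mul_shear : heckeG 2 * KtoG shear * heckeG 1 = KtoG shear * two := by
  rw [mul_assoc, shear_mul_heckeG_one, ← mul_assoc, heckeG_two_mul_zero, two_comm]

/-! ### Monomials -/

/-- The monomial `X^(r-j) Y^j` in `Sym^r R^2` (for `j ≤ r`). -/
def mono (R : Type*) [CommRing R] (r j : ℕ) : SymPow R r :=
  ⟨X 0 ^ (r - j) * X 1 ^ min j r, by
    have h := ((MvPolynomial.isHomogeneous_X R (0 : Fin 2)).pow (r - j)).mul
      ((MvPolynomial.isHomogeneous_X R (1 : Fin 2)).pow (min j r))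
    have e : 1 * (r - j) + 1 * min j r = r := by omega
    rw [e] at h
    exact h⟩

theorem mono_val (R : Type*) [CommRing R] {r j : ℕ} (h : j ≤ r) :
    (mono R r j).1 = X 0 ^ (r - j) * X 1 ^ j := by
  change X 0 ^ (r - j) * X 1 ^ min j r = _
  rw [min_eq_left h]

section
variable {R : Type*} [CommRing R]

theorem SymPow.coe_sum {r : ℕ} {ι : Type*} (s : Finset ι) (f : ι → SymPow R r) :
    (∑ i ∈ s, f i).1 = ∑ i ∈ s, (f i).1 :=
  map_sum (MvPolynomial.homogeneousSubmodule (Fin 2) R r).subtype f s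

theorem C_two : (C 2 : MvPolynomial (Fin 2) R) = 2 := map_ofNat _ 2

theorem SymPow.coe_smul {r : ℕ} (c : R) (f : SymPow R r) : (c • f).1 = C c * f.1 :=
  MvPolynomial.smul_eq_C_mul _ _

theorem coeffXY_mono {r i j : ℕ} (hj : j ≤ r) :
    coeffXY R r i (mono R r j) = if i = j then 1 else 0 := by
  change MvPolynomial.coeff _ (mono R r j).1 = _
  rw [mono_val R hj, MvPolynomial.X_pow_eq_monomial, MvPolynomial.X_pow_eq_monomial,
    MvPolynomial.monomial_mul, MvPolynomial.coeff_monomial]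
  have : (Finsupp.single (0 : Fin 2) (r - j) + Finsupp.single 1 j =
      Finsupp.single 0 (r - i) + Finsupp.single 1 i) ↔ i = j := by
    constructor
    · intro h
      have := DFunLike.congr_fun h 1
      simpa using this.symm
    · rintro rfl; rfl
  simp only [this, one_mul]

theorem sum_coeff_mono {r : ℕ} (f : SymPow R r) :
    f = ∑ j ∈ Finset.range (r + 1), coeffXY R r j f • mono R r j := by
  classical
  have hf : f.1.IsHomogeneous r := f.2
  apply Subtype.ext
  rw [SymPow.coe_sum]
  ext d
  rw [MvPolynomial.coeff_sum]
  have hc : ∀ j ∈ Finset.range (r + 1), MvPolynomial.coeff d (coeffXY R r j f • mono R r j).1 =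
      if Finsupp.single (0 : Fin 2) (r - j) + Finsupp.single 1 j = d then
        MvPolynomial.coeff d f.1 else 0 := by
    intro j hj
    have hj' : j ≤ r := by have := Finset.mem_range.1 hj; omega
    rw [SymPow.coe_smul, MvPolynomial.coeff_C_mul, mono_val R hj', MvPolynomial.X_pow_eq_monomial,
      MvPolynomial.X_pow_eq_monomial, MvPolynomial.monomial_mul, MvPolynomial.coeff_monomial]
    split_ifs with h
    · rw [← h]; simp [coeffXY]
    · simp
  rw [Finset.sum_congr rfl hc]
  by_cases hd : MvPolynomial.coeff d f.1 = 0
  · simp [hd]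
  have hdeg := hf hd
  have hdeg' : d 0 + d 1 = r := by
    rw [← hdeg, Finsupp.weight_apply, Finsupp.sum_fintype _ _ (by simp)]
    simp
  rw [Finset.sum_eq_single (d 1)]
  · rw [if_pos]
    ext i
    fin_cases i
    · simp; omega
    · simp
  · intro j _ hj
    rw [if_neg]
    rintro rfl
    simp at hj
  · intro h
    exact absurd (Finset.mem_range.2 (by omega)) h

variable [Algebra ℤ_[2] R]

theorem symInt_adj_zero_mono {r j : ℕ} (hj : j ≤ r) :
    symInt R r (heckeMat 0).adjugate (mono R r j) = (2 ^ j : R) • mono R r j := by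
  apply Subtype.ext
  rw [symInt_adjugate, SymPow.coe_smul, mono_val R hj]
  simp [mul_pow, C_two]
  ring

theorem symInt_adj_two_mono {r j : ℕ} (hj : j ≤ r) :
    symInt R r (heckeMat 2).adjugate (mono R r j) = (2 ^ (r - j) : R) • mono R r j := by
  apply Subtype.ext
  rw [symInt_adjugate, SymPow.coe_smul, mono_val R hj]
  simp [mul_pow, C_two]
  ring

theorem symInt_adj_one_mono {r j : ℕ} (hj : j ≤ r) :
    symInt R r (heckeMat 1).adjugate (mono R r j) =
      ∑ k ∈ Finset.range (j + 1), ((-1) ^ (j - k) * (j.choose k * 2 ^ k) : R) • mono R r k := by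
  apply Subtype.ext
  rw [symInt_adjugate, SymPow.coe_sum, mono_val R hj]
  simp only [Matrix.cons_val_one, Matrix.cons_val_zero, map_mul, map_pow, MvPolynomial.aeval_X]
  rw [sub_eq_add_neg, add_pow, Finset.mul_sum]
  refine Finset.sum_congr rfl fun k hk => ?_
  have hk' : k ≤ j := by have := Finset.mem_range.1 hk; omega
  rw [SymPow.coe_smul, mono_val R (hk'.trans hj), neg_pow, mul_pow,
    show r - k = (r - j) + (j - k) by omega, pow_add]
  simp [C_two]
  ring

theorem symRep_mkK_mono_zero {r : ℕ} (a b c d : ℤ_[2]) (h : IsUnit (a * d - b * c)) :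
    (symRep R r (mkK a b c d h) (mono R r 0)).1 =
      (C (algebraMap ℤ_[2] R a) * X 0 + C (algebraMap ℤ_[2] R c) * X 1) ^ r := by
  change MvPolynomial.aeval (linForm ((algebraMap ℤ_[2] R).mapMatrix !![a, b; c, d]))
    (mono R r 0).1 = _
  rw [mono_val R (Nat.zero_le r)]
  simp [linForm]

theorem symRep_shear_mono {r : ℕ} : symRep R r shear (mono R r 0) = mono R r 0 := by
  apply Subtype.ext
  rw [shear, symRep_mkK_mono_zero, mono_val R (Nat.zero_le r)]
  simp

theorem symRep_rot_mono {r : ℕ} : symRep R r rot (mono R r 0) = mono R r r := by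
  apply Subtype.ext
  rw [rot, symRep_mkK_mono_zero, mono_val R le_rfl]
  simp

theorem symRep_quarter_mono {r : ℕ} : symRep R r quarter (mono R r 0) = mono R r r := by
  apply Subtype.ext
  rw [quarter, symRep_mkK_mono_zero, mono_val R le_rfl]
  simp

theorem symRep_twist_mono {r : ℕ} : symRep R r twist (mono R r 0) =
    ((-1) ^ r : R) • ∑ k ∈ Finset.range (r + 1), (r.choose k * 2 ^ k : R) • mono R r (r - k) := by
  apply Subtype.ext
  rw [twist, symRep_mkK_mono_zero, SymPow.coe_smul, SymPow.coe_sum]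
  have e : C (algebraMap ℤ_[2] R (-2)) * X 0 + C (algebraMap ℤ_[2] R (-1)) * X 1 =
      (-1) * (2 * X 0 + X 1 : MvPolynomial (Fin 2) R) := by
    have h2 : (C (algebraMap ℤ_[2] R 2) : MvPolynomial (Fin 2) R) = 2 := by
      rw [map_ofNat, C_two]
    rw [map_neg, map_neg, map_neg, map_neg, h2]
    simp
    ring
  rw [e, mul_pow, add_pow]
  simp only [map_pow, map_neg, map_one]
  congr 1
  refine Finset.sum_congr rfl fun k hk => ?_
  have hk' : k ≤ r := by have := Finset.mem_range.1 hk; omega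
  rw [SymPow.coe_smul, mono_val R (Nat.sub_le r k), show r - (r - k) = k by omega]
  simp [mul_pow, C_two]
  ring

end

/-! ### Divisibility of binomial coefficients by powers of two -/

theorem isUnit_natCast_of_odd {m : ℕ} (hm : Odd m) : IsUnit (m : ℤ_[2]) := by
  rw [PadicInt.isUnit_iff]
  refine le_antisymm (PadicInt.norm_le_one _) (not_lt.1 fun h => ?_)
  rw [PadicInt.norm_natCast_lt_one_iff] at h
  exact (Nat.not_even_iff_odd.2 hm) (even_iff_two_dvd.2 h)

/-- In ℤ_2 the odd part of k is a unit, and the exponent of its power of two is at most s. -/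
theorem natCast_dvd_two_pow {k s : ℕ} (hk : 0 < k) (h : k < 2 ^ (s + 1)) :
    (k : ℤ_[2]) ∣ 2 ^ s := by
  obtain ⟨v, m, hm, rfl⟩ := Nat.exists_eq_two_pow_mul_odd hk.ne'
  have hv : 2 ^ v < 2 ^ (s + 1) := lt_of_le_of_lt (Nat.le_mul_of_pos_right _ hm.pos) h
  have hv' : v ≤ s := by
    have := (Nat.pow_lt_pow_iff_right (a := 2) (by norm_num)).1 hv
    omega
  rw [Nat.cast_mul, (isUnit_natCast_of_odd hm).mul_right_dvd]
  push_cast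
  exact pow_dvd_pow _ hv'

theorem lt_two_pow_sub_one {k : ℕ} (hk : 3 ≤ k) : k < 2 ^ (k - 2 + 1) := by
  obtain ⟨m, rfl⟩ := Nat.exists_eq_add_of_le hk
  rw [show 3 + m - 2 + 1 = m + 2 by omega]
  induction m with
  | zero => norm_num
  | succ m ih => have := ih (by omega); rw [pow_succ]; omega

theorem exists_sum_smul_of_dvd {A L : Type*} [CommRing A] [AddCommGroup L] [Module A L]
    (c : A) (s : Finset ℕ) (u : ℕ → A) (f : ℕ → L)
    (h : ∀ k ∈ s, c ∣ u k) : ∃ z, ∑ k ∈ s, u k • f k = c • z := by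
  classical
  choose! v hv using h
  refine ⟨∑ k ∈ s, v k • f k, ?_⟩
  rw [Finset.smul_sum]
  exact Finset.sum_congr rfl fun k hk => by rw [smul_smul, ← hv k hk]

section
variable {A : Type*} [CommRing A] [Algebra ℤ_[2] A]

/-- From k·C(n,k) = n·C(n-1,k-1), together with k ∣ 2^(k-2) in ℤ_2 for k ≥ 3. -/
theorem four_mul_dvd_choose {n k : ℕ} (hn : 0 < n) (hk : 3 ≤ k) :
    (4 * n : A) ∣ n.choose k * 2 ^ k := by
  suffices h : (4 * n : ℤ_[2]) ∣ n.choose k * 2 ^ k by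
    have := map_dvd (algebraMap ℤ_[2] A) h
    simpa only [map_mul, map_pow, map_natCast, map_ofNat] using this
  obtain ⟨w, hw⟩ := natCast_dvd_two_pow (by omega) (lt_two_pow_sub_one hk)
  obtain ⟨m, rfl⟩ : ∃ m, n = m + 1 := ⟨n - 1, by omega⟩
  obtain ⟨l, rfl⟩ : ∃ l, k = l + 1 := ⟨k - 1, by omega⟩
  have h1 : (m + 1 : ℤ_[2]) * m.choose l = (m + 1).choose (l + 1) * (l + 1) := by
    exact_mod_cast Nat.add_one_mul_choose_eq m l
  refine ⟨m.choose l * w, ?_⟩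
  have h2 : ((l + 1 : ℕ) : ℤ_[2]) ≠ 0 := by exact_mod_cast Nat.succ_ne_zero l
  apply mul_right_cancel₀ h2
  have h3 : (2 : ℤ_[2]) ^ (l + 1) = 4 * 2 ^ (l + 1 - 2) := by
    conv_lhs => rw [show l + 1 = (l + 1 - 2) + 2 by omega]
    rw [pow_add]; ring
  rw [h3, hw]
  push_cast at h1 ⊢
  linear_combination -4 * (l + 1) * w * h1

/-- Pascal's rule reduces this to `four_mul_dvd_choose`, except for k = 3, where the extra term
8·C(n,2) = 4n(n-1) is divisible directly. -/
theorem four_mul_dvd_choose_succ {n k : ℕ} (hn : 0 < n) (hk : 3 ≤ k) :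
    (4 * n : A) ∣ (n + 1).choose k * 2 ^ k := by
  obtain ⟨l, rfl⟩ : ∃ l, k = l + 1 := ⟨k - 1, by omega⟩
  have e : ((n + 1).choose (l + 1) * 2 ^ (l + 1) : A) =
      2 * (n.choose l * 2 ^ l) + n.choose (l + 1) * 2 ^ (l + 1) := by
    rw [Nat.choose_succ_succ]; push_cast; ring
  rw [e]
  refine dvd_add ?_ (four_mul_dvd_choose hn hk)
  rcases (show l = 2 ∨ 3 ≤ l by omega) with rfl | hl
  · obtain ⟨m, rfl⟩ : ∃ m, n = m + 1 := ⟨n - 1, by omega⟩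
    have h1 : (m + 1 : A) * m = (m + 1).choose 2 * 2 := by
      have := Nat.add_one_mul_choose_eq m 1
      rw [Nat.choose_one_right] at this
      exact_mod_cast congrArg (Nat.cast (R := A)) this
    exact ⟨m, by push_cast; linear_combination -4 * h1⟩
  · exact (four_mul_dvd_choose hn hl).mul_left 2

theorem four_mul_dvd_two_pow {n : ℕ} (hn : 3 ≤ n) : (4 * n : A) ∣ 2 ^ n := by
  have h := map_dvd (algebraMap ℤ_[2] A) (natCast_dvd_two_pow (by omega) (lt_two_pow_sub_one hn))
  rw [map_natCast, map_pow, map_ofNat] at h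
  have := mul_dvd_mul_left (4 : A) h
  rwa [show (4 : A) * 2 ^ (n - 2) = 2 ^ n by
    conv_rhs => rw [show n = (n - 2) + 2 by omega]
    rw [pow_add]; ring] at this

theorem two_mul_dvd_two_pow {n : ℕ} (hn : 2 ≤ n) : (2 * n : A) ∣ 2 ^ n := by
  rcases (show n = 2 ∨ 3 ≤ n by omega) with rfl | hn
  · norm_num
  · refine dvd_trans ⟨2, by ring⟩ (four_mul_dvd_two_pow hn)

variable {L : Type*} [AddCommGroup L] [Module A L]

/-- The expansion of `X^(r-n) (2Y - X)^n` modulo `4n`, for `n` even. -/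
theorem sum_expand_even {n : ℕ} (hn : 2 ≤ n) (he : Even n) (f : ℕ → L) :
    ∃ z, ∑ k ∈ Finset.range (n + 1), ((-1) ^ (n - k) * (n.choose k * 2 ^ k) : A) • f k =
      f 0 + (2 * n : A) • (f 1 + f 2) + (4 * n : A) • z := by
  obtain ⟨m, rfl⟩ : ∃ m, n = m + 2 := ⟨n - 2, by omega⟩
  rw [Finset.sum_range_succ', Finset.sum_range_succ', Finset.sum_range_succ']
  obtain ⟨z, hz⟩ := exists_sum_smul_of_dvd (4 * (m + 2 : ℕ) : A) (Finset.range m)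
    (fun k => (-1) ^ (m + 2 - (k + 3)) * ((m + 2).choose (k + 3) * 2 ^ (k + 3)))
    (fun k => f (k + 3)) (fun k _ =>
      (four_mul_dvd_choose (by omega) (by omega)).mul_left _)
  rw [hz]
  obtain ⟨l, hl⟩ : Even m := by rwa [Nat.even_add, iff_true_right even_two] at he
  have hc : ((m + 2).choose 2 * 2 : A) = (m + 2) * (m + 1) := by
    have := Nat.add_one_mul_choose_eq (m + 1) 1
    rw [Nat.choose_one_right] at this
    exact_mod_cast congrArg (Nat.cast (R := A)) this.symm
  -- The exact coefficients of f 1 and f 2 are -2n = 2n - 4n and 2n(n-1) = 2n + 4n·l, with l = n/2 -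
  -- 1.
  refine ⟨z - f 1 + (l : A) • f 2, ?_⟩
  have h1 : (-1 : A) ^ (m + 1) = -1 := Odd.neg_one_pow ⟨l, by omega⟩
  have h2 : (-1 : A) ^ m = 1 := Even.neg_one_pow ⟨l, hl⟩
  have h3 : (-1 : A) ^ (m + 2) = 1 := he.neg_one_pow
  have hm : (m : A) = 2 * l := by rw [hl]; push_cast; ring
  simp only [zero_add, Nat.sub_zero, show 0 + 1 + 1 = 2 from rfl, Nat.add_sub_cancel,
    show m + 2 - 1 = m + 1 from rfl, h1, h2, h3, Nat.choose_zero_right, Nat.choose_one_right]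
  rw [show (1 * (((m + 2).choose 2 : ℕ) * 2 ^ 2) : A) = 2 * ((m + 2) * (m + 1)) by
    rw [← hc]; ring]
  push_cast
  rw [hm]
  module

/-- The expansion of `X^(r-j) (2Y - X)^j` modulo `4`. -/
theorem sum_expand_mod_four {A L : Type*} [CommRing A] [AddCommGroup L] [Module A L]
    (j : ℕ) (f : ℕ → L) :
    ∃ z, ∑ k ∈ Finset.range (j + 1), ((-1) ^ (j - k) * (j.choose k * 2 ^ k) : A) • f k =
      ((-1) ^ j : A) • (f 0 - (2 * j : A) • f 1) + (4 : A) • z := by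
  cases j with
  | zero => exact ⟨0, by simp⟩
  | succ m =>
    rw [Finset.sum_range_succ', Finset.sum_range_succ']
    obtain ⟨z, hz⟩ := exists_sum_smul_of_dvd (4 : A) (Finset.range m)
      (fun k => (-1) ^ (m + 1 - (k + 1 + 1)) * ((m + 1).choose (k + 1 + 1) * 2 ^ (k + 1 + 1)))
      (fun k => f (k + 1 + 1)) (fun k _ =>
        Dvd.dvd.mul_left (Dvd.dvd.mul_left ⟨2 ^ k, by ring⟩ _) _)
    rw [hz]
    refine ⟨z, ?_⟩
    simp
    rw [pow_succ]
    module

/-- The expansion of `Y^r - (2X + Y)^r` modulo `4n`, for `r = n + 1` odd. -/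
theorem sum_expand_odd {n : ℕ} (hn : 2 ≤ n) (he : Even n) (f : ℕ → L) :
    ∃ z, ∑ k ∈ Finset.range (n + 2), ((n + 1).choose k * 2 ^ k : A) • f k =
      f 0 + (2 : A) • f 1 - (2 * n : A) • (f 1 + f 2) + (4 * n : A) • z := by
  obtain ⟨m, rfl⟩ : ∃ m, n = m + 1 := ⟨n - 1, by omega⟩
  rw [Finset.sum_range_succ', Finset.sum_range_succ', Finset.sum_range_succ']
  obtain ⟨z, hz⟩ := exists_sum_smul_of_dvd (4 * (m + 1 : ℕ) : A) (Finset.range m)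
    (fun k => ((m + 1 + 1).choose (k + 3) * 2 ^ (k + 3)))
    (fun k => f (k + 3)) (fun k _ => four_mul_dvd_choose_succ (by omega) (by omega))
  rw [hz]
  obtain ⟨l, hl⟩ := he
  have hc : ((m + 1 + 1).choose 2 * 2 : A) = (m + 2) * (m + 1) := by
    have := Nat.add_one_mul_choose_eq (m + 1) 1
    rw [Nat.choose_one_right] at this
    exact_mod_cast congrArg (Nat.cast (R := A)) this.symm
  -- The exact coefficients of f 1 and f 2 are 2(n+1) = 2 - 2n + 4n and 2n(n+1) = -2n + 4n(l+1),
  -- with l = n/2.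
  refine ⟨z + f 1 + (l + 1 : A) • f 2, ?_⟩
  have hm : (m : A) = 2 * l - 1 := by
    have := congrArg (Nat.cast (R := A)) hl
    push_cast at this
    linear_combination this
  simp only [zero_add, show 0 + 1 + 1 = 2 from rfl, Nat.choose_zero_right, Nat.choose_one_right]
  rw [show ((((m + 1 + 1).choose 2 : ℕ) : A) * 2 ^ 2) = 2 * ((m + 2) * (m + 1)) by
    rw [← hc]; ring]
  push_cast
  rw [hm]
  module

/-- The expansion of `(2X + Y)^r` modulo `4`, for `r = n + 1` even. -/
theorem sum_expand_mod_four_of_even {A L : Type*} [CommRing A] [AddCommGroup L] [Module A L]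
    {n : ℕ} (he : Even (n + 1)) (f : ℕ → L) :
    ∃ z, ∑ k ∈ Finset.range (n + 2), ((n + 1).choose k * 2 ^ k : A) • f k =
      f 0 + (4 : A) • z := by
  rw [Finset.sum_range_succ', Finset.sum_range_succ']
  obtain ⟨z, hz⟩ := exists_sum_smul_of_dvd (4 : A) (Finset.range n)
    (fun k => ((n + 1).choose (k + 1 + 1) * 2 ^ (k + 1 + 1)))
    (fun k => f (k + 1 + 1)) (fun k _ => Dvd.dvd.mul_left ⟨2 ^ k, by ring⟩ _)
  rw [hz]
  obtain ⟨l, hl⟩ := he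
  have hm : (n : A) = 2 * l - 1 := by
    have := congrArg (Nat.cast (R := A)) hl
    push_cast at this
    linear_combination this
  refine ⟨z + (l : A) • f 1, ?_⟩
  simp
  rw [hm]
  module

end

/-! ### Torsion-free modules on which the Hecke operator is a scalar -/

/-- A family of classes `[g, w]` in a module `L` on which `a` is a non-zero-divisor, with the
relations of the compact induction and with the Hecke operator acting as the scalar `a`. -/
structure IsHeckeClass {A L : Type*} [CommRing A] [Algebra ℤ_[2] A] [AddCommGroup L] [Module A L]
    {r : ℕ} (a : A) (cl : G → SymPow A r →ₗ[A] L) : Prop where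
  inj : ∀ x y : L, a • x = a • y → x = y
  mul_K : ∀ g k w, cl (g * KtoG k) w = cl g (symRep A r k w)
  mul_two : ∀ g w, cl (g * two) w = cl g w
  hecke : ∀ g w, a • cl g w = cl (g * heckeG 0) (symInt A r (heckeMat 0).adjugate w) +
    cl (g * heckeG 1) (symInt A r (heckeMat 1).adjugate w) +
    cl (g * heckeG 2) (symInt A r (heckeMat 2).adjugate w)

namespace IsHeckeClass

variable {A L : Type*} [CommRing A] [Algebra ℤ_[2] A] [AddCommGroup L] [Module A L]

section
variable {r : ℕ} {a b : A} {cl : G → SymPow A r →ₗ[A] L}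

theorem hecke_mono (h : IsHeckeClass a cl) (g : G) {j : ℕ} (hj : j ≤ r) :
    a • cl g (mono A r j) = (2 ^ j : A) • cl (g * heckeG 0) (mono A r j) +
      ∑ k ∈ Finset.range (j + 1),
        ((-1) ^ (j - k) * (j.choose k * 2 ^ k) : A) • cl (g * heckeG 1) (mono A r k) +
      (2 ^ (r - j) : A) • cl (g * heckeG 2) (mono A r j) := by
  rw [h.hecke, symInt_adj_zero_mono hj, symInt_adj_one_mono hj, symInt_adj_two_mono hj]
  simp only [map_smul, map_sum]

theorem hecke_mono_zero (h : IsHeckeClass a cl) (g : G) :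
    a • cl g (mono A r 0) = cl (g * heckeG 0) (mono A r 0) + cl (g * heckeG 1) (mono A r 0) +
      (2 ^ r : A) • cl (g * heckeG 2) (mono A r 0) := by
  rw [h.hecke_mono g (Nat.zero_le r)]
  simp

theorem mono_shear (h : IsHeckeClass a cl) (g : G) :
    cl (g * KtoG shear) (mono A r 0) = cl g (mono A r 0) := by
  rw [h.mul_K, symRep_shear_mono]

theorem mono_rot (h : IsHeckeClass a cl) (g : G) :
    cl (g * KtoG rot) (mono A r 0) = cl g (mono A r r) := by
  rw [h.mul_K, symRep_rot_mono]

theorem mono_quarter (h : IsHeckeClass a cl) (g : G) :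
    cl (g * KtoG quarter) (mono A r 0) = cl g (mono A r r) := by
  rw [h.mul_K, symRep_quarter_mono]

theorem mono_shear_heckeG_one (h : IsHeckeClass a cl) (g : G) :
    cl (g * KtoG shear * heckeG 1) (mono A r 0) = cl (g * heckeG 0) (mono A r 0) := by
  rw [mul_assoc, shear_mul_heckeG_one, ← mul_assoc, h.mono_shear]

theorem mono_heckeG_two_shear (h : IsHeckeClass a cl) (g : G) :
    cl (g * heckeG 2 * KtoG shear * heckeG 1) (mono A r 0) = cl g (mono A r 0) := by
  rw [mul_assoc, mul_assoc, ← mul_assoc (heckeG 2), heckeG_two_mul_shear, ← mul_assoc, h.mul_two,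
    h.mono_shear]

/-- The m_0 and m_2 terms carry the even factors 2^j and 2^(r-j), and in X^(r-j)(2Y - X)^j only the
X^r coefficient is odd. -/
theorem exists_hecke_mono (h : IsHeckeClass a cl) (g : G) {j : ℕ} (h0 : 0 < j) (hj : j < r) :
    ∃ z, a • cl g (mono A r j) =
      ((-1) ^ j : A) • cl (g * heckeG 1) (mono A r 0) + (2 : A) • z := by
  obtain ⟨z, hz⟩ := sum_expand_mod_four (A := A) j
    (fun k => cl (g * heckeG 1) (mono A r k))
  obtain ⟨i, rfl⟩ : ∃ i, j = i + 1 := ⟨j - 1, by omega⟩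
  obtain ⟨l, hl⟩ : ∃ l, r - (i + 1) = l + 1 := ⟨r - (i + 1) - 1, by omega⟩
  rw [h.hecke_mono g hj.le, hz, hl]
  refine ⟨(2 ^ i : A) • cl (g * heckeG 0) (mono A r (i + 1)) -
    ((-1) ^ (i + 1) * (i + 1 : ℕ) : A) • cl (g * heckeG 1) (mono A r 1) + (2 : A) • z +
    (2 ^ l : A) • cl (g * heckeG 2) (mono A r (i + 1)), ?_⟩
  rw [pow_succ (2 : A), pow_succ (2 : A)]
  module

/-- After multiplication by a both sides are ±[g m_1, X^r] modulo 2 = ab, and the sign does not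
matter modulo 2; then a is cancelled. -/
theorem exists_mono_sub (h : IsHeckeClass a cl) (hb : a * b = 2) (g : G) {i j : ℕ} (hi0 : 0 < i)
    (hi : i < r) (h0 : 0 < j) (hj : j < r) :
    ∃ z, cl g (mono A r i) = cl g (mono A r j) + b • z := by
  obtain ⟨z, hz⟩ := h.exists_hecke_mono g hi0 hi
  obtain ⟨z', hz'⟩ := h.exists_hecke_mono g h0 hj
  obtain ⟨c, hc⟩ : ∃ c : A, (-1) ^ i = (-1) ^ j + 2 * c := by
    rcases neg_one_pow_eq_or A i with e | e <;> rcases neg_one_pow_eq_or A j with e' | e' <;>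
      rw [e, e']
    exacts [⟨0, by ring⟩, ⟨1, by ring⟩, ⟨-1, by ring⟩, ⟨0, by ring⟩]
  refine ⟨c • cl (g * heckeG 1) (mono A r 0) + z - z', h.inj _ _ ?_⟩
  rw [smul_add, hz, hz', hc, smul_smul, hb]
  module

/-- By `mono_heckeG_two_shear`, [g, X^r] is the leading term of a times a middle monomial class
based at g m_2 shear; the rest is divisible by 2 = ab. -/
theorem exists_mono_zero (h : IsHeckeClass a cl) (hb : a * b = 2) (hr : 2 ≤ r) (g : G) :
    ∃ z, cl g (mono A r 0) = a • z := by
  obtain ⟨z, hz⟩ := h.exists_hecke_mono (g * heckeG 2 * KtoG shear) (j := 1) one_pos (by omega)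
  rw [h.mono_heckeG_two_shear] at hz
  refine ⟨-cl (g * heckeG 2 * KtoG shear) (mono A r 1) + b • z, ?_⟩
  rw [smul_add, smul_neg, hz, smul_smul, hb]
  module

/-- The sum of `[g, ℓ^r]` over three linear forms with sum zero. -/
theorem hecke_sum_rot (h : IsHeckeClass a cl) (g : G) {W : G → L}
    (hW : ∀ g, W g = cl g (mono A r r) + ((-1) ^ r : A) • ∑ k ∈ Finset.range (r + 1),
      (r.choose k * 2 ^ k : A) • cl g (mono A r (r - k)) + (2 ^ r : A) • cl g (mono A r 0)) :
    a • (cl g (mono A r 0) + cl (g * KtoG rot) (mono A r 0) +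
        cl (g * KtoG rot ^ 2) (mono A r 0)) =
      W (g * heckeG 2) + W (g * KtoG rot * heckeG 2) + W (g * KtoG rot ^ 2 * heckeG 2) := by
  -- The nine terms of the three Hecke relations are regrouped by neighbour. The vertex g m_2
  -- receives Y^r from g·rot through m_1, (-2X-Y)^r from g·rot² through m_0, and 2^r X^r from g
  -- through m_2. Translating g by powers of `rot` gives the other two neighbours.
  have h1 : ∀ g, cl (g * KtoG rot * heckeG 1) (mono A r 0) =
      cl (g * heckeG 2) (mono A r r) := fun g => by
    rw [mul_assoc, rot_mul_heckeG_one, ← mul_assoc, h.mono_quarter]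
  have h2 : ∀ g, cl (g * KtoG rot ^ 2 * heckeG 0) (mono A r 0) =
      ((-1) ^ r : A) • ∑ k ∈ Finset.range (r + 1),
        (r.choose k * 2 ^ k : A) • cl (g * heckeG 2) (mono A r (r - k)) := fun g => by
    rw [mul_assoc, rot_sq_mul_heckeG_zero, ← mul_assoc, h.mul_K, symRep_twist_mono]
    simp only [map_smul, map_sum]
  have e3 : g * KtoG rot ^ 2 * KtoG rot = g := by
    rw [mul_assoc, ← pow_succ, rot_pow_three, mul_one]
  have e4 : g * KtoG rot * KtoG rot ^ 2 = g := by
    rw [mul_assoc, ← pow_succ', rot_pow_three, mul_one]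
  have e5 : g * KtoG rot ^ 2 * KtoG rot ^ 2 = g * KtoG rot := by
    rw [mul_assoc, ← pow_add, pow_succ, rot_pow_three, one_mul]
  have e6 : g * KtoG rot * KtoG rot = g * KtoG rot ^ 2 := by
    rw [mul_assoc, ← pow_two]
  have a1 := h1 g
  have a2 := h1 (g * KtoG rot)
  have a3 := h1 (g * KtoG rot ^ 2)
  have b1 := h2 g
  have b2 := h2 (g * KtoG rot)
  have b3 := h2 (g * KtoG rot ^ 2)
  rw [e6] at a2
  rw [e3] at a3
  rw [e4] at b2
  rw [e5] at b3
  rw [smul_add, smul_add, h.hecke_mono_zero, h.hecke_mono_zero, h.hecke_mono_zero, a1, a2, a3,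
    b1, b2, b3, hW, hW, hW]
  abel

end

/-! ### The Hecke relation for even r -/

section Even
variable {n : ℕ} {a b : A} {cl : G → SymPow A (n + 1) →ₗ[A] L}

/-- The relation for even `r = n + 1`. -/
theorem sum_mem_of_even (h : IsHeckeClass a cl) (hb : a * b = 2) (hn : 1 ≤ n)
    (he : Even (n + 1)) (g : G) :
    ∃ z, cl (g * heckeG 2 * KtoG shear) (mono A _ n) +
      cl (g * KtoG rot * heckeG 2 * KtoG shear) (mono A _ n) +
      cl (g * KtoG rot ^ 2 * heckeG 2 * KtoG shear) (mono A _ n) = b • z := by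
  have hu : ∀ g, ∃ z, cl g (mono A _ 0) =
      a • (-cl (g * heckeG 2 * KtoG shear) (mono A _ n) + b • z) := by
    intro g
    obtain ⟨z, hz⟩ := h.exists_hecke_mono (g * heckeG 2 * KtoG shear) (j := n) hn
      (Nat.lt_succ_self n)
    have ho : (-1 : A) ^ n = -1 := by
      rw [Nat.even_add_one, Nat.not_even_iff_odd] at he
      exact he.neg_one_pow
    rw [h.mono_heckeG_two_shear, ho] at hz
    refine ⟨z, ?_⟩
    rw [smul_add, smul_neg, hz, smul_smul, hb]
    module
  -- Modulo 4 the contribution is 2Y^r, and Y^r already has class in aL; as 4 = 2ab, everything is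
  -- divisible by 2a.
  have hw : ∀ g, ∃ z, cl g (mono A _ (n + 1)) +
      ((-1) ^ (n + 1) : A) • ∑ k ∈ Finset.range (n + 1 + 1),
        ((n + 1).choose k * 2 ^ k : A) • cl g (mono A _ (n + 1 - k)) +
      (2 ^ (n + 1) : A) • cl g (mono A _ 0) = (a * 2) • z := by
    intro g
    obtain ⟨z, hz⟩ := sum_expand_mod_four_of_even (A := A) he
      (fun k => cl g (mono A _ (n + 1 - k)))
    obtain ⟨y, hy⟩ := h.exists_mono_zero hb (by omega) g
    obtain ⟨y', hy'⟩ := h.exists_mono_zero hb (by omega) (g * KtoG quarter)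
    rw [h.mono_quarter] at hy'
    rw [hz, he.neg_one_pow, Nat.sub_zero, hy, hy', pow_succ]
    refine ⟨y' + b • z + (2 ^ n : A) • y, ?_⟩
    rw [show (4 : A) = a * 2 * b by linear_combination -2 * hb]
    module
  choose W hW using hw
  have key := h.hecke_sum_rot g (W := fun g => (a * 2) • W g) (fun g => (hW g).symm)
  obtain ⟨z0, h0⟩ := hu g
  obtain ⟨z1, h1⟩ := hu (g * KtoG rot)
  obtain ⟨z2, h2⟩ := hu (g * KtoG rot ^ 2)
  rw [h0, h1, h2] at key
  -- Both sides of `key` are multiples of a², because 2a = a²b; a is cancelled twice.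
  refine ⟨z0 + z1 + z2 - W (g * heckeG 2) - W (g * KtoG rot * heckeG 2) -
    W (g * KtoG rot ^ 2 * heckeG 2), h.inj _ _ (h.inj _ _ ?_)⟩
  rw [show (a * 2 : A) = a * a * b by linear_combination -a * hb] at key
  linear_combination (norm := module) -key

end Even

end IsHeckeClass

/-! ### The Hecke relation for odd r, with n = r - 1 even -/

namespace IsHeckeClass

variable {A L : Type*} [CommRing A] [Algebra ℤ_[2] A] [AddCommGroup L] [Module A L]
  {n : ℕ} {a b : A} {cl : G → SymPow A (n + 1) →ₗ[A] L}

/-- `T [g, X Y^n]` modulo `4n`, for `n` even. -/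
theorem exists_hecke_even (h : IsHeckeClass a cl) (hn : 2 ≤ n) (he : Even n) (g : G) :
    ∃ z, a • cl g (mono A _ n) = (2 : A) • cl (g * heckeG 2) (mono A _ n) +
      (2 ^ n : A) • cl (g * heckeG 0) (mono A _ n) + cl (g * heckeG 1) (mono A _ 0) +
      (2 * n : A) • (cl (g * heckeG 1) (mono A _ 1) + cl (g * heckeG 1) (mono A _ 2)) +
      (4 * n : A) • z := by
  obtain ⟨z, hz⟩ := sum_expand_even (A := A) hn he (fun k => cl (g * heckeG 1) (mono A _ k))
  rw [h.hecke_mono g (Nat.le_succ n), hz, show n + 1 - n = 1 by omega, pow_one]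
  exact ⟨z, by abel⟩

/-- The exponents 1 and 2 have opposite parity, so the X^r terms cancel after multiplication by a
and only a multiple of 2 = ab is left. -/
theorem exists_mono_one_add_mono_two (h : IsHeckeClass a cl) (hb : a * b = 2) (hn : 2 ≤ n)
    (g : G) : ∃ z, cl g (mono A _ 1) + cl g (mono A _ 2) = b • z := by
  obtain ⟨z, hz⟩ := h.exists_hecke_mono g (j := 1) one_pos (by omega)
  obtain ⟨z', hz'⟩ := h.exists_hecke_mono g (j := 2) two_pos (by omega)
  refine ⟨z + z', h.inj _ _ ?_⟩
  rw [smul_add, hz, hz', smul_smul, hb]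
  module

/-- `[g, X^r]` modulo `4n` and modulo `2nb`, for `r = n + 1` odd. -/
theorem exists_mono_zero_even (h : IsHeckeClass a cl) (hb : a * b = 2) (hn : 2 ≤ n)
    (he : Even n) (g : G) :
    ∃ y z, cl g (mono A _ 0) = a • cl (g * heckeG 2 * KtoG shear) (mono A _ n) -
      (2 : A) • cl (g * heckeG 2 * KtoG shear * heckeG 2) (mono A _ n) -
      (2 ^ n : A) • cl (g * heckeG 2 * KtoG shear * heckeG 0) (mono A _ n) +
      (2 * n * b) • y + (4 * n : A) • z := by
  obtain ⟨z, hz⟩ := h.exists_hecke_even hn he (g * heckeG 2 * KtoG shear)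
  obtain ⟨y, hy⟩ := h.exists_mono_one_add_mono_two hb hn (g * heckeG 2 * KtoG shear * heckeG 1)
  rw [hy, h.mono_heckeG_two_shear] at hz
  refine ⟨-y, -z, ?_⟩
  rw [hz]
  module

/-- The combination of classes that satisfies the recursion `exists_recursion`. -/
def recClass (a : A) (cl : G → SymPow A (n + 1) →ₗ[A] L) (g : G) : L :=
  (a ^ 2) • cl (g * KtoG shear) (mono A _ n) -
    (2 * a) • cl (g * KtoG shear * heckeG 2) (mono A _ n) + (2 : A) • cl g (mono A _ n)

/-- The relations for XY^n at g·shear and at g express U(g m_0) and U(g m_1) through E. Their sum is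
aU(g) up to a multiple of 2^r, and `exists_mono_zero_even` expresses U(g) through E at g m_2 shear
and its neighbours. Eliminating U leaves a relation among E alone, in which the combination
`recClass` occurs at g and at g m_2. -/
theorem exists_recursion (h : IsHeckeClass a cl) (hb : a * b = 2) (hn : 2 ≤ n)
    (he : Even n) (g : G) :
    ∃ y z, recClass a cl g = (2 - a ^ 2) • cl g (mono A _ n) +
      a • recClass a cl (g * heckeG 2) +
      (2 ^ n * a) • (cl (g * KtoG shear * heckeG 0) (mono A _ n) +
        cl (g * heckeG 0) (mono A _ n)) + (2 * n * a ^ 2) • y + (4 * n : A) • z := by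
  obtain ⟨z1, h1⟩ := h.exists_hecke_even hn he (g * KtoG shear)
  obtain ⟨z2, h2⟩ := h.exists_hecke_even hn he g
  obtain ⟨y1, hy1⟩ := h.exists_mono_one_add_mono_two hb hn (g * KtoG shear * heckeG 1)
  obtain ⟨y2, hy2⟩ := h.exists_mono_one_add_mono_two hb hn (g * heckeG 1)
  obtain ⟨y3, z3, h3⟩ := h.exists_mono_zero_even hb hn he g
  have h4 := h.hecke_mono_zero g
  obtain ⟨c, hc⟩ := two_mul_dvd_two_pow (A := A) hn
  rw [hy1, h.mono_shear_heckeG_one] at h1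
  rw [hy2] at h2
  rw [pow_succ] at h4
  have e1 : (2 * n * b * a : A) = 4 * n := by linear_combination 2 * n * hb
  have k1 : ∀ x : L, (4 * n : A) • x = (2 * n * b * a : A) • x := fun x => by rw [e1]
  have k2 : ∀ x : L, (2 ^ n : A) • x = (2 * n * c : A) • x := fun x => by rw [hc]
  refine ⟨-(c • cl (g * heckeG 2 * KtoG shear * heckeG 0) (mono A _ n)),
    y1 + y2 + a • y3 + a • z1 + a • z2 + (a ^ 2) • z3 -
      (a * c) • cl (g * heckeG 2) (mono A _ 0), ?_⟩
  rw [recClass, recClass]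
  have K1 := k1 y1
  have K2 := k1 y2
  have K3 := k1 y3
  have K4 := k2 (cl (g * heckeG 2 * KtoG shear * heckeG 0) (mono A _ n))
  have K5 := k2 (cl (g * heckeG 2) (mono A _ 0))
  linear_combination (norm := module) a • h1 + a • h2 - a • h4 + (a ^ 2) • h3 - K1 - K2 -
    a • K3 - (a ^ 2) • K4 - (2 * a) • K5

/-- The recursion is iterated along g, g m_2, g m_2², and so on. The error coefficients 2^n a, 2na²
and 4n = 2nab are multiples of 2na, and the remainder carries a power of a which finally is one too.
-/
theorem exists_recClass (h : IsHeckeClass a cl) (hb : a * b = 2) (hn : 2 ≤ n)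
    (he : Even n) (ha : ∃ k, (2 * n * a : A) ∣ a ^ k) (g : G) :
    ∃ y z, recClass a cl g = (2 - a ^ 2) • y + (2 * n * a) • z := by
  obtain ⟨k, d, hd⟩ := ha
  obtain ⟨c, hc⟩ := two_mul_dvd_two_pow (A := A) hn
  have key : ∀ m : ℕ, ∀ g, ∃ x y z, recClass a cl g = (a ^ m) • x + (2 - a ^ 2) • y +
      (2 * n * a) • z := by
    intro m
    induction m with
    | zero => exact fun g => ⟨recClass a cl g, 0, 0, by simp⟩
    | succ m ih =>
      intro g
      obtain ⟨y, z, hyz⟩ := h.exists_recursion hb hn he g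
      obtain ⟨x', y', z', h'⟩ := ih (g * heckeG 2)
      refine ⟨x', a • y' + cl g (mono A _ n), a • z' + c • (cl (g * KtoG shear * heckeG 0)
        (mono A _ n) + cl (g * heckeG 0) (mono A _ n)) + a • y + b • z, ?_⟩
      rw [hyz, h', hc, show (4 * n : A) = 2 * n * a * b by linear_combination -2 * n * hb]
      module
  obtain ⟨x, y, z, hx⟩ := key k g
  refine ⟨y, d • x + z, ?_⟩
  rw [hx, hd]
  module

/-- As n and n - 1 have opposite parity, the X^r terms of the two Hecke relations cancel. What
remains at m_1 is -2[X^n Y] modulo 4, and X^n Y may be replaced by XY^n modulo b. Division by a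
turns 2 into b and 4 into 2b. -/
theorem exists_mono_add_mono_pred (h : IsHeckeClass a cl) (hb : a * b = 2) (hn : 2 ≤ n)
    (he : Even n) (g : G) :
    ∃ y z, cl g (mono A _ n) + cl g (mono A _ (n - 1)) =
      b • (cl (g * heckeG 2) (mono A _ n) + cl (g * heckeG 1) (mono A _ n) +
        (2 ^ (n - 2) : A) • cl (g * heckeG 0) (mono A _ n)) + (b ^ 2) • y + (2 * b) • z := by
  obtain ⟨m, rfl⟩ : ∃ m, n = m + 2 := ⟨n - 2, by omega⟩
  obtain ⟨z1, h1⟩ := sum_expand_mod_four (A := A) (m + 2)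
    (fun k => cl (g * heckeG 1) (mono A (m + 2 + 1) k))
  obtain ⟨z2, h2⟩ := sum_expand_mod_four (A := A) (m + 1)
    (fun k => cl (g * heckeG 1) (mono A (m + 2 + 1) k))
  have h3 := h.hecke_mono g (j := m + 2) (by omega)
  have h4 := h.hecke_mono g (j := m + 1) (by omega)
  rw [h1, he.neg_one_pow, show m + 2 + 1 - (m + 2) = 1 by omega] at h3
  have ho : Odd (m + 1) := by
    rw [← Nat.not_even_iff_odd, ← Nat.even_add_one]; exact he
  rw [h2, ho.neg_one_pow, show m + 2 + 1 - (m + 1) = 2 by omega] at h4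
  obtain ⟨y1, k1⟩ := h.exists_mono_sub hb (g * heckeG 1) (i := 1) (j := m + 2) (by omega)
    (by omega) (by omega) (by omega)
  obtain ⟨y2, k2⟩ := h.exists_mono_sub hb (g * heckeG 0) (i := m + 1) (j := m + 2) (by omega)
    (by omega) (by omega) (by omega)
  refine ⟨(2 ^ m : A) • y2 - y1, (2 ^ m : A) • cl (g * heckeG 0) (mono A _ (m + 2)) + z1 + z2 +
    cl (g * heckeG 2) (mono A _ (m + 1)) - cl (g * heckeG 1) (mono A _ (m + 2)),
    h.inj _ _ ?_⟩
  have hc : ∀ x : L, (2 : A) • x = (a * b) • x := fun x => by rw [hb]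
  simp only [show m + 2 - 1 = m + 1 from rfl, Nat.add_sub_cancel]
  rw [smul_add, h3, h4, k1, k2]
  simp only [smul_add, smul_sub, smul_smul]
  have e1 : a * (b * 2 ^ m) = 2 * 2 ^ m := by rw [← hb]; ring
  have e2 : a * (b ^ 2 * 2 ^ m) = 2 * 2 ^ m * b := by rw [← hb]; ring
  have e3 : a * (2 * b * 2 ^ m) = 4 * 2 ^ m := by linear_combination 2 * 2 ^ m * hb
  have e4 : a * (2 * b) = 4 := by linear_combination 2 * hb
  have e5 : a * b ^ 2 = 2 * b := by linear_combination b * hb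
  rw [e1, e2, e3, e4, e5, hb]
  push_cast
  rw [pow_succ, pow_succ]
  module

/-- The ideal of error terms. -/
def errIdeal (n : ℕ) (a b : A) : Ideal A :=
  Ideal.span {(2 - a ^ 2) * a, (2 - a ^ 2) * b, 2 * n * a ^ 2, 2 * n * b ^ 2, 4 * (n : A)}

/-- For n ≥ 3 both terms are multiples of 4n. For n = 2 the divisibility 4n ∣ 2^n fails, but the
difference 4a - 4b equals -2(2 - a²)b. -/
theorem two_pow_mul_sub_mem (hb : a * b = 2) (hn : 2 ≤ n) :
    (2 ^ n * a - 2 * n * b * 2 ^ (n - 2) : A) ∈ errIdeal n a b := by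
  have h4 : (4 * n : A) ∈ errIdeal n a b := Ideal.subset_span (by simp)
  rcases (show n = 2 ∨ 3 ≤ n by omega) with rfl | hn
  · have : (2 ^ 2 * a - 2 * (2 : ℕ) * b * 2 ^ (2 - 2) : A) = -2 * ((2 - a ^ 2) * b) := by
      push_cast
      norm_num
      linear_combination -2 * a * hb
    rw [this]
    exact Ideal.mul_mem_left _ _ (Ideal.subset_span (by simp))
  · refine sub_mem (Ideal.mul_mem_right _ _ (Ideal.mem_of_dvd _ (four_mul_dvd_two_pow hn) h4)) ?_
    obtain ⟨m, rfl⟩ : ∃ m, n = m + 3 := ⟨n - 3, by omega⟩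
    rw [show (2 * (m + 3 : ℕ) * b * 2 ^ (m + 3 - 2) : A) = (b * 2 ^ m) * (4 * (m + 3 : ℕ)) by
      rw [show m + 3 - 2 = m + 1 by omega, pow_succ]; ring]
    exact Ideal.mul_mem_left _ _ h4

/-- The left side is what the neighbour g m_2 contributes to `hecke_sum_rot`. The recursion at g m_2
removes the term with g m_2 shear m_0, and a·recClass(g m_2 m_2) is an error term by
`exists_recClass`. The two remaining terms at g m_2 m_0, with coefficients 2^n a and 2nb·2^(n-2),
cancel by `two_pow_mul_sub_mem`. -/
theorem exists_recClass_sub (h : IsHeckeClass a cl) (hb : a * b = 2) (hn : 2 ≤ n)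
    (he : Even n) (ha : ∃ k, (2 * n * a : A) ∣ a ^ k) (g : G) :
    ∃ x ∈ errIdeal n a b • (⊤ : Submodule A L), recClass a cl (g * heckeG 2) -
      (a * 2 ^ n) • cl (g * heckeG 2 * KtoG shear * heckeG 0) (mono A _ n) -
      (2 * n : A) • (cl (g * heckeG 2) (mono A _ n) + cl (g * heckeG 2) (mono A _ (n - 1))) =
      (2 - a ^ 2) • cl (g * heckeG 2) (mono A _ n) -
      (2 * n * b) • (cl (g * heckeG 2 * heckeG 2) (mono A _ n) +
        cl (g * heckeG 2 * heckeG 1) (mono A _ n)) + x := by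
  obtain ⟨y1, z1, h1⟩ := h.exists_recursion hb hn he (g * heckeG 2)
  obtain ⟨y2, z2, h2⟩ := h.exists_recClass hb hn he ha (g * heckeG 2 * heckeG 2)
  obtain ⟨y3, z3, h3⟩ := h.exists_mono_add_mono_pred hb hn he (g * heckeG 2)
  have mem : ∀ {c : A} (x : L), c ∈ errIdeal n a b →
      c • x ∈ errIdeal n a b • (⊤ : Submodule A L) :=
    fun x hc => Submodule.smul_mem_smul hc Submodule.mem_top
  have s1 : (2 - a ^ 2) * a ∈ errIdeal n a b := Ideal.subset_span (by simp)
  have s3 : 2 * n * a ^ 2 ∈ errIdeal n a b := Ideal.subset_span (by simp)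
  have s4 : 2 * n * b ^ 2 ∈ errIdeal n a b := Ideal.subset_span (by simp)
  have s5 : 4 * (n : A) ∈ errIdeal n a b := Ideal.subset_span (by simp)
  refine ⟨(2 ^ n * a - 2 * n * b * 2 ^ (n - 2)) • cl (g * heckeG 2 * heckeG 0) (mono A _ n) +
    ((2 - a ^ 2) * a) • y2 + (2 * n * a ^ 2) • (z2 + y1) + (2 * n * b ^ 2) • (-y3) +
    (4 * (n : A)) • (z1 - b • z3), ?_, ?_⟩
  · exact add_mem (add_mem (add_mem (add_mem (mem _ (two_pow_mul_sub_mem hb hn)) (mem _ s1))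
      (mem _ s3)) (mem _ s4)) (mem _ s5)
  · linear_combination (norm := module) h1 + a • h2 - (2 * n : A) • h3

/-- The relation for odd `r = n + 1`. -/
theorem sum_mem_of_odd (h : IsHeckeClass a cl) (hb : a * b = 2) (hn : 2 ≤ n)
    (he : Even n) (ha : ∃ k, (2 * n * a : A) ∣ a ^ k) (g : G) {E : G → L}
    (hE : ∀ g, E g = cl g (mono A _ n)) :
    (2 - a ^ 2) • (E (g * heckeG 2) + E (g * KtoG rot * heckeG 2) +
        E (g * KtoG rot ^ 2 * heckeG 2)) -
      (2 * n * b) • (E (g * heckeG 2 * heckeG 2) + E (g * heckeG 2 * heckeG 1) +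
        (E (g * KtoG rot * heckeG 2 * heckeG 2) + E (g * KtoG rot * heckeG 2 * heckeG 1)) +
        (E (g * KtoG rot ^ 2 * heckeG 2 * heckeG 2) +
          E (g * KtoG rot ^ 2 * heckeG 2 * heckeG 1))) ∈
      errIdeal n a b • (⊤ : Submodule A L) := by
  have hw : ∀ g, ∃ z, cl g (mono A _ (n + 1)) +
      ((-1) ^ (n + 1) : A) • ∑ k ∈ Finset.range (n + 1 + 1),
        ((n + 1).choose k * 2 ^ k : A) • cl g (mono A _ (n + 1 - k)) +
      (2 ^ (n + 1) : A) • cl g (mono A _ 0) = -(2 : A) • cl g (mono A _ n) +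
      (2 * n : A) • (cl g (mono A _ n) + cl g (mono A _ (n - 1))) + (4 * n : A) • z := by
    intro g
    obtain ⟨z, hz⟩ := sum_expand_odd (A := A) hn he (fun k => cl g (mono A _ (n + 1 - k)))
    obtain ⟨d, hd⟩ := two_mul_dvd_two_pow (A := A) hn
    rw [hz, he.add_one.neg_one_pow, show n + 1 - 2 = n - 1 by omega, pow_succ, hd, Nat.sub_zero,
      Nat.add_sub_cancel]
    exact ⟨d • cl g (mono A _ 0) - z, by module⟩
  choose W hW using hw
  have key := h.hecke_sum_rot g (W := fun g => -(2 : A) • cl g (mono A _ n) +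
      (2 * n : A) • (cl g (mono A _ n) + cl g (mono A _ (n - 1))) + (4 * n : A) • W g)
      (fun g => (hW g).symm)
  choose y z hU using h.exists_mono_zero_even hb hn he
  choose x hx hQ using h.exists_recClass_sub hb hn he ha
  have s5 : 4 * (n : A) ∈ errIdeal n a b := Ideal.subset_span (by simp)
  have e : ∀ x : L, (4 * n : A) • x = (2 * n * b * a) • x := fun x => by
    rw [show (2 * n * b * a : A) = 4 * n by linear_combination 2 * n * hb]
  set g1 := g * KtoG rot with hg1
  set g2 := g * KtoG rot ^ 2 with hg2
  have hmem : (4 * n : A) • (W (g * heckeG 2) + W (g1 * heckeG 2) + W (g2 * heckeG 2) -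
      (y g + y g1 + y g2) - a • (z g + z g1 + z g2)) - (x g + x g1 + x g2) ∈
      errIdeal n a b • (⊤ : Submodule A L) :=
    sub_mem (Submodule.smul_mem_smul s5 Submodule.mem_top)
      (add_mem (add_mem (hx _) (hx _)) (hx _))
  convert hmem using 1
  -- Once U is replaced by its expression in E, the term -2E(g m_2) on the right supplies exactly
  -- the summand 2E(g m_2) that completes `recClass` at g m_2; likewise for the other two
  -- neighbours.
  rw [hU, hU, hU] at key
  have q0 := hQ g
  have q1 := hQ g1
  have q2 := hQ g2
  rw [recClass] at q0 q1 q2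
  simp only [hE]
  linear_combination (norm := module) key - q0 - q1 - q2 + e (y g) + e (y g1) + e (y g2)

end IsHeckeClass

/-! ### Elementary functions span the compact induction -/

/-- A scalar in ℚ_2^× is a power of 2 times a unit of ℤ_2, and the unit scalar is absorbed into K.
-/
theorem exists_eq_KtoG_mul_two_zpow {h : G} (hh : h ∈ KZ) :
    ∃ (k : K) (n : ℤ), h = KtoG k * two ^ n := by
  obtain ⟨k, u, rfl⟩ := mem_KZ.1 hh
  have hu : (u : ℚ_[2]) ≠ 0 := u.ne_zero
  set n := Padic.valuation (u : ℚ_[2]) with hn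
  have h1 : ‖(u : ℚ_[2]) * (2 : ℚ_[2]) ^ (-n)‖ = 1 := by
    rw [norm_mul, norm_zpow, norm_two_padic, Padic.norm_eq_zpow_neg_valuation hu, ← hn]
    push_cast
    rw [inv_zpow, zpow_neg, inv_inv, inv_mul_cancel₀ (zpow_ne_zero _ (by norm_num))]
  refine ⟨k * Matrix.GeneralLinearGroup.scalar (Fin 2) (PadicInt.mkUnits h1), n, ?_⟩
  have e : KtoG (Matrix.GeneralLinearGroup.scalar (Fin 2) (PadicInt.mkUnits h1)) =
      Matrix.GeneralLinearGroup.scalar (Fin 2)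
        (Units.map (algebraMap ℤ_[2] ℚ_[2]).toMonoidHom (PadicInt.mkUnits h1)) := by
    apply Units.ext
    rw [coe_KtoG]
    generalize PadicInt.mkUnits h1 = w
    ext i j
    fin_cases i <;> fin_cases j <;>
      simp [Matrix.GeneralLinearGroup.coe_scalar, Matrix.scalar_apply]
  rw [map_mul, mul_assoc, e, two, ← map_zpow, ← map_mul]
  congr 2
  apply Units.ext
  have e1 : (algebraMap ℤ_[2] ℚ_[2]) (PadicInt.mkUnits h1 : ℤ_[2]ˣ).1 =
      (u : ℚ_[2]) * (2 : ℚ_[2]) ^ (-n) := PadicInt.mkUnits_eq h1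
  rw [Units.val_mul, Units.val_zpow_eq_zpow_val]
  change (u : ℚ_[2]) = algebraMap ℤ_[2] ℚ_[2] (PadicInt.mkUnits h1 : ℤ_[2]ˣ).1 * 2 ^ n
  rw [e1, mul_assoc, ← zpow_add₀ two_ne_zero, neg_add_cancel, zpow_zero, mul_one]

section
variable {R : Type*} [CommRing R] [Algebra ℤ_[2] R] {r : ℕ}

theorem ind_mul {f : ind R r} (k : K) (n : ℤ) (x : G) :
    f.1 (KtoG k * two ^ n * x) = symRep R r k (f.1 x) := by
  have h2 := f.2.2.1
  have hn : ∀ n : ℕ, ∀ x, f.1 (two ^ n * x) = f.1 x := by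
    intro n
    induction n with
    | zero => simp
    | succ n ih => intro x; rw [pow_succ, mul_assoc, ih, h2]
  rw [mul_assoc, f.2.1]
  congr 1
  obtain ⟨m, rfl | rfl⟩ := n.eq_nat_or_neg
  · rw [zpow_natCast, hn]
  · rw [← hn m (two ^ (-(m : ℤ)) * x), zpow_neg, zpow_natCast, mul_inv_cancel_left]

theorem single_of_eq {g : G} {v : SymPow R r} {x : G} {k : K} {n : ℤ}
    (h : x * g = KtoG k * two ^ n) : (single g v).1 x = symRep R r k v := singleFun_of_eq h

theorem single_of_not {g : G} {v : SymPow R r} {x : G}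
    (h : ¬ ∃ k : K, ∃ n : ℤ, x * g = KtoG k * two ^ n) : (single g v).1 x = 0 :=
  singleFun_of_not h

/-- Functions in the compact induction whose values lie in `S` are sums of elementary functions
with values in `S`. -/
theorem ind_induction (S : Set (SymPow R r)) (h0 : (0 : SymPow R r) ∈ S) {p : ind R r → Prop}
    (zero : p 0) (add : ∀ g, ∀ v ∈ S, ∀ f, p f → p (single g v + f)) (f : ind R r)
    (hf : ∀ x, f.1 x ∈ S) : p f := by
  classical
  obtain ⟨s, hs⟩ := f.2.2.2
  induction s using Finset.induction_on generalizing f with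
  | empty =>
    have : f = 0 := Subtype.ext (funext fun x => by
      by_contra h
      obtain ⟨_, _, _, hx, _⟩ := hs x h
      simp at hx)
    rw [this]
    exact zero
  | insert y s _ ih =>
    -- Subtracting [y⁻¹, f(y)] kills f on the coset of y and changes nothing on the other cosets.
    have key : ∀ x, (f - single y⁻¹ (f.1 y)).1 x = 0 ∨
        (f - single y⁻¹ (f.1 y)).1 x = f.1 x ∧ ¬ ∃ h ∈ KZ, x = h * y := by
      intro x
      change f.1 x - (single y⁻¹ (f.1 y)).1 x = 0 ∨ f.1 x - (single y⁻¹ (f.1 y)).1 x = _ ∧ _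
      by_cases h : ∃ k : K, ∃ n : ℤ, x * y⁻¹ = KtoG k * two ^ n
      · left
        obtain ⟨k, n, e⟩ := h
        rw [single_of_eq e, ← ind_mul k n y, ← e, inv_mul_cancel_right, sub_self]
      · right
        refine ⟨by rw [single_of_not h, sub_zero], ?_⟩
        rintro ⟨g, hg, rfl⟩
        obtain ⟨k, n, e⟩ := exists_eq_KtoG_mul_two_zpow hg
        exact h ⟨k, n, by rw [mul_inv_cancel_right, e]⟩
    have := add y⁻¹ (f.1 y) (hf y) (f - single y⁻¹ (f.1 y)) (ih _ (fun x => ?_) (fun x hx => ?_))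
    · rwa [add_sub_cancel] at this
    · rcases key x with h | ⟨h, _⟩
      · rw [h]; exact h0
      · rw [h]; exact hf x
    · rcases key x with h | ⟨h, h'⟩
      · exact absurd h hx
      · rw [h] at hx
        obtain ⟨g, hg, z, hz, e⟩ := hs x hx
        rcases Finset.mem_insert.1 hz with rfl | hz
        · exact absurd ⟨g, hg, e⟩ h'
        · exact ⟨g, hg, z, hz, e⟩

/-- `[g, v]` as a linear function of `v`. -/
def singleHom (g : G) : SymPow R r →ₗ[R] ind R r where
  toFun := single g
  map_add' v w := Subtype.ext (funext fun x => by
    change (single g (v + w)).1 x = (single g v).1 x + (single g w).1 x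
    by_cases h : ∃ k : K, ∃ n : ℤ, x * g = KtoG k * two ^ n
    · obtain ⟨k, n, e⟩ := h
      rw [single_of_eq e, single_of_eq e, single_of_eq e, map_add]
    · rw [single_of_not h, single_of_not h, single_of_not h, add_zero])
  map_smul' c v := Subtype.ext (funext fun x => by
    change (single g (c • v)).1 x = c • (single g v).1 x
    by_cases h : ∃ k : K, ∃ n : ℤ, x * g = KtoG k * two ^ n
    · obtain ⟨k, n, e⟩ := h
      rw [single_of_eq e, single_of_eq e, map_smul]
    · rw [single_of_not h, single_of_not h, smul_zero])

theorem singleHom_apply (g : G) (v : SymPow R r) : singleHom g v = single g v := rfl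

theorem single_mul_K (g : G) (k : K) (v : SymPow R r) :
    single (g * KtoG k) v = single g (symRep R r k v) := by
  apply Subtype.ext
  funext x
  by_cases h : ∃ l : K, ∃ n : ℤ, x * g = KtoG l * two ^ n
  · obtain ⟨l, n, e⟩ := h
    rw [single_of_eq e, single_of_eq (k := l * k) (n := n), map_mul, Module.End.mul_apply]
    rw [← mul_assoc, e, mul_assoc, two_zpow_comm, map_mul, mul_assoc]
  · rw [single_of_not h, single_of_not]
    rintro ⟨l, n, e⟩
    refine h ⟨l * k⁻¹, n, ?_⟩
    rw [← mul_assoc] at e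
    rw [eq_mul_inv_of_mul_eq e, mul_assoc, two_zpow_comm, map_mul, map_inv, mul_assoc]

theorem single_mul_two (g : G) (v : SymPow R r) : single (g * two) v = single g v := by
  apply Subtype.ext
  funext x
  by_cases h : ∃ l : K, ∃ n : ℤ, x * g = KtoG l * two ^ n
  · obtain ⟨l, n, e⟩ := h
    rw [single_of_eq e, single_of_eq (k := l) (n := n + 1)]
    rw [← mul_assoc, e, mul_assoc, zpow_add_one]
  · rw [single_of_not h, single_of_not]
    rintro ⟨l, n, e⟩
    refine h ⟨l, n - 1, ?_⟩
    rw [← mul_assoc] at e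
    rw [eq_mul_inv_of_mul_eq e, mul_assoc, zpow_sub_one]

theorem indBaseChange_single {S : Type*} [CommRing S] [Algebra R S] [Algebra ℤ_[2] S]
    [IsScalarTower ℤ_[2] R S] (g : G) (v : SymPow R r) :
    indBaseChange R S r (single g v) = single g (symBaseChange R S r v) := by
  apply Subtype.ext
  funext x
  rw [indBaseChange_apply]
  by_cases h : ∃ l : K, ∃ n : ℤ, x * g = KtoG l * two ^ n
  · obtain ⟨l, n, e⟩ := h
    rw [single_of_eq e, single_of_eq e, symRep_apply, symRep_apply, symBaseChange_symInt]
  · rw [single_of_not h, single_of_not h, map_zero]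

theorem indMap_single {s : ℕ} (φ : SymPow R r →ₗ[R] SymPow R s)
    (hφ : ∀ (k : K) (v : SymPow R r), φ (symRep R r k v) = symRep R s k (φ v)) (g : G)
    (v : SymPow R r) : indMap φ hφ (single g v) = single g (φ v) := by
  apply Subtype.ext
  funext x
  change φ ((single g v).1 x) = _
  by_cases h : ∃ l : K, ∃ n : ℤ, x * g = KtoG l * two ^ n
  · obtain ⟨l, n, e⟩ := h
    rw [single_of_eq e, single_of_eq e, hφ]
  · rw [single_of_not h, single_of_not h, map_zero]

theorem hecke_indBaseChange {S : Type*} [CommRing S] [Algebra R S] [Algebra ℤ_[2] S]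
    [IsScalarTower ℤ_[2] R S] (f : ind R r) :
    hecke S r (indBaseChange R S r f) = indBaseChange R S r (hecke R r f) := by
  apply Subtype.ext
  funext x
  rw [indBaseChange_apply, hecke_apply, hecke_apply, map_sum]
  exact Finset.sum_congr rfl fun i _ => by rw [indBaseChange_apply, symBaseChange_symInt]

/-! ### Weight zero -/

theorem symInt_constSym (M : Matrix (Fin 2) (Fin 2) ℤ_[2]) (c : R) :
    symInt R 0 M (constSym R c) = constSym R c := by
  apply Subtype.ext
  change MvPolynomial.aeval _ (C c) = C c
  simp

theorem exists_constSym {R : Type*} [CommRing R] (v : SymPow R 0) : ∃ c : R, v = c • constSym R 1 := by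
  have h : mono R 0 0 = constSym R 1 := by
    apply Subtype.ext
    rw [mono_val R le_rfl]
    change _ = C 1
    simp
  refine ⟨coeffXY R 0 0 v, ?_⟩
  conv_lhs => rw [sum_coeff_mono v]
  rw [zero_add, Finset.sum_range_one, h]

/-- The elementary function `[g, 1]` in weight zero. -/
def vertex (R : Type*) [CommRing R] [Algebra ℤ_[2] R] (g : G) : ind R 0 :=
  single g (constSym R 1)

theorem vertex_mul_K (g : G) (k : K) : vertex R (g * KtoG k) = vertex R g := by
  rw [vertex, single_mul_K, symRep_apply, symInt_constSym, vertex]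

theorem vertex_mul_two (g : G) : vertex R (g * two) = vertex R g := single_mul_two _ _

theorem hecke_vertex (g : G) : hecke R 0 (vertex R g) =
    vertex R (g * heckeG 0) + vertex R (g * heckeG 1) + vertex R (g * heckeG 2) := by
  rw [vertex, hecke_single, symInt_constSym, symInt_constSym, symInt_constSym]
  rfl

/-- In weight zero K acts trivially, so the three neighbours may be represented as in
`hecke_sum_rot`. -/
theorem hecke_vertex_rot (g : G) : hecke R 0 (vertex R g) =
    vertex R (g * heckeG 2) + vertex R (g * KtoG rot * heckeG 2) +
      vertex R (g * KtoG rot ^ 2 * heckeG 2) := by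
  obtain ⟨k, hk⟩ := rot_mul_heckeG_two
  obtain ⟨l, hl⟩ := rot_sq_mul_heckeG_two
  rw [hecke_vertex, mul_assoc g, hk, mul_assoc g _ (heckeG 2), hl, ← mul_assoc, ← mul_assoc,
    vertex_mul_K, vertex_mul_K]
  abel

theorem vertex_heckeG_two_zero (g : G) : vertex R (g * heckeG 2 * heckeG 0) = vertex R g := by
  rw [mul_assoc, heckeG_two_mul_zero, vertex_mul_two]

/-- Each of the three neighbours has two further neighbours, at distance two from g, and leads back
to g through m_0. -/
theorem hecke_sq_vertex (g : G) : hecke R 0 (hecke R 0 (vertex R g)) =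
    (vertex R (g * heckeG 2 * heckeG 2) + vertex R (g * heckeG 2 * heckeG 1) +
      (vertex R (g * KtoG rot * heckeG 2 * heckeG 2) +
        vertex R (g * KtoG rot * heckeG 2 * heckeG 1)) +
      (vertex R (g * KtoG rot ^ 2 * heckeG 2 * heckeG 2) +
        vertex R (g * KtoG rot ^ 2 * heckeG 2 * heckeG 1))) + (3 : R) • vertex R g := by
  have h1 : vertex R (g * KtoG rot) = vertex R g := vertex_mul_K g rot
  have h2 : vertex R (g * KtoG rot ^ 2) = vertex R g := by
    rw [← map_pow]; exact vertex_mul_K g _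
  rw [hecke_vertex_rot, map_add, map_add, hecke_vertex, hecke_vertex, hecke_vertex,
    vertex_heckeG_two_zero, vertex_heckeG_two_zero, vertex_heckeG_two_zero, h1, h2]
  module

/-- Two linear maps on the weight zero compact induction agree if they agree on `[g, 1]`. -/
theorem ind_zero_ext {M : Type*} [AddCommGroup M] [Module R M] {φ ψ : ind R 0 →ₗ[R] M}
    (h : ∀ g, φ (vertex R g) = ψ (vertex R g)) : φ = ψ := by
  ext1 f
  refine ind_induction Set.univ trivial (p := fun f => φ f = ψ f) (by simp) ?_ f
    (fun _ => trivial)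
  intro g v _ f hf
  obtain ⟨c, rfl⟩ := exists_constSym v
  have : single g (c • constSym R 1) = c • vertex R g := (singleHom g).map_smul c _
  rw [map_add, map_add, hf, this, map_smul, map_smul, h]

end

/-! ### The valuation -/

theorem norm_two_QBar : ‖(2 : QBar)‖ = 1 / 2 := by
  have h := norm_algebraMap' QBar (2 : ℚ_[2])
  rw [map_ofNat, norm_two_padic] at h
  rw [h]; norm_num

theorem two_ne_zero_QBar : (2 : QBar) ≠ 0 := by
  rw [← norm_pos_iff, norm_two_QBar]; norm_num

theorem norm_natCast_QBar (n : ℕ) : ‖(n : QBar)‖ = ‖(n : ℚ_[2])‖ := by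
  have h := norm_algebraMap' QBar (n : ℚ_[2])
  rwa [map_natCast] at h

theorem natCast_ne_zero_QBar {n : ℕ} (hn : n ≠ 0) : (n : QBar) ≠ 0 := by
  rw [← norm_pos_iff, norm_natCast_QBar, norm_pos_iff]
  exact_mod_cast hn

theorem norm_natCast_even {n : ℕ} (hn : Even n) : ‖(n : QBar)‖ ≤ 1 / 2 := by
  obtain ⟨m, rfl⟩ := hn
  rw [← two_mul, Nat.cast_mul, norm_mul, Nat.cast_ofNat, norm_two_QBar]
  have := IsUltrametricDist.norm_natCast_le_one QBar m
  linarith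

theorem norm_natCast_odd {n : ℕ} (hn : Odd n) : ‖(n : QBar)‖ = 1 := by
  rw [norm_natCast_QBar]
  have := PadicInt.isUnit_iff.1 (isUnit_natCast_of_odd hn)
  rwa [PadicInt.norm_def, PadicInt.coe_natCast] at this

theorem val_zero : val 0 = ⊤ := by simp [val]

theorem val_of_ne {x : QBar} (hx : x ≠ 0) : val x = ((-Real.logb 2 ‖x‖ : ℝ) : WithTop ℝ) := by
  simp [val, hx]

theorem val_lt_val {x y : QBar} : val x < val y ↔ ‖y‖ < ‖x‖ := by
  rcases eq_or_ne x 0 with rfl | hx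
  · rw [val_zero, norm_zero]
    exact iff_of_false not_top_lt (not_lt.2 (norm_nonneg _))
  rcases eq_or_ne y 0 with rfl | hy
  · rw [val_zero, norm_zero, val_of_ne hx]
    exact iff_of_true (WithTop.coe_lt_top _) (norm_pos_iff.2 hx)
  rw [val_of_ne hx, val_of_ne hy, WithTop.coe_lt_coe, neg_lt_neg_iff,
    Real.logb_lt_logb_iff one_lt_two (norm_pos_iff.2 hy) (norm_pos_iff.2 hx)]

theorem val_le_val {x y : QBar} : val x ≤ val y ↔ ‖y‖ ≤ ‖x‖ := by
  rw [← not_lt, val_lt_val, not_lt]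

theorem val_one : val 1 = 0 := by simp [val_of_ne one_ne_zero]

theorem val_two : val 2 = 1 := by
  rw [val_of_ne two_ne_zero_QBar, norm_two_QBar, one_div, Real.logb_inv,
    Real.logb_self_eq_one one_lt_two, neg_neg]
  rfl

/-! ### The ring of integers -/

theorem algebraMap_ZBar_injective : Function.Injective (algebraMap ZBar QBar) :=
  Subtype.coe_injective

instance : IsDomain ZBar :=
  algebraMap_ZBar_injective.isDomain _

theorem norm_ZBar_le_one (c : ZBar) : ‖algebraMap ZBar QBar c‖ ≤ 1 := by
  have h : Valued.v (Γ₀ := NNReal) (algebraMap ZBar QBar c) ≤ 1 := c.2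
  rw [PadicAlgCl.valuation_def] at h
  exact_mod_cast h

theorem exists_ZBar {x : QBar} (hx : ‖x‖ ≤ 1) : ∃ c : ZBar, algebraMap ZBar QBar c = x := by
  refine ⟨⟨x, ?_⟩, rfl⟩
  change Valued.v (Γ₀ := NNReal) x ≤ 1
  rw [PadicAlgCl.valuation_def]
  exact_mod_cast hx

theorem dvd_ZBar_iff {c d : ZBar} (hc : c ≠ 0) :
    c ∣ d ↔ ‖algebraMap ZBar QBar d‖ ≤ ‖algebraMap ZBar QBar c‖ := by
  have hc' : algebraMap ZBar QBar c ≠ 0 :=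
    (map_ne_zero_iff _ algebraMap_ZBar_injective).2 hc
  constructor
  · rintro ⟨e, rfl⟩
    rw [map_mul, norm_mul]
    exact mul_le_of_le_one_right (norm_nonneg _) (norm_ZBar_le_one e)
  · intro h
    obtain ⟨e, he⟩ := exists_ZBar (x := algebraMap ZBar QBar d / algebraMap ZBar QBar c) (by
      rw [norm_div]
      exact div_le_one_of_le₀ h (norm_nonneg _))
    refine ⟨e, algebraMap_ZBar_injective ?_⟩
    rw [map_mul, he, mul_div_cancel₀ _ hc']

theorem residue_eq_zero_iff_norm {c : ZBar} :
    IsLocalRing.residue ZBar c = 0 ↔ ‖algebraMap ZBar QBar c‖ < 1 := by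
  rw [IsLocalRing.residue_eq_zero_iff, IsLocalRing.mem_maximalIdeal, mem_nonunits_iff,
    isUnit_iff_dvd_one]
  rcases eq_or_ne c 0 with rfl | hc
  · simp
  · rw [dvd_ZBar_iff hc, map_one, norm_one, not_le]

theorem mem_maximalIdeal_iff_norm {c : ZBar} :
    c ∈ IsLocalRing.maximalIdeal ZBar ↔ ‖algebraMap ZBar QBar c‖ < 1 := by
  rw [← IsLocalRing.residue_eq_zero_iff, residue_eq_zero_iff_norm]

theorem mem_span_mul_maximalIdeal {c d : ZBar} (hc : c ≠ 0)
    (h : ‖algebraMap ZBar QBar d‖ < ‖algebraMap ZBar QBar c‖) :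
    d ∈ Ideal.span {c} * IsLocalRing.maximalIdeal ZBar := by
  obtain ⟨e, rfl⟩ := (dvd_ZBar_iff hc).2 h.le
  refine Ideal.mul_mem_mul (Ideal.mem_span_singleton_self c) ?_
  rw [mem_maximalIdeal_iff_norm]
  rw [map_mul, norm_mul] at h
  by_contra h'
  rw [not_lt] at h'
  exact absurd h (not_lt.2 (le_mul_of_one_le_right (norm_nonneg _) h'))

theorem exists_dvd_pow {a c : ZBar} (ha : ‖algebraMap ZBar QBar a‖ < 1) (hc : c ≠ 0) :
    ∃ k, c ∣ a ^ k := by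
  have hc' : 0 < ‖algebraMap ZBar QBar c‖ :=
    norm_pos_iff.2 ((map_ne_zero_iff _ algebraMap_ZBar_injective).2 hc)
  obtain ⟨k, hk⟩ := exists_pow_lt_of_lt_one hc' ha
  refine ⟨k, (dvd_ZBar_iff hc).2 ?_⟩
  rw [map_pow, norm_pow]
  exact hk.le

theorem norm_add_eq_left {x y : QBar} (h : ‖y‖ < ‖x‖) : ‖x + y‖ = ‖x‖ := by
  rw [IsUltrametricDist.norm_add_eq_max_of_norm_ne_norm h.ne', max_eq_left h.le]

theorem norm_sub_eq_left {x y : QBar} (h : ‖y‖ < ‖x‖) : ‖x - y‖ = ‖x‖ := by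
  rw [sub_eq_add_neg, norm_add_eq_left (by rwa [norm_neg])]

theorem norm_sub_le_of_le {x y : QBar} {c : ℝ} (hx : ‖x‖ ≤ c) (hy : ‖y‖ ≤ c) : ‖x - y‖ ≤ c := by
  rw [sub_eq_add_neg]
  refine (IsUltrametricDist.norm_add_le_max _ _).trans (max_le hx ?_)
  rwa [norm_neg]

/-! ### Comparison of the error terms -/

section
variable {a b : ZBar} {n : ℕ}

theorem span_mul_smul_top {L : Type*} [AddCommGroup L] [Module ZBar L] {c : ZBar} {I : Ideal ZBar}
    (h : I ≤ Ideal.span {c} * IsLocalRing.maximalIdeal ZBar) {x : L}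
    (hx : x ∈ I • (⊤ : Submodule ZBar L)) :
    ∃ y ∈ IsLocalRing.maximalIdeal ZBar • (⊤ : Submodule ZBar L), x = c • y := by
  have h1 := Submodule.smul_mono_left (N := (⊤ : Submodule ZBar L)) h hx
  rw [Submodule.mul_smul, Submodule.ideal_span_singleton_smul] at h1
  obtain ⟨y, hy, e⟩ := h1
  exact ⟨y, hy, e.symm⟩

theorem norm_b (hb : a * b = 2) : ‖algebraMap ZBar QBar a‖ * ‖algebraMap ZBar QBar b‖ = 1 / 2 := by
  rw [← norm_mul, ← map_mul, hb, map_ofNat, norm_two_QBar]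

/-- Each generator is one of 2 - a², 2na, 2nb, whose norms are at most that of c, times a or b,
whose norms are less than 1; note that 4n = 2na·b. -/
theorem errIdeal_le_of_norm (hb : a * b = 2) (hn : n ≠ 0)
    (ha : ‖algebraMap ZBar QBar a‖ < 1) (hb1 : ‖algebraMap ZBar QBar b‖ < 1) {c : ZBar}
    (hD : ‖2 - (algebraMap ZBar QBar a) ^ 2‖ ≤ ‖algebraMap ZBar QBar c‖)
    (hna : ‖(n : QBar)‖ * ‖algebraMap ZBar QBar a‖ / 2 ≤ ‖algebraMap ZBar QBar c‖)
    (hnb : ‖(n : QBar)‖ * ‖algebraMap ZBar QBar b‖ / 2 ≤ ‖algebraMap ZBar QBar c‖) :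
    IsHeckeClass.errIdeal n a b ≤ Ideal.span {c} * IsLocalRing.maximalIdeal ZBar := by
  have hab := norm_b hb
  have hn' : 0 < ‖(n : QBar)‖ := norm_pos_iff.2 (natCast_ne_zero_QBar hn)
  have ha0 : 0 < ‖algebraMap ZBar QBar a‖ := by
    refine lt_of_le_of_ne (norm_nonneg _) fun h => ?_
    rw [← h] at hab; norm_num at hab
  have hb0 : 0 < ‖algebraMap ZBar QBar b‖ := by
    refine lt_of_le_of_ne (norm_nonneg _) fun h => ?_
    rw [← h] at hab; norm_num at hab
  have hc0 : 0 < ‖algebraMap ZBar QBar c‖ := lt_of_lt_of_le (by positivity) hna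
  have hc : c ≠ 0 := by rintro rfl; simp at hc0
  have hlt : ∀ {x y z : ℝ}, 0 < z → x ≤ z → 0 ≤ y → y < 1 → x * y < z := fun hz hx hy hy' => by
    nlinarith
  have h4 : ‖(4 : QBar)‖ = 1 / 4 := by
    rw [show (4 : QBar) = 2 * 2 by norm_num, norm_mul, norm_two_QBar]; norm_num
  have e2 : ‖(n : QBar)‖ * ‖algebraMap ZBar QBar a‖ ^ 2 / 2 < ‖algebraMap ZBar QBar c‖ := by
    have := hlt hc0 hna ha0.le ha
    linarith
  have e3 : ‖(n : QBar)‖ * ‖algebraMap ZBar QBar b‖ ^ 2 / 2 < ‖algebraMap ZBar QBar c‖ := by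
    have := hlt hc0 hnb hb0.le hb1
    linarith
  have e4 : ‖(n : QBar)‖ / 4 < ‖algebraMap ZBar QBar c‖ := by
    have := hlt hc0 hna hb0.le hb1
    nlinarith
  rw [IsHeckeClass.errIdeal, Ideal.span_le]
  rintro x (rfl | rfl | rfl | rfl | rfl) <;> refine mem_span_mul_maximalIdeal hc ?_ <;>
    simp only [map_mul, map_sub, map_pow, map_ofNat, map_natCast, norm_mul, norm_pow,
      norm_two_QBar, h4]
  · exact hlt hc0 hD ha0.le ha
  · exact hlt hc0 hD hb0.le hb1
  · linarith
  · linarith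
  · linarith

end

section
variable {a b : ZBar} {n : ℕ}

/-- The difference is -2n(n+2), and n + 2 is even. -/
theorem norm_discr_sub_le (hn : Even n) (x : QBar) :
    ‖(x ^ 2 - 2 * ((n + 1 : ℕ) : QBar) ^ 2) - (x ^ 2 - 2)‖ ≤ ‖(n : QBar)‖ / 4 := by
  have e : (x ^ 2 - 2 * ((n + 1 : ℕ) : QBar) ^ 2) - (x ^ 2 - 2) = -(2 * n * (n + 2 : ℕ)) := by
    push_cast; ring
  rw [e, norm_neg, norm_mul, norm_mul, norm_two_QBar]
  have := norm_natCast_even (hn.add even_two)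
  have := norm_nonneg (n : QBar)
  nlinarith

variable {L : Type*} [AddCommGroup L] [Module ZBar L]

/-- Under the inequality `hlt`, 2 - a² is strictly larger in norm than 2nb and all the error
coefficients, so dividing by it leaves S modulo the maximal ideal. -/
theorem mem_smul_top_of_lt (ht : ∀ c : ZBar, c ≠ 0 → ∀ x : L, c • x = 0 → x = 0)
    (hb : a * b = 2) (hn : n ≠ 0) (he : Even n)
    (ha : ‖algebraMap ZBar QBar a‖ < 1) (ha' : 1 / 2 < ‖algebraMap ZBar QBar a‖)
    (hlt : ‖(n : QBar)‖ * ‖algebraMap ZBar QBar a‖ / 2 <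
      ‖(algebraMap ZBar QBar a) ^ 2 - 2 * ((n + 1 : ℕ) : QBar) ^ 2‖) {S T : L}
    (h : (2 - a ^ 2) • S - (2 * n * b) • T ∈
      IsHeckeClass.errIdeal n a b • (⊤ : Submodule ZBar L)) :
    S ∈ IsLocalRing.maximalIdeal ZBar • (⊤ : Submodule ZBar L) := by
  have hab := norm_b hb
  have hn' : 0 < ‖(n : QBar)‖ := norm_pos_iff.2 (natCast_ne_zero_QBar hn)
  have hn2 := norm_natCast_even he
  have hdist := norm_discr_sub_le he (algebraMap ZBar QBar a)
  have hcast : algebraMap ZBar QBar (2 - a ^ 2) = 2 - (algebraMap ZBar QBar a) ^ 2 := by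
    rw [map_sub, map_pow, map_ofNat]
  have hD : ‖(n : QBar)‖ * ‖algebraMap ZBar QBar a‖ / 2 <
      ‖algebraMap ZBar QBar (2 - a ^ 2)‖ := by
    rw [hcast, norm_sub_rev]
    refine lt_of_lt_of_eq hlt ?_
    have := norm_sub_eq_left (lt_of_le_of_lt hdist (lt_of_le_of_lt (by nlinarith) hlt))
    rw [← this, sub_sub_cancel]
  have hb1 : ‖algebraMap ZBar QBar b‖ < 1 := by
    by_contra hb1
    rw [not_lt] at hb1
    nlinarith
  -- If ‖b‖ > ‖a‖, then ‖a‖² < ‖ab‖ = ‖2‖, so 2 - a² has the norm of 2.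
  have hD' : ‖(n : QBar)‖ * ‖algebraMap ZBar QBar b‖ / 2 <
      ‖algebraMap ZBar QBar (2 - a ^ 2)‖ := by
    rcases le_or_gt ‖algebraMap ZBar QBar b‖ ‖algebraMap ZBar QBar a‖ with hle | hgt
    · exact lt_of_le_of_lt (by gcongr) hD
    · have : ‖algebraMap ZBar QBar (2 - a ^ 2)‖ = 1 / 2 := by
        rw [hcast, norm_sub_eq_left, norm_two_QBar]
        rw [norm_pow, norm_two_QBar]
        nlinarith
      rw [this]
      nlinarith [norm_nonneg (algebraMap ZBar QBar b)]
  have hc : (2 - a ^ 2 : ZBar) ≠ 0 := by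
    intro h0
    rw [h0, map_zero, norm_zero] at hD
    exact absurd hD (not_lt.2 (by positivity))
  obtain ⟨y, hy, e⟩ := span_mul_smul_top
    (errIdeal_le_of_norm hb hn ha hb1 (by rw [hcast]) hD.le hD'.le) h
  obtain ⟨m, hm, e'⟩ := Ideal.mem_span_singleton_mul.1 (mem_span_mul_maximalIdeal (c := 2 - a ^ 2)
    (d := 2 * n * b) hc (by
    rw [map_mul, map_mul, map_ofNat, map_natCast, norm_mul, norm_mul, norm_two_QBar]
    linarith))
  have : S = m • T + y := by
    rw [← sub_eq_zero]
    refine ht _ hc _ ?_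
    rw [← e'] at e
    linear_combination (norm := module) e
  rw [this]
  exact add_mem (Submodule.smul_mem_smul hm Submodule.mem_top) hy

/-- Integrality of c makes 2 - a² divisible by 2na, which forces ‖a‖ = ‖b‖. Dividing the relation by
2na then leaves the coefficients (a² - 2)/(2na), which reduces to c, and b/a, which reduces to 1. -/
theorem mem_smul_top_of_le (ht : ∀ c : ZBar, c ≠ 0 → ∀ x : L, c • x = 0 → x = 0)
    (hb : a * b = 2) (hn : n ≠ 0) (he : Even n)
    (ha : ‖algebraMap ZBar QBar a‖ < 1) (ha' : 1 / 2 < ‖algebraMap ZBar QBar a‖) {c : ZBar}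
    (hc : 2 * n * algebraMap ZBar QBar a * algebraMap ZBar QBar c =
      (algebraMap ZBar QBar a) ^ 2 - 2 * ((n + 1 : ℕ) : QBar) ^ 2) {S T : L}
    (h : (2 - a ^ 2) • S - (2 * n * b) • T ∈
      IsHeckeClass.errIdeal n a b • (⊤ : Submodule ZBar L)) :
    c • S + T ∈ IsLocalRing.maximalIdeal ZBar • (⊤ : Submodule ZBar L) := by
  set s := ‖algebraMap ZBar QBar a‖ with hs
  have hab := norm_b hb
  rw [← hs] at hab
  have hn' : 0 < ‖(n : QBar)‖ := norm_pos_iff.2 (natCast_ne_zero_QBar hn)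
  have hn2 := norm_natCast_even he
  have hdist := norm_discr_sub_le he (algebraMap ZBar QBar a)
  have hcast : algebraMap ZBar QBar (2 - a ^ 2) = 2 - (algebraMap ZBar QBar a) ^ 2 := by
    rw [map_sub, map_pow, map_ofNat]
  have hκ : ‖algebraMap ZBar QBar (2 * n * a)‖ = ‖(n : QBar)‖ * s / 2 := by
    rw [map_mul, map_mul, map_ofNat, map_natCast, norm_mul, norm_mul, norm_two_QBar]
    ring
  have hκ0 : (2 * n * a : ZBar) ≠ 0 := by
    intro h0
    rw [h0, map_zero, norm_zero] at hκ
    have : 0 < ‖(n : QBar)‖ * s / 2 := by positivity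
    linarith
  have hD : ‖algebraMap ZBar QBar (2 - a ^ 2)‖ ≤ ‖(n : QBar)‖ * s / 2 := by
    have h1 : ‖(algebraMap ZBar QBar a) ^ 2 - 2 * ((n + 1 : ℕ) : QBar) ^ 2‖ ≤
        ‖(n : QBar)‖ * s / 2 := by
      rw [← hc, norm_mul, norm_mul, norm_mul, norm_two_QBar, ← hs]
      have := norm_ZBar_le_one c
      have : 0 < 1 / 2 * ‖(n : QBar)‖ * s := by positivity
      nlinarith
    have h2 := norm_sub_le_of_le h1 (hdist.trans (by nlinarith :
      ‖(n : QBar)‖ / 4 ≤ ‖(n : QBar)‖ * s / 2))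
    rwa [sub_sub_cancel, norm_sub_rev, ← hcast] at h2
  -- Otherwise ‖2 - a²‖ ≥ 1/2, whereas ‖2na‖ ≤ s/4 < 1/2.
  have hss : s * s = 1 / 2 := by
    by_contra hne
    have : ‖(2 : QBar) + -(algebraMap ZBar QBar a) ^ 2‖ = max (1 / 2) (s * s) := by
      rw [IsUltrametricDist.norm_add_eq_max_of_norm_ne_norm, norm_neg, norm_pow, norm_two_QBar,
        ← hs, pow_two]
      rw [norm_neg, norm_pow, norm_two_QBar, ← hs, pow_two]
      exact fun h => hne h.symm
    rw [← sub_eq_add_neg, ← hcast] at this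
    rw [this] at hD
    have := le_trans (le_max_left _ _) hD
    nlinarith
  have hbs : ‖algebraMap ZBar QBar b‖ = s := by
    have hs0 : s ≠ 0 := by linarith
    exact mul_left_cancel₀ hs0 (hab.trans hss.symm)
  have ha0 : algebraMap ZBar QBar a ≠ 0 := by
    rw [← norm_pos_iff, ← hs]; linarith
  obtain ⟨y, hy, e⟩ := span_mul_smul_top
    (errIdeal_le_of_norm (c := 2 * n * a) hb hn ha (by rw [hbs]; exact ha) (by
      rw [← hcast, hκ]; exact hD) (by rw [hκ]) (by rw [hκ, hbs])) h
  have haa : a ≠ 0 := by rintro rfl; simp at ha0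
  obtain ⟨c', hc'⟩ := (dvd_ZBar_iff hκ0 (d := a ^ 2 - 2)).2 (by
    rw [hκ, ← neg_sub, map_neg, norm_neg]; exact hD)
  obtain ⟨u, hu⟩ := (dvd_ZBar_iff haa (d := b)).2 (by rw [hbs])
  -- By `norm_discr_sub_le`, 2na(c - c') has norm at most ‖n‖/4, which is less than ‖2na‖ = ‖n‖s/2
  -- because s > 1/2.
  have hcu : c - c' ∈ IsLocalRing.maximalIdeal ZBar := by
    rw [mem_maximalIdeal_iff_norm]
    have h1 : algebraMap ZBar QBar (2 * n * a) * algebraMap ZBar QBar (c - c') =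
        (algebraMap ZBar QBar a ^ 2 - 2 * ((n + 1 : ℕ) : QBar) ^ 2) -
          (algebraMap ZBar QBar a ^ 2 - 2) := by
      have := congrArg (algebraMap ZBar QBar) hc'
      simp only [map_mul, map_sub, map_pow, map_ofNat, map_natCast] at this ⊢
      linear_combination hc + this
    rw [← h1, norm_mul, hκ] at hdist
    by_contra hle
    rw [not_lt] at hle
    have : 0 < ‖(n : QBar)‖ * s / 2 := by positivity
    nlinarith
  have hu1 : u - 1 ∈ IsLocalRing.maximalIdeal ZBar := by
    rw [mem_maximalIdeal_iff_norm]
    have h1 : a ^ 2 * (u - 1) = 2 - a ^ 2 := by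
      rw [hu] at hb; linear_combination hb
    have h2 := congrArg (fun x => ‖algebraMap ZBar QBar x‖) h1
    simp only [map_mul, map_pow, norm_mul, norm_pow] at h2
    rw [← hs] at h2
    by_contra hle
    rw [not_lt] at hle
    nlinarith
  have key : c' • S + u • T + y = 0 := by
    refine ht _ hκ0 _ ?_
    have e1 : (a ^ 2 - 2) • S = (2 * n * a * c') • S := by rw [hc']
    have e2 : (2 * n * b) • T = (2 * n * a * u) • T := by rw [hu, ← mul_assoc]
    linear_combination (norm := module) -e - e1 - e2
  have : c • S + T = (c - c') • S - (u - 1) • T - y := by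
    linear_combination (norm := module) key
  rw [this]
  exact sub_mem (sub_mem (Submodule.smul_mem_smul hcu Submodule.mem_top)
    (Submodule.smul_mem_smul hu1 Submodule.mem_top)) hy

end

/-! ### Classes in `Θ` -/

/-- The class of `[g, w]` in `Θ`. -/
def thetaCl (r : ℕ) (α : QBar) (g : G) : SymPow ZBar r →ₗ[ZBar] Theta r α :=
  (thetaKer r α).mkQ ∘ₗ singleHom g

theorem thetaCl_apply {r : ℕ} {α : QBar} (g : G) (w : SymPow ZBar r) :
    thetaCl r α g w = Submodule.Quotient.mk (single g w) := rfl

/-- The submodule `thetaKer` is the preimage of a subspace over the field, in which c can be divided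
out. -/
theorem theta_torsion_free {r : ℕ} {α : QBar} (c : ZBar) (hc : c ≠ 0) (x : Theta r α)
    (hx : c • x = 0) : x = 0 := by
  obtain ⟨f, rfl⟩ := Submodule.Quotient.mk_surjective _ x
  rw [← Submodule.Quotient.mk_smul, Submodule.Quotient.mk_eq_zero] at hx
  rw [Submodule.Quotient.mk_eq_zero]
  obtain ⟨h, hh⟩ := hx
  have hc' : algebraMap ZBar QBar c ≠ 0 :=
    (map_ne_zero_iff _ algebraMap_ZBar_injective).2 hc
  refine ⟨(algebraMap ZBar QBar c)⁻¹ • h, ?_⟩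
  rw [map_smul, hh, map_smul, ← algebraMap_smul QBar c, smul_smul, inv_mul_cancel₀ hc', one_smul]

theorem mk_hecke {r : ℕ} {α : QBar} {a : ZBar} (ha : algebraMap ZBar QBar a = α)
    (f : ind ZBar r) : a • (Submodule.Quotient.mk f : Theta r α) =
      Submodule.Quotient.mk (hecke ZBar r f) := by
  symm
  rw [← Submodule.Quotient.mk_smul, Submodule.Quotient.eq]
  refine ⟨indBaseChange ZBar QBar r f, ?_⟩
  rw [map_sub, map_smul, ← algebraMap_smul QBar a, ha, LinearMap.sub_apply, LinearMap.smul_apply,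
    hecke_indBaseChange]
  rfl

theorem isHeckeClass_thetaCl {r : ℕ} {α : QBar} {a : ZBar} (ha : algebraMap ZBar QBar a = α)
    (h0 : a ≠ 0) : IsHeckeClass a (thetaCl r α) where
  inj x y h := by
    rw [← sub_eq_zero] at h ⊢
    rw [← smul_sub] at h
    exact theta_torsion_free a h0 _ h
  mul_K g k w := by rw [thetaCl_apply, single_mul_K, thetaCl_apply]
  mul_two g w := by rw [thetaCl_apply, single_mul_two, thetaCl_apply]
  hecke g w := by
    rw [thetaCl_apply, mk_hecke ha, hecke_single]
    rfl

/-! ### Reduction -/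

theorem residue_tmul {M : Type*} [AddCommGroup M] [Module ZBar M] (c : ZBar) (x : M) :
    (1 : FBar) ⊗ₜ[ZBar] (c • x) = IsLocalRing.residue ZBar c • ((1 : FBar) ⊗ₜ[ZBar] x) := by
  rw [TensorProduct.tmul_smul, TensorProduct.smul_tmul', TensorProduct.smul_tmul', smul_eq_mul,
    mul_one, Algebra.smul_def, mul_one]
  rfl

theorem one_tmul_eq_zero_of_mem {M : Type*} [AddCommGroup M] [Module ZBar M] {x : M}
    (hx : x ∈ IsLocalRing.maximalIdeal ZBar • (⊤ : Submodule ZBar M)) :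
    (1 : FBar) ⊗ₜ[ZBar] x = 0 := by
  induction hx using Submodule.smul_induction_on' with
  | smul c hc y _ => rw [residue_tmul, (IsLocalRing.residue_eq_zero_iff c).2 hc, zero_smul]
  | add x _ y _ hx hy => rw [TensorProduct.tmul_add, hx, hy, add_zero]

section
variable {R S : Type*} [CommRing R] [CommRing S] [Algebra R S] {r : ℕ}

theorem coeffXY_symBaseChange (j : ℕ) (v : SymPow R r) :
    coeffXY S r j (symBaseChange R S r v) = algebraMap R S (coeffXY R r j v) :=
  MvPolynomial.coeff_map _ _ _

theorem symBaseChange_mono (j : ℕ) : symBaseChange R S r (mono R r j) = mono S r j := by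
  apply Subtype.ext
  change MvPolynomial.map (algebraMap R S) (X 0 ^ (r - j) * X 1 ^ min j r) = X 0 ^ _ * X 1 ^ _
  simp

theorem symBaseChange_surjective (h : Function.Surjective (algebraMap R S)) :
    Function.Surjective (symBaseChange R S r) := by
  intro v
  choose u hu using h
  refine ⟨∑ j ∈ Finset.range (r + 1), u (coeffXY S r j v) • mono R r j, ?_⟩
  rw [map_sum, sum_coeff_mono v]
  refine Finset.sum_congr rfl fun j _ => ?_
  rw [map_smul, symBaseChange_mono, ← algebraMap_smul S (u _), hu, ← sum_coeff_mono v]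

theorem indBaseChange_surjective [Algebra ℤ_[2] R] [Algebra ℤ_[2] S] [IsScalarTower ℤ_[2] R S]
    (h : Function.Surjective (algebraMap R S)) :
    Function.Surjective (indBaseChange R S r) := by
  intro f
  refine ind_induction Set.univ trivial (p := fun f => ∃ f', indBaseChange R S r f' = f)
    ⟨0, map_zero _⟩ ?_ f (fun _ => trivial)
  rintro g v _ _ ⟨f, rfl⟩
  obtain ⟨w, rfl⟩ := symBaseChange_surjective h v
  exact ⟨single g w + f, by rw [map_add, indBaseChange_single]⟩

end

theorem algebraMap_FBar_surjective : Function.Surjective (algebraMap ZBar FBar) :=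
  IsLocalRing.residue_surjective

section
variable {r : ℕ} {α : QBar}

theorem one_tmul_single_eq_zero {g : G} {v : SymPow ZBar r}
    (hv : symBaseChange ZBar FBar r v = 0) :
    (1 : FBar) ⊗ₜ[ZBar] (Submodule.Quotient.mk (single g v) : Theta r α) = 0 := by
  apply one_tmul_eq_zero_of_mem
  rw [← thetaCl_apply, sum_coeff_mono v, map_sum]
  refine Submodule.sum_mem _ fun j _ => ?_
  rw [map_smul]
  refine Submodule.smul_mem_smul ?_ Submodule.mem_top
  rw [← IsLocalRing.residue_eq_zero_iff]
  change algebraMap ZBar FBar _ = 0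
  rw [← coeffXY_symBaseChange, hv, map_zero]

/-- A function with zero reduction is a sum of [g, v] with v of zero reduction, and the coefficients
of such v lie in the maximal ideal. -/
theorem one_tmul_mk_eq_zero {f : ind ZBar r} (hf : indBaseChange ZBar FBar r f = 0) :
    (1 : FBar) ⊗ₜ[ZBar] (Submodule.Quotient.mk f : Theta r α) = 0 := by
  refine ind_induction {v | symBaseChange ZBar FBar r v = 0} (map_zero _)
    (p := fun f => (1 : FBar) ⊗ₜ[ZBar] (Submodule.Quotient.mk f : Theta r α) = 0)
    (by rw [Submodule.Quotient.mk_zero, TensorProduct.tmul_zero]) ?_ f (fun x => ?_)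
  · intro g v hv f hf
    rw [Submodule.Quotient.mk_add, TensorProduct.tmul_add, hf, one_tmul_single_eq_zero hv, add_zero]
  · have := congrArg (fun f => f.1 x) hf
    exact this

theorem one_tmul_mk_congr {f f' : ind ZBar r}
    (h : indBaseChange ZBar FBar r f = indBaseChange ZBar FBar r f') :
    (1 : FBar) ⊗ₜ[ZBar] (Submodule.Quotient.mk f : Theta r α) =
      (1 : FBar) ⊗ₜ[ZBar] (Submodule.Quotient.mk f' : Theta r α) := by
  rw [← sub_eq_zero, ← TensorProduct.tmul_sub, ← Submodule.Quotient.mk_sub]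
  exact one_tmul_mk_eq_zero (by rw [map_sub, h, sub_self])

/-- The natural map `I(V_r) → \bar Θ`. -/
def naturalMap (r : ℕ) (α : QBar) : ind FBar r →ₗ[FBar] ThetaBar r α :=
  -- By `one_tmul_mk_congr` the value does not depend on the lift, so a set-theoretic section
  -- suffices.
  let s := Function.surjInv (indBaseChange_surjective (r := r) algebraMap_FBar_surjective)
  have hs : ∀ x, indBaseChange ZBar FBar r (s x) = x := Function.surjInv_eq _
  { toFun := fun x => 1 ⊗ₜ[ZBar] Submodule.Quotient.mk (s x)
    map_add' := fun x y => by
      rw [← TensorProduct.tmul_add, ← Submodule.Quotient.mk_add]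
      exact one_tmul_mk_congr (by rw [map_add, hs, hs, hs])
    map_smul' := fun c x => by
      obtain ⟨d, rfl⟩ := algebraMap_FBar_surjective c
      rw [RingHom.id_apply]
      change _ = IsLocalRing.residue ZBar d • _
      rw [← residue_tmul, ← Submodule.Quotient.mk_smul]
      refine one_tmul_mk_congr ?_
      rw [map_smul, hs, hs, algebraMap_smul] }

theorem isNaturalMap_naturalMap : IsNaturalMap r α (naturalMap r α) := fun _ =>
  one_tmul_mk_congr
    (Function.surjInv_eq (indBaseChange_surjective algebraMap_FBar_surjective) _)

theorem IsNaturalMap.unique {P P' : ind FBar r →ₗ[FBar] ThetaBar r α} (h : IsNaturalMap r α P)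
    (h' : IsNaturalMap r α P') : P = P' := by
  ext1 f
  obtain ⟨f, rfl⟩ := indBaseChange_surjective algebraMap_FBar_surjective f
  rw [h, h']

theorem IsNaturalMap.surjective {P : ind FBar r →ₗ[FBar] ThetaBar r α} (h : IsNaturalMap r α P) :
    Function.Surjective P := by
  intro x
  induction x using TensorProduct.induction_on with
  | zero => exact ⟨0, map_zero _⟩
  | tmul c y =>
    obtain ⟨d, rfl⟩ := algebraMap_FBar_surjective c
    obtain ⟨f, rfl⟩ := Submodule.Quotient.mk_surjective _ y
    refine ⟨algebraMap ZBar FBar d • indBaseChange ZBar FBar r f, ?_⟩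
    rw [map_smul, h, TensorProduct.smul_tmul', smul_eq_mul, mul_one]
  | add x y hx hy =>
    obtain ⟨f, rfl⟩ := hx
    obtain ⟨f', rfl⟩ := hy
    exact ⟨f + f', map_add _ _ _⟩

theorem IsNaturalMap.equivariant {P : ind FBar r →ₗ[FBar] ThetaBar r α} (h : IsNaturalMap r α P)
    (g : G) (f : ind FBar r) : P (indRep FBar r g f) = thetaBarRep r α g (P f) := by
  obtain ⟨f, rfl⟩ := indBaseChange_surjective algebraMap_FBar_surjective f
  rw [← indBaseChange_indRep, h, h]
  rfl

theorem IsNaturalMap.apply_single {P : ind FBar r →ₗ[FBar] ThetaBar r α} (h : IsNaturalMap r α P)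
    (g : G) (v : SymPow ZBar r) :
    P (single g (symBaseChange ZBar FBar r v)) = 1 ⊗ₜ[ZBar] thetaCl r α g v := by
  rw [← indBaseChange_single, h, thetaCl_apply]

end

/-! ### Factorization through weight zero -/

section
variable {n : ℕ} {α : QBar} {P : ind FBar (n + 1) →ₗ[FBar] ThetaBar (n + 1) α}

theorem midSum_mono {R : Type*} [CommRing R] (hn : 1 ≤ n) :
    midSum R (n + 1) (mono R (n + 1) n) = constSym R 1 := by
  rw [midSum, LinearMap.comp_apply, LinearMap.sum_apply]
  congr 1
  rw [Finset.sum_eq_single n]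
  · rw [coeffXY_mono (Nat.le_succ n), if_pos rfl]
  · intro j _ hj
    rw [coeffXY_mono (Nat.le_succ n), if_neg hj]
  · intro h
    exact absurd (Finset.mem_Ioo.2 ⟨hn, Nat.lt_succ_self n⟩) h

theorem toIndV0_single_mono (hn : 1 ≤ n) (g : G) :
    toIndV0 (n + 1) (single g (mono FBar (n + 1) n)) = vertex FBar g := by
  rw [toIndV0, indMap_single, midSum_mono hn, vertex]

theorem toIndV0_surjective (hn : 1 ≤ n) : Function.Surjective (toIndV0 (n + 1)) := by
  rw [← LinearMap.range_eq_top, ← Submodule.ker_mkQ (LinearMap.range (toIndV0 (n + 1))),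
    LinearMap.ker_eq_top]
  refine ind_zero_ext fun g => ?_
  rw [LinearMap.zero_apply, Submodule.mkQ_apply, Submodule.Quotient.mk_eq_zero]
  exact ⟨_, toIndV0_single_mono hn g⟩

theorem constSym_injective {R : Type*} [CommRing R] : Function.Injective (constSym R) :=
  fun _ _ h => MvPolynomial.C_injective (Fin 2) R (congrArg Subtype.val h)

variable {a b : ZBar}

theorem one_tmul_thetaCl_mono (ha : algebraMap ZBar QBar a = α) (h0 : a ≠ 0) (hb : a * b = 2)
    (hb1 : b ∈ IsLocalRing.maximalIdeal ZBar) (g : G) {j : ℕ} (hj0 : 0 < j) (hj : j < n + 1) :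
    (1 : FBar) ⊗ₜ[ZBar] thetaCl (n + 1) α g (mono ZBar _ j) =
      1 ⊗ₜ[ZBar] thetaCl (n + 1) α g (mono ZBar _ n) := by
  obtain ⟨z, hz⟩ := (isHeckeClass_thetaCl ha h0).exists_mono_sub hb g hj0 hj (j := n) (by omega)
    (Nat.lt_succ_self n)
  rw [hz, TensorProduct.tmul_add, one_tmul_eq_zero_of_mem (Submodule.smul_mem_smul hb1
    Submodule.mem_top), add_zero]

theorem one_tmul_thetaCl_mono_zero (ha : algebraMap ZBar QBar a = α) (h0 : a ≠ 0)
    (hb : a * b = 2) (ha1 : a ∈ IsLocalRing.maximalIdeal ZBar) (hn : 1 ≤ n) (g : G) :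
    (1 : FBar) ⊗ₜ[ZBar] thetaCl (n + 1) α g (mono ZBar _ 0) = 0 := by
  obtain ⟨z, hz⟩ := (isHeckeClass_thetaCl (r := n + 1) ha h0).exists_mono_zero hb (by omega) g
  rw [hz]
  exact one_tmul_eq_zero_of_mem (Submodule.smul_mem_smul ha1 Submodule.mem_top)

/-- X^r and Y^r contribute nothing, and the middle monomials all contribute the same class. -/
theorem IsNaturalMap.apply_single_eq (h : IsNaturalMap (n + 1) α P)
    (ha : algebraMap ZBar QBar a = α) (h0 : a ≠ 0) (hb : a * b = 2)
    (ha1 : a ∈ IsLocalRing.maximalIdeal ZBar) (hb1 : b ∈ IsLocalRing.maximalIdeal ZBar)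
    (hn : 1 ≤ n) (g : G) (v : SymPow FBar (n + 1)) :
    P (single g v) = (∑ j ∈ Finset.Ioo 0 (n + 1), coeffXY FBar (n + 1) j v) •
      ((1 : FBar) ⊗ₜ[ZBar] thetaCl (n + 1) α g (mono ZBar _ n)) := by
  have hm : ∀ j, P (singleHom g (mono FBar (n + 1) j)) =
      1 ⊗ₜ[ZBar] thetaCl (n + 1) α g (mono ZBar _ j) := fun j => by
    rw [singleHom_apply, ← symBaseChange_mono (R := ZBar), h.apply_single]
  rw [← singleHom_apply]
  conv_lhs => rw [sum_coeff_mono v]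
  rw [map_sum, map_sum, Finset.sum_range_succ, Finset.sum_range_eq_add_Ico _ (Nat.succ_pos n),
    show Finset.Ico 1 (n + 1) = Finset.Ioo 0 (n + 1) by ext; simp; omega, Finset.sum_smul]
  simp only [map_smul, hm]
  rw [one_tmul_thetaCl_mono_zero ha h0 hb ha1 hn,
    ← (isHeckeClass_thetaCl ha h0).mono_rot, one_tmul_thetaCl_mono_zero ha h0 hb ha1 hn,
    smul_zero, smul_zero, zero_add, add_zero]
  refine Finset.sum_congr rfl fun j hj => ?_
  obtain ⟨hj0, hj⟩ := Finset.mem_Ioo.1 hj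
  rw [one_tmul_thetaCl_mono ha h0 hb hb1 g hj0 hj]

/-- The kernel consists of the functions with values in the kernel of `midSum`; by `ind_induction`
they are sums of elementary functions of that kind, each killed by P. -/
theorem IsNaturalMap.ker_le (h : IsNaturalMap (n + 1) α P)
    (ha : algebraMap ZBar QBar a = α) (h0 : a ≠ 0) (hb : a * b = 2)
    (ha1 : a ∈ IsLocalRing.maximalIdeal ZBar) (hb1 : b ∈ IsLocalRing.maximalIdeal ZBar)
    (hn : 1 ≤ n) : LinearMap.ker (toIndV0 (n + 1)) ≤ LinearMap.ker P := by
  intro f hf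
  refine ind_induction {v | midSum FBar (n + 1) v = 0} (map_zero _)
    (p := fun f => f ∈ LinearMap.ker P) (zero_mem _) ?_ f (fun x => ?_)
  · intro g v hv f hf
    refine add_mem ?_ hf
    have hv' : ∑ j ∈ Finset.Ioo 0 (n + 1), coeffXY FBar (n + 1) j v = 0 := by
      apply constSym_injective
      rw [map_zero]
      refine Eq.trans ?_ hv
      rw [midSum, LinearMap.comp_apply, LinearMap.sum_apply]
    rw [LinearMap.mem_ker, h.apply_single_eq ha h0 hb ha1 hb1 hn, hv', zero_smul]
  · have := congrArg (fun f => f.1 x) (LinearMap.mem_ker.1 hf)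
    exact this

theorem factor_vertex (h : IsNaturalMap (n + 1) α P) (hn : 1 ≤ n)
    {P₀ : ind FBar 0 →ₗ[FBar] ThetaBar (n + 1) α} (hP : P₀ ∘ₗ toIndV0 (n + 1) = P) (g : G) :
    P₀ (vertex FBar g) = 1 ⊗ₜ[ZBar] thetaCl (n + 1) α g (mono ZBar _ n) := by
  rw [← toIndV0_single_mono hn, ← LinearMap.comp_apply, hP, ← symBaseChange_mono (R := ZBar),
    h.apply_single]

end

/-! ### Hecke relations for the map on weight zero -/

theorem smul_add_eq_zero_char_two {k M : Type*} [CommRing k] [CharP k 2] [AddCommGroup M]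
    [Module k M] {c : k} {x y : M} (h : c • x + y = 0) (v : M) :
    y + (3 : k) • v - c • x + v = 0 := by
  have e : ∀ z : M, (2 : k) • z = 0 := fun z => by rw [CharTwo.two_eq_zero, zero_smul]
  linear_combination (norm := module) h + (2 : k) • e v - e (c • x)

section
variable {n : ℕ} {α : QBar} {a b : ZBar} {P : ind FBar (n + 1) →ₗ[FBar] ThetaBar (n + 1) α}
  {P₀ : ind FBar 0 →ₗ[FBar] ThetaBar (n + 1) α}

theorem factor_comp_hecke_of_even (h : IsNaturalMap (n + 1) α P) (hn : 1 ≤ n)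
    (hP : P₀ ∘ₗ toIndV0 (n + 1) = P) (ha : algebraMap ZBar QBar a = α) (h0 : a ≠ 0)
    (hb : a * b = 2) (hb1 : b ∈ IsLocalRing.maximalIdeal ZBar) (he : Even (n + 1)) :
    P₀ ∘ₗ hecke FBar 0 = 0 := by
  refine ind_zero_ext fun g => ?_
  obtain ⟨z, hz⟩ := (isHeckeClass_thetaCl ha h0).sum_mem_of_even hb hn he g
  have hz' := congrArg (fun x => (1 : FBar) ⊗ₜ[ZBar] x) hz
  simp only [TensorProduct.tmul_add, ← factor_vertex h hn hP, vertex_mul_K] at hz'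
  rw [LinearMap.comp_apply, hecke_vertex_rot, map_add, map_add, hz',
    one_tmul_eq_zero_of_mem (Submodule.smul_mem_smul hb1 Submodule.mem_top), LinearMap.zero_apply]

theorem factor_comp_hecke_of_lt (h : IsNaturalMap (n + 1) α P) (hn : 2 ≤ n)
    (hP : P₀ ∘ₗ toIndV0 (n + 1) = P) (ha : algebraMap ZBar QBar a = α) (h0 : a ≠ 0)
    (hb : a * b = 2) (ha1 : ‖α‖ < 1) (ha2 : 1 / 2 < ‖α‖) (he : Even n)
    (hlt : ‖(n : QBar)‖ * ‖α‖ / 2 < ‖α ^ 2 - 2 * ((n + 1 : ℕ) : QBar) ^ 2‖) :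
    P₀ ∘ₗ hecke FBar 0 = 0 := by
  subst ha
  have hna : (2 * n * a : ZBar) ≠ 0 := by
    intro h1
    have h2 := congrArg (algebraMap ZBar QBar) h1
    rw [map_mul, map_mul, map_ofNat, map_natCast, map_zero] at h2
    exact mul_ne_zero (mul_ne_zero two_ne_zero_QBar (natCast_ne_zero_QBar (by omega)))
      ((map_ne_zero_iff _ algebraMap_ZBar_injective).2 h0) h2
  refine ind_zero_ext fun g => ?_
  have hz := one_tmul_eq_zero_of_mem (mem_smul_top_of_lt theta_torsion_free hb (by omega) he ha1
    ha2 hlt ((isHeckeClass_thetaCl rfl h0).sum_mem_of_odd hb hn he (exists_dvd_pow ha1 hna) g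
      (E := fun g => thetaCl (n + 1) _ g (mono ZBar _ n)) (fun _ => rfl)))
  simp only [TensorProduct.tmul_add, ← factor_vertex h (by omega) hP] at hz
  rw [LinearMap.comp_apply, hecke_vertex_rot, map_add, map_add, hz, LinearMap.zero_apply]

theorem factor_comp_hecke_of_le (h : IsNaturalMap (n + 1) α P) (hn : 2 ≤ n)
    (hP : P₀ ∘ₗ toIndV0 (n + 1) = P) (ha : algebraMap ZBar QBar a = α) (h0 : a ≠ 0)
    (hb : a * b = 2) (ha1 : ‖α‖ < 1) (ha2 : 1 / 2 < ‖α‖) (he : Even n) {c : ZBar}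
    (hc : 2 * n * α * algebraMap ZBar QBar c = α ^ 2 - 2 * ((n + 1 : ℕ) : QBar) ^ 2) :
    P₀ ∘ₗ (hecke FBar 0 ^ 2 - IsLocalRing.residue ZBar c • hecke FBar 0 + 1) = 0 := by
  subst ha
  have hna : (2 * n * a : ZBar) ≠ 0 := by
    intro h1
    have h2 := congrArg (algebraMap ZBar QBar) h1
    rw [map_mul, map_mul, map_ofNat, map_natCast, map_zero] at h2
    exact mul_ne_zero (mul_ne_zero two_ne_zero_QBar (natCast_ne_zero_QBar (by omega)))
      ((map_ne_zero_iff _ algebraMap_ZBar_injective).2 h0) h2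
  refine ind_zero_ext fun g => ?_
  have hz := one_tmul_eq_zero_of_mem (mem_smul_top_of_le theta_torsion_free hb (by omega) he ha1
    ha2 hc ((isHeckeClass_thetaCl rfl h0).sum_mem_of_odd hb hn he (exists_dvd_pow ha1 hna) g
      (E := fun g => thetaCl (n + 1) _ g (mono ZBar _ n)) (fun _ => rfl)))
  rw [TensorProduct.tmul_add, residue_tmul] at hz
  simp only [TensorProduct.tmul_add, ← factor_vertex h (by omega) hP, ← map_add] at hz
  rw [← hecke_vertex_rot] at hz
  -- Here `hz` says that c·T plus the distance-two operator T² - 3 is killed; in characteristic two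
  -- this is T² - cT + 1.
  have h2 := hecke_sq_vertex (R := FBar) g
  rw [LinearMap.comp_apply, LinearMap.add_apply, LinearMap.sub_apply, LinearMap.smul_apply,
    pow_two, Module.End.mul_apply, Module.End.one_apply, h2, map_add, map_sub, map_add, map_smul,
    map_smul, LinearMap.zero_apply]
  exact smul_add_eq_zero_char_two hz _

theorem exists_factor {M N : Type*} [AddCommGroup M] [AddCommGroup N] [Module FBar M]
    [Module FBar N] {φ : M →ₗ[FBar] N} {T : Module.End FBar M} (h : φ ∘ₗ T = 0) :
    ∃ Q : (M ⧸ LinearMap.range T) →ₗ[FBar] N, Q ∘ₗ Submodule.mkQ _ = φ :=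
  ⟨Submodule.liftQ _ φ (LinearMap.range_le_ker_iff.2 h), Submodule.liftQ_mkQ _ _ _⟩

end

end TreeInd

end

/-! ### The theorem -/

open TreeInd in
theorem theorem3 (r : ℕ) (hr : 2 ≤ r) (a α' : QBar) (ha0 : 0 < val a) (ha1 : val a < 1)
    (hα' : α' = (a ^ 2 - 2 * (r : QBar) ^ 2) / (2 * a)) :
    (∃! P : ind FBar r →ₗ[FBar] ThetaBar r a, IsNaturalMap r a P) ∧
    ∀ P : ind FBar r →ₗ[FBar] ThetaBar r a, IsNaturalMap r a P →
      (∃! P₀ : ind FBar 0 →ₗ[FBar] ThetaBar r a, P₀ ∘ₗ toIndV0 r = P) ∧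
      ∀ P₀ : ind FBar 0 →ₗ[FBar] ThetaBar r a, P₀ ∘ₗ toIndV0 r = P →
        Function.Surjective P₀ ∧
        (∀ (g : G) (f : ind FBar 0), P₀ (indRep FBar 0 g f) = thetaBarRep r a g (P₀ f)) ∧
        (val α' < val ((r : QBar) - 1) →
          ∃ Q : (ind FBar 0 ⧸ LinearMap.range (hecke FBar 0)) →ₗ[FBar] ThetaBar r a,
            Q ∘ₗ Submodule.mkQ _ = P₀) ∧
        (val ((r : QBar) - 1) ≤ val α' →
          ∃ c : ZBar, algebraMap ZBar QBar c = α' / ((r : QBar) - 1) ∧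
            ∃ Q : (ind FBar 0 ⧸ LinearMap.range
                (hecke FBar 0 ^ 2 - IsLocalRing.residue ZBar c • hecke FBar 0 + 1)) →ₗ[FBar]
                ThetaBar r a,
              Q ∘ₗ Submodule.mkQ _ = P₀) := by
  obtain ⟨n, rfl⟩ : ∃ n, r = n + 1 := ⟨r - 1, by omega⟩
  have hn : 1 ≤ n := by omega
  rw [← val_one, val_lt_val, norm_one] at ha0
  rw [← val_two, val_lt_val, norm_two_QBar] at ha1
  have hane : a ≠ 0 := by rw [← norm_pos_iff]; linarith
  obtain ⟨A, hA⟩ := exists_ZBar ha0.le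
  have hA0 : A ≠ 0 := by rintro rfl; exact hane (by rw [← hA, map_zero])
  -- The bound v(a) < 1 puts b = 2/a in the maximal ideal.
  have hba : ‖2 / a‖ < 1 := by
    rw [norm_div, norm_two_QBar, div_lt_one (by linarith)]
    exact ha1
  obtain ⟨b, hb⟩ := exists_ZBar hba.le
  have hab : A * b = 2 := algebraMap_ZBar_injective (by
    rw [map_mul, hA, hb, map_ofNat, mul_div_cancel₀ _ hane])
  have hAm : A ∈ IsLocalRing.maximalIdeal ZBar := by rwa [mem_maximalIdeal_iff_norm, hA]
  have hbm : b ∈ IsLocalRing.maximalIdeal ZBar := by rwa [mem_maximalIdeal_iff_norm, hb]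
  refine ⟨⟨naturalMap _ a, isNaturalMap_naturalMap, fun P hP => hP.unique isNaturalMap_naturalMap⟩,
    fun P hP => ?_⟩
  have hsurj := toIndV0_surjective hn
  refine ⟨?_, fun P₀ hP₀ => ⟨?_, fun g f => ?_, ?_, ?_⟩⟩
  · let e := (toIndV0 (n + 1)).quotKerEquivOfSurjective hsurj
    have hker := hP.ker_le hA hA0 hab hAm hbm hn
    refine ⟨Submodule.liftQ _ P hker ∘ₗ e.symm.toLinearMap, ?_, ?_⟩
    · ext1 f
      have : e.symm (toIndV0 (n + 1) f) = Submodule.Quotient.mk f :=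
        (LinearEquiv.symm_apply_eq e).2 rfl
      change Submodule.liftQ _ P hker (e.symm (toIndV0 (n + 1) f)) = P f
      rw [this, Submodule.liftQ_apply]
    · intro P₁ hP₁
      ext1 f
      obtain ⟨f, rfl⟩ := hsurj f
      have : e.symm (toIndV0 (n + 1) f) = Submodule.Quotient.mk f :=
        (LinearEquiv.symm_apply_eq e).2 rfl
      change _ = Submodule.liftQ _ P hker (e.symm (toIndV0 (n + 1) f))
      rw [this, Submodule.liftQ_apply, ← hP₁, LinearMap.comp_apply]
  · have := hP.surjective
    rw [← hP₀, LinearMap.coe_comp] at this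
    exact this.of_comp
  · obtain ⟨f, rfl⟩ := hsurj f
    have h1 : indRep FBar 0 g (toIndV0 (n + 1) f) = toIndV0 (n + 1) (indRep FBar (n + 1) g f) :=
      rfl
    have h2 : ∀ f, P₀ (toIndV0 (n + 1) f) = P f := fun f => by rw [← hP₀, LinearMap.comp_apply]
    rw [h1, h2, h2, hP.equivariant]
  all_goals
    have hn1 : ((n + 1 : ℕ) : QBar) - 1 = n := by push_cast; ring
    have h2a : ‖2 * a‖ = ‖a‖ / 2 := by rw [norm_mul, norm_two_QBar]; ring
    have h2apos : 0 < ‖a‖ / 2 := by linarith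
  · intro hlt
    apply exists_factor
    rcases Nat.even_or_odd n with he | ho
    · refine factor_comp_hecke_of_lt hP (by obtain ⟨m, rfl⟩ := he; omega) hP₀ hA hA0 hab ha0 ha1
        he ?_
      rw [hn1, val_lt_val, hα', norm_div, h2a, lt_div_iff₀ h2apos] at hlt
      linarith
    · exact factor_comp_hecke_of_even hP hn hP₀ hA hA0 hab hbm ho.add_one
  · intro hle
    have hnn : (n : QBar) ≠ 0 := natCast_ne_zero_QBar (by omega)
    rw [hn1] at hle ⊢
    rw [val_le_val] at hle
    obtain ⟨c, hc⟩ := exists_ZBar (x := α' / n) (by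
      rw [norm_div]
      exact div_le_one_of_le₀ hle (norm_nonneg _))
    refine ⟨c, hc, exists_factor ?_⟩
    rcases Nat.even_or_odd n with he | ho
    · refine factor_comp_hecke_of_le hP (by obtain ⟨m, rfl⟩ := he; omega) hP₀ hA hA0 hab ha0 ha1
        he ?_
      rw [hc, hα']
      field_simp
    -- For even r, ‖2r²‖ ≤ 1/8 < 1/4 < ‖a‖², so τ' = v(a) - 1 is negative while t = 0.
    · exfalso
      have he := norm_natCast_even ho.add_one
      rw [hα', norm_div, h2a, norm_natCast_odd ho, div_le_one h2apos] at hle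
      have h1 : ‖2 * ((n + 1 : ℕ) : QBar) ^ 2‖ ≤ 1 / 8 := by
        rw [norm_mul, norm_pow, norm_two_QBar]
        have := norm_nonneg ((n + 1 : ℕ) : QBar)
        nlinarith
      rw [norm_sub_eq_left, norm_pow] at hle
      · nlinarith
      · rw [norm_pow]
        nlinarith
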